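/- Let $F\in C^2(\mathbb R,\mathbb R)$ satisfy $0=F(0)=\min_{\mathbb R}F$ and \[ 6\limsup_{t\to-\infty}\frac{F(t)}{t^2}<F''(0). \] Then, for (Lebesgue) almost every $q>0$ such that \[ 24\limsup_{t\to-\infty}\frac{F(t)}{t^2}<q^2<4F''(0), \] the Swift–Hohenberg equation $u''''+qu''+F'(u)=0$ on $\mathbb R$ has a nontrivial (i.e. non-constant) periodic solution $u\in C^4(\mathbb R)$. -/

import Mathlib

open Filter MeasureTheory

/-- `u : ℝ → ℝ` is a (classical, globally defined) solution of the Swift–Hohenberg equation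
`u'''' + q u'' + F'(u) = 0`. -/
def IsSwiftHohenbergSolution (F : ℝ → ℝ) (q : ℝ) (u : ℝ → ℝ) : Prop :=
  ContDiff ℝ 4 u ∧
    ∀ x : ℝ, iteratedDeriv 4 u x + q * iteratedDeriv 2 u x + deriv F (u x) = 0

/-- `u` is a nontrivial periodic function: it has some period `P > 0` and is not constant. -/
def IsNontrivialPeriodic (u : ℝ → ℝ) : Prop :=
  (∃ P : ℝ, 0 < P ∧ Function.Periodic u P) ∧ ¬ ∃ c : ℝ, ∀ x : ℝ, u x = c

/-- `limsup_{t → -∞} F(t) / t²`, as an extended real number. -/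
noncomputable def limsupQuotAtBot (F : ℝ → ℝ) : EReal :=
  limsup (fun t : ℝ => ((F t / t ^ 2 : ℝ) : EReal)) atBot

/-! Between two consecutive turning points a solution is monotone. Such a lap, from height a to
height b = a + h, is described by its velocity as a function of the normalised height s. In the
variable y = (u')^{3/2} the action ∫ (u''²/2 − q u'²/2 + F(u) + e) dx becomes (2/(9h)) ∫ y'² −
(qh/2) ∫ y^{2/3} + h ∫ (F + e) y^{-2/3}. For q ≥ 0 and e > 0 this is strongly convex, because F ≥ 0.
So every pair a < b carries a unique minimal lap, and its Euler–Lagrange equation is the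
Swift–Hohenberg equation on the energy level u'u''' − u''²/2 + q u'²/2 + F(u) + e = 0
(`exists_isEnergyMin`, `IsEnergyMin.ode`, `exists_lapProfile`).

The problem is thereby reduced to the least action S(a, b), a function of two variables. It is
semiconcave, and the coefficients of its first order expansion are u''' at the lower end and −u'''
at the upper end (`IsPotential.exists_profile`). If both vanish, reflecting the lap at its turning
points gives an even periodic solution (`Lap.exists_periodic`).

On the quadrant a ≤ 0 ≤ b the function S has a mountain pass. Near the origin q² < 4F''(0) makes a
quadratic form positive definite, and S is bounded below by a multiple of a² + b²
(`LapProfile.barrier`), while S is small on very small laps if e is small. Far away a cosine-shaped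
lap from −H to 0 has negative action because 24 limsup F/t² < q²
(`IsPotential.exists_lapAction_neg`). Critical points on the sides a = 0 or b = 0 are excluded away
from the origin: the equilibrium is a saddle-focus, so a lap leaving it slowly with u''' of the
wrong sign would have to turn back too early (`Lap.false_of_saddleFocus`).

Compactness at infinity comes from Struwe's monotonicity trick. S decreases in q, so the pass level
is monotone in q and differentiable almost everywhere. Where it is differentiable, nearly optimal
paths for slightly smaller q' have a bounded difference quotient of S in q at their high points.
This bounds ∫ u'², hence the duration and the height of the lap (`IsPotential.height_le`). Projected
gradient steps on the resulting compact region (`exists_deformation`) then produce a critical point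
(`IsPotential.exists_isKKT`). -/

section

open Set Topology

/-! ### Square integrable derivatives and their primitives. -/

/-- The Hilbert space of square integrable functions on the unit interval. -/
noncomputable abbrev L2I := Lp ℝ 2 (volume.restrict (Ioc (0 : ℝ) 1))

/-- The indicator function of `(0, s]`. -/
noncomputable def brownKer (s : ℝ) : L2I :=
  indicatorConstLp 2 (measurableSet_Iic (a := s)) (measure_ne_top _ _) 1

/-- The primitive of `g` vanishing at `0`. -/
noncomputable def prim (g : L2I) (s : ℝ) : ℝ := inner ℝ (brownKer s) g

/-- These are the reproducing kernels of primitives vanishing at 0: pairing with one evaluates a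
primitive, so point values are continuous linear functionals of the derivative. -/
lemma inner_brownKer {s t : ℝ} (hs : s ∈ Icc (0 : ℝ) 1) (ht : t ∈ Icc (0 : ℝ) 1) :
    inner ℝ (brownKer s) (brownKer t) = min s t := by
  unfold brownKer
  rw [L2.real_inner_indicatorConstLp_one_indicatorConstLp_one]
  rw [measureReal_def, Measure.restrict_apply (measurableSet_Iic.inter measurableSet_Iic),
    Iic_inter_Iic]
  have : Iic (s ⊓ t) ∩ Ioc 0 1 = Ioc 0 (min s t) := by
    ext x
    have h1 : min s t ≤ 1 := (min_le_left _ _).trans hs.2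
    simp only [mem_inter_iff, mem_Iic, mem_Ioc]
    constructor
    · rintro ⟨h, h2, h3⟩; exact ⟨h2, h⟩
    · rintro ⟨h, h2⟩; exact ⟨h2, h, h2.trans h1⟩
  rw [this, Real.volume_Ioc, sub_zero, ENNReal.toReal_ofReal (le_min hs.1 ht.1)]

lemma prim_add (g k : L2I) (s : ℝ) : prim (g + k) s = prim g s + prim k s := inner_add_right ..

lemma prim_sub (g k : L2I) (s : ℝ) : prim (g - k) s = prim g s - prim k s := inner_sub_right ..

lemma prim_smul (c : ℝ) (g : L2I) (s : ℝ) : prim (c • g) s = c * prim g s :=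
  real_inner_smul_right ..

lemma prim_brownKer {s t : ℝ} (hs : s ∈ Icc (0 : ℝ) 1) (ht : t ∈ Icc (0 : ℝ) 1) :
    prim (brownKer t) s = min s t := inner_brownKer hs ht

lemma norm_brownKer_sq {s : ℝ} (hs : s ∈ Icc (0 : ℝ) 1) : ‖brownKer s‖ ^ 2 = s := by
  rw [← real_inner_self_eq_norm_sq, inner_brownKer hs hs, min_self]

lemma norm_brownKer_le {s : ℝ} (hs : s ∈ Icc (0 : ℝ) 1) : ‖brownKer s‖ ≤ 1 := by
  have := norm_brownKer_sq hs
  have h1 := hs.2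
  nlinarith [norm_nonneg (brownKer s)]

lemma abs_prim_le (g : L2I) {s : ℝ} (hs : s ∈ Icc (0 : ℝ) 1) : |prim g s| ≤ ‖g‖ := by
  calc |prim g s| ≤ ‖brownKer s‖ * ‖g‖ := abs_real_inner_le_norm _ _
    _ ≤ 1 * ‖g‖ := by gcongr; exact norm_brownKer_le hs
    _ = ‖g‖ := one_mul _

lemma prim_zero (g : L2I) : prim g 0 = 0 := by
  have h : ‖brownKer 0‖ ^ 2 = 0 := norm_brownKer_sq ⟨le_rfl, zero_le_one⟩
  have h2 : brownKer 0 = 0 := by simpa using h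
  simp [prim, h2]

lemma prim_eq_integral (g : L2I) {s : ℝ} (hs : s ∈ Icc (0 : ℝ) 1) :
    prim g s = ∫ t in (0 : ℝ)..s, g t := by
  unfold prim brownKer
  rw [L2.inner_indicatorConstLp_one, intervalIntegral.integral_of_le hs.1,
    Measure.restrict_restrict measurableSet_Iic]
  congr 2
  ext x
  simp only [mem_inter_iff, mem_Iic, mem_Ioc]
  constructor
  · rintro ⟨h, h2, h3⟩; exact ⟨h2, h⟩
  · rintro ⟨h, h2⟩; exact ⟨h2, h, h2.trans hs.2⟩

lemma brownKer_continuousOn : ContinuousOn brownKer (Icc 0 1) := by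
  rw [Metric.continuousOn_iff]
  intro s hs ε hε
  refine ⟨ε ^ 2, by positivity, fun t ht hd => ?_⟩
  rw [dist_eq_norm]
  have h : ‖brownKer t - brownKer s‖ ^ 2 = |t - s| := by
    rw [← real_inner_self_eq_norm_sq, inner_sub_left, inner_sub_right, inner_sub_right,
      inner_brownKer hs hs, inner_brownKer ht ht, inner_brownKer hs ht, inner_brownKer ht hs]
    rcases le_total s t with h | h
    · rw [abs_of_nonneg (by linarith), min_eq_right h, min_eq_left h, min_self, min_self]; ring
    · rw [abs_of_nonpos (by linarith), min_eq_left h, min_eq_right h, min_self, min_self]; ring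
  rw [Real.dist_eq] at hd
  exact lt_of_pow_lt_pow_left₀ 2 hε.le (by rw [h]; exact hd)

lemma prim_continuousOn (g : L2I) : ContinuousOn (prim g) (Icc 0 1) :=
  brownKer_continuousOn.inner continuousOn_const

lemma tendsto_prim {ι : Type*} {l : Filter ι} {g : ι → L2I} {g₀ : L2I} (h : Tendsto g l (𝓝 g₀))
    (s : ℝ) : Tendsto (fun i => prim (g i) s) l (𝓝 (prim g₀ s)) :=
  tendsto_const_nhds.inner h

/-- A function with square integrable derivative is represented by its derivative. -/
lemma exists_prim_eq {f f' : ℝ → ℝ} (hf : ContinuousOn f (Icc 0 1))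
    (hd : ∀ s ∈ Ioo (0 : ℝ) 1, HasDerivAt f (f' s) s) (h0 : f 0 = 0)
    (hm : MemLp f' 2 (volume.restrict (Ioc 0 1))) :
    ∃ g : L2I, (∀ s ∈ Icc (0 : ℝ) 1, prim g s = f s) ∧ ‖g‖ ^ 2 = ∫ s in (0 : ℝ)..1, f' s ^ 2 := by
  have hint : IntegrableOn f' (Ioc 0 1) := hm.integrable (by norm_num)
  refine ⟨hm.toLp f', fun s hs => ?_, ?_⟩
  · rw [prim_eq_integral _ hs]
    have hsub : Ioc 0 s ⊆ Ioc (0 : ℝ) 1 := Ioc_subset_Ioc_right hs.2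
    have e1 : ∫ t in (0 : ℝ)..s, (hm.toLp f') t = ∫ t in (0 : ℝ)..s, f' t := by
      rw [intervalIntegral.integral_of_le hs.1, intervalIntegral.integral_of_le hs.1]
      exact integral_congr_ae (ae_restrict_of_ae_restrict_of_subset hsub hm.coeFn_toLp)
    rw [e1, intervalIntegral.integral_eq_sub_of_hasDerivAt_of_le hs.1
      (hf.mono (Icc_subset_Icc_right hs.2)) (fun t ht => hd t ⟨ht.1, ht.2.trans_le hs.2⟩), h0,
      sub_zero]
    rw [intervalIntegrable_iff_integrableOn_Ioc_of_le hs.1]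
    exact hint.mono_set hsub
  · rw [← real_inner_self_eq_norm_sq, L2.inner_def, intervalIntegral.integral_of_le zero_le_one]
    refine integral_congr_ae ?_
    filter_upwards [hm.coeFn_toLp] with t ht
    rw [ht]; simp [sq]

/-! ### Profiles above a parabola and their singular integrals. -/

/-- `g` has mean zero and its primitive lies above the parabola `η s (1 - s)`. -/
def Above (η : ℝ) (g : L2I) : Prop :=
  prim g 1 = 0 ∧ ∀ s ∈ Icc (0 : ℝ) 1, η * (s * (1 - s)) ≤ prim g s

lemma Above.mono {η η' : ℝ} {g : L2I} (h : Above η g) (hη : η' ≤ η) : Above η' g :=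
  ⟨h.1, fun s hs => (mul_le_mul_of_nonneg_right hη
    (mul_nonneg hs.1 (by linarith [hs.2]))).trans (h.2 s hs)⟩

lemma Above.pos {η : ℝ} {g : L2I} (h : Above η g) (hη : 0 < η) {s : ℝ} (hs : s ∈ Ioo (0 : ℝ) 1) :
    0 < prim g s :=
  (mul_pos hη (mul_pos hs.1 (by linarith [hs.2]))).trans_le (h.2 s ⟨hs.1.le, hs.2.le⟩)

lemma Above.nonneg {η : ℝ} {g : L2I} (h : Above η g) (hη : 0 < η) {s : ℝ}
    (hs : s ∈ Icc (0 : ℝ) 1) : 0 ≤ prim g s :=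
  (mul_nonneg hη.le (mul_nonneg hs.1 (by linarith [hs.2]))).trans (h.2 s hs)

/-- With `Above.of_tendsto`, this gives the convexity and closedness of the constraint set needed by
the direct method. -/
lemma Above.midpoint {η : ℝ} {g k : L2I} (hg : Above η g) (hk : Above η k) :
    Above η ((1 / 2 : ℝ) • (g + k)) := by
  refine ⟨by rw [prim_smul, prim_add, hg.1, hk.1]; ring, fun s hs => ?_⟩
  rw [prim_smul, prim_add]
  linarith [hg.2 s hs, hk.2 s hs]

lemma Above.of_tendsto {η : ℝ} {g : ℕ → L2I} {g₀ : L2I} (hg : ∀ n, Above η (g n))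
    (h : Tendsto g atTop (𝓝 g₀)) : Above η g₀ :=
  ⟨tendsto_nhds_unique (tendsto_prim h 1) (by simp [fun n => (hg n).1]),
    fun s hs => ge_of_tendsto' (tendsto_prim h s) fun n => (hg n).2 s hs⟩

/-- The singularities sit at the two ends. On either half of the interval one factor is at least 1/2
and the other carries an integrable power. -/
lemma intervalIntegrable_parabola_rpow {r : ℝ} (hr : -1 < r) (hr0 : r ≤ 0) :
    IntervalIntegrable (fun s : ℝ => (s * (1 - s)) ^ r) volume 0 1 := by
  have h1 : IntervalIntegrable (fun s : ℝ => s ^ r) volume 0 1 :=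
    intervalIntegral.intervalIntegrable_rpow' hr
  have h2 : IntervalIntegrable (fun s : ℝ => (1 - s) ^ r) volume 0 1 := by
    simpa using (h1.comp_sub_left 1).symm
  refine ((h1.add h2).const_mul ((1 / 2 : ℝ) ^ r)).mono_fun ?_ ?_
  · exact (Measurable.pow_const (by fun_prop) r).aestronglyMeasurable
  · rw [uIoc_of_le zero_le_one]
    filter_upwards [ae_restrict_mem measurableSet_Ioc] with s hs
    have hs0 := hs.1
    have hs1 : 0 ≤ 1 - s := by linarith [hs.2]
    have a1 := Real.rpow_nonneg hs0.le r
    have a2 := Real.rpow_nonneg hs1 r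
    have a3 : (0 : ℝ) < (1 / 2 : ℝ) ^ r := by positivity
    have a4 : 0 ≤ (1 / 2 : ℝ) ^ r * (s ^ r + (1 - s) ^ r) := by positivity
    rw [Real.norm_of_nonneg (Real.rpow_nonneg (mul_nonneg hs0.le hs1) r), Real.norm_of_nonneg a4,
      Real.mul_rpow hs0.le hs1]
    rcases le_total s (1 / 2) with h | h
    · have : (1 - s) ^ r ≤ (1 / 2 : ℝ) ^ r :=
        Real.rpow_le_rpow_of_nonpos (by norm_num) (by linarith) hr0
      nlinarith [mul_nonneg a3.le a2]
    · have : s ^ r ≤ (1 / 2 : ℝ) ^ r := Real.rpow_le_rpow_of_nonpos (by norm_num) h hr0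
      nlinarith [mul_nonneg a3.le a1]

lemma Above.rpow_neg_le {η : ℝ} {g : L2I} (h : Above η g) (hη : 0 < η) {s : ℝ}
    (hs : s ∈ Ioc (0 : ℝ) 1) :
    (prim g s) ^ (-(2 / 3) : ℝ) ≤ (η * (s * (1 - s))) ^ (-(2 / 3) : ℝ) := by
  rcases hs.2.lt_or_eq with h1 | rfl
  · exact Real.rpow_le_rpow_of_nonpos (mul_pos hη (mul_pos hs.1 (by linarith)))
      (h.2 s ⟨hs.1.le, hs.2⟩) (by norm_num)
  -- At the end point both bases vanish, and a negative power of zero has the default value 0.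
  · rw [h.1]; simp

lemma intervalIntegrable_barrier (η : ℝ) (hη : 0 < η) :
    IntervalIntegrable (fun s : ℝ => (η * (s * (1 - s))) ^ (-(2 / 3) : ℝ)) volume 0 1 := by
  refine ((intervalIntegrable_parabola_rpow (r := -(2 / 3)) (by norm_num)
    (by norm_num)).const_mul (η ^ (-(2 / 3) : ℝ))).congr (fun s hs => ?_)
  rw [uIoc_of_le zero_le_one] at hs
  exact (Real.mul_rpow hη.le (mul_nonneg hs.1.le (by linarith [hs.2]))).symm

lemma aestronglyMeasurable_mul_prim_rpow (g : L2I) {k : ℝ → ℝ} (hk : ContinuousOn k (Icc 0 1))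
    (r : ℝ) : AEStronglyMeasurable (fun s => k s * (prim g s) ^ r)
      (volume.restrict (uIoc (0 : ℝ) 1)) := by
  rw [uIoc_of_le zero_le_one]
  have h1 : AEMeasurable (prim g) (volume.restrict (Ioc (0 : ℝ) 1)) :=
    ((prim_continuousOn g).mono Ioc_subset_Icc_self).aemeasurable measurableSet_Ioc
  have h2 : AEMeasurable k (volume.restrict (Ioc (0 : ℝ) 1)) :=
    (hk.mono Ioc_subset_Icc_self).aemeasurable measurableSet_Ioc
  exact (h2.mul (h1.pow_const r)).aestronglyMeasurable

lemma Above.intervalIntegrable {η : ℝ} {g : L2I} (h : Above η g) (hη : 0 < η) {k : ℝ → ℝ}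
    (hk : ContinuousOn k (Icc 0 1)) :
    IntervalIntegrable (fun s => k s * (prim g s) ^ (-(2 / 3) : ℝ)) volume 0 1 := by
  obtain ⟨C, hC⟩ := isCompact_Icc.exists_bound_of_continuousOn hk
  refine ((intervalIntegrable_barrier η hη).const_mul C).mono_fun
    (aestronglyMeasurable_mul_prim_rpow g hk _) ?_
  rw [uIoc_of_le zero_le_one]
  filter_upwards [ae_restrict_mem measurableSet_Ioc] with s hs
  have hs' : s ∈ Icc (0 : ℝ) 1 := ⟨hs.1.le, hs.2⟩
  have hC0 : 0 ≤ C := (norm_nonneg _).trans (hC s hs')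
  rw [norm_mul, Real.norm_of_nonneg (Real.rpow_nonneg (h.nonneg hη hs') _)]
  refine (mul_le_mul (hC s hs') (h.rpow_neg_le hη hs) (Real.rpow_nonneg (h.nonneg hη hs') _)
    hC0).trans (le_abs_self _)

lemma intervalIntegrable_prim_rpow (g : L2I) {r : ℝ} (hr : 0 ≤ r) :
    IntervalIntegrable (fun s => (prim g s) ^ r) volume 0 1 := by
  refine ContinuousOn.intervalIntegrable ?_
  rw [uIcc_of_le zero_le_one]
  exact (prim_continuousOn g).rpow_const fun _ _ => Or.inr hr

/-- Dominated convergence for weighted integrals of a negative power of the primitive. -/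
lemma tendsto_integral_prim_rpow_neg {ι : Type*} {l : Filter ι} [l.IsCountablyGenerated]
    {g : ι → L2I} {g₀ : L2I} {k : ι → ℝ → ℝ} {k₀ : ℝ → ℝ} {η C : ℝ} (hη : 0 < η)
    (hg : Tendsto g l (𝓝 g₀)) (ha : ∀ᶠ i in l, Above η (g i)) (h0 : Above η g₀)
    (hk : ∀ᶠ i in l, ContinuousOn (k i) (Icc 0 1))
    (hkC : ∀ᶠ i in l, ∀ s ∈ Icc (0 : ℝ) 1, |k i s| ≤ C)
    (hlim : ∀ s ∈ Icc (0 : ℝ) 1, Tendsto (fun i => k i s) l (𝓝 (k₀ s))) :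
    Tendsto (fun i => ∫ s in (0 : ℝ)..1, k i s * (prim (g i) s) ^ (-(2 / 3) : ℝ)) l
      (𝓝 (∫ s in (0 : ℝ)..1, k₀ s * (prim g₀ s) ^ (-(2 / 3) : ℝ))) := by
  refine intervalIntegral.tendsto_integral_filter_of_dominated_convergence
    (fun s => C * (η * (s * (1 - s))) ^ (-(2 / 3) : ℝ)) ?_ ?_
    ((intervalIntegrable_barrier η hη).const_mul C) ?_
  · filter_upwards [hk] with i hi
    exact aestronglyMeasurable_mul_prim_rpow _ hi _
  · filter_upwards [ha, hkC] with i hi hC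
    refine ae_of_all _ fun s hs => ?_
    rw [uIoc_of_le zero_le_one] at hs
    have hs' : s ∈ Icc (0 : ℝ) 1 := ⟨hs.1.le, hs.2⟩
    rw [norm_mul, Real.norm_of_nonneg (Real.rpow_nonneg (hi.nonneg hη hs') _)]
    exact mul_le_mul (hC s hs') (hi.rpow_neg_le hη hs) (Real.rpow_nonneg (hi.nonneg hη hs') _)
      ((abs_nonneg _).trans (hC s hs'))
  · refine ae_of_all _ fun s hs => ?_
    rw [uIoc_of_le zero_le_one] at hs
    have hs' : s ∈ Icc (0 : ℝ) 1 := ⟨hs.1.le, hs.2⟩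
    refine (hlim s hs').mul ?_
    rcases hs.2.lt_or_eq with h1 | rfl
    · exact (tendsto_prim hg s).rpow_const (Or.inl (h0.pos hη ⟨hs.1, h1⟩).ne')
    · rw [h0.1]
      refine tendsto_const_nhds.congr' ?_
      filter_upwards [ha] with i hi
      rw [hi.1]

lemma tendsto_integral_prim_rpow {ι : Type*} {l : Filter ι} [l.IsCountablyGenerated]
    {g : ι → L2I} {g₀ : L2I} (hg : Tendsto g l (𝓝 g₀)) {r : ℝ} (hr : 0 < r) :
    Tendsto (fun i => ∫ s in (0 : ℝ)..1, (prim (g i) s) ^ r) l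
      (𝓝 (∫ s in (0 : ℝ)..1, (prim g₀ s) ^ r)) := by
  have hb : ∀ᶠ i in l, ‖g i‖ ≤ ‖g₀‖ + 1 := by
    filter_upwards [hg.norm.eventually (gt_mem_nhds (lt_add_one ‖g₀‖))] with i hi using hi.le
  refine intervalIntegral.tendsto_integral_filter_of_dominated_convergence
    (fun _ => (‖g₀‖ + 1) ^ r) ?_ ?_ intervalIntegrable_const ?_
  · filter_upwards with i
    simpa using aestronglyMeasurable_mul_prim_rpow (g i) (k := fun _ => 1) continuousOn_const r
  · filter_upwards [hb] with i hi
    refine ae_of_all _ fun s hs => ?_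
    rw [uIoc_of_le zero_le_one] at hs
    have hs' : s ∈ Icc (0 : ℝ) 1 := ⟨hs.1.le, hs.2⟩
    refine (Real.abs_rpow_le_abs_rpow _ _).trans ?_
    exact Real.rpow_le_rpow (abs_nonneg _) ((abs_prim_le _ hs').trans hi) hr.le
  · refine ae_of_all _ fun s hs => ?_
    exact (tendsto_prim hg s).rpow_const (Or.inr hr.le)

/-! ### The convex energy and its minimiser above a barrier. -/

/-- The convex functional `α ∫ y'² - β ∫ y^{2/3} + ∫ w y^{-2/3}`, where `y' = g`. -/
noncomputable def energy (α β : ℝ) (w : ℝ → ℝ) (g : L2I) : ℝ :=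
  α * ‖g‖ ^ 2 - β * (∫ s in (0 : ℝ)..1, (prim g s) ^ (2 / 3 : ℝ)) +
    ∫ s in (0 : ℝ)..1, w s * (prim g s) ^ (-(2 / 3) : ℝ)

lemma rpow_midpoint_ge {x y : ℝ} (hx : 0 ≤ x) (hy : 0 ≤ y) :
    (x ^ (2 / 3 : ℝ) + y ^ (2 / 3 : ℝ)) / 2 ≤ (1 / 2 * (x + y)) ^ (2 / 3 : ℝ) := by
  have h := (Real.concaveOn_rpow (p := 2 / 3) (by norm_num) (by norm_num)).2
    (show x ∈ Ici (0 : ℝ) from hx) (show y ∈ Ici (0 : ℝ) from hy)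
    (show (0 : ℝ) ≤ 1 / 2 by norm_num) (show (0 : ℝ) ≤ 1 / 2 by norm_num) (by norm_num)
  simp only [smul_eq_mul] at h
  rw [mul_add]
  linarith

/-- Concavity of x^{2/3}, followed by the inequality between harmonic and arithmetic means. -/
lemma rpow_neg_midpoint_le {x y : ℝ} (hx : 0 < x) (hy : 0 < y) :
    (1 / 2 * (x + y)) ^ (-(2 / 3) : ℝ) ≤ (x ^ (-(2 / 3) : ℝ) + y ^ (-(2 / 3) : ℝ)) / 2 := by
  have h := rpow_midpoint_ge hx.le hy.le
  rw [Real.rpow_neg (by positivity), Real.rpow_neg hx.le, Real.rpow_neg hy.le]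
  have h1 : 0 < x ^ (2 / 3 : ℝ) := by positivity
  have h2 : 0 < y ^ (2 / 3 : ℝ) := by positivity
  set a := x ^ (2 / 3 : ℝ)
  set b := y ^ (2 / 3 : ℝ)
  calc ((1 / 2 * (x + y)) ^ (2 / 3 : ℝ))⁻¹ ≤ ((a + b) / 2)⁻¹ := inv_anti₀ (by positivity) h
    _ ≤ (a⁻¹ + b⁻¹) / 2 := by
      rw [← sub_nonneg]
      have : (a⁻¹ + b⁻¹) / 2 - ((a + b) / 2)⁻¹ = (a - b) ^ 2 / (2 * a * b * (a + b)) := by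
        field_simp; ring
      rw [this]; positivity

lemma integral_prim_rpow_le (g : L2I) {η : ℝ} (h : Above η g) (hη : 0 < η) :
    ∫ s in (0 : ℝ)..1, (prim g s) ^ (2 / 3 : ℝ) ≤ 1 + ‖g‖ := by
  have : ∫ s in (0 : ℝ)..1, (prim g s) ^ (2 / 3 : ℝ) ≤ ∫ _s in (0 : ℝ)..1, (1 + ‖g‖) := by
    refine intervalIntegral.integral_mono_on zero_le_one
      (intervalIntegrable_prim_rpow g (by norm_num)) intervalIntegrable_const fun s hs => ?_
    have h0 := h.nonneg hη hs
    have h1 := (le_abs_self _).trans (abs_prim_le g hs)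
    rcases le_total (prim g s) 1 with h2 | h2
    · linarith [Real.rpow_le_one h0 h2 (show (0 : ℝ) ≤ 2 / 3 by norm_num), norm_nonneg g]
    · have := Real.rpow_le_rpow_of_exponent_le h2 (show (2 / 3 : ℝ) ≤ 1 by norm_num)
      rw [Real.rpow_one] at this
      linarith
  simpa using this

/-- The parallelogram law makes the kinetic term uniformly convex. The functions −y^{2/3} and
y^{-2/3} are convex and enter with nonnegative weights. -/
lemma energy_midpoint_le {α β : ℝ} {w : ℝ → ℝ} (hβ : 0 ≤ β)
    (hw : ContinuousOn w (Icc 0 1)) (hw0 : ∀ s ∈ Icc (0 : ℝ) 1, 0 ≤ w s) {η : ℝ} (hη : 0 < η)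
    {g k : L2I} (hg : Above η g) (hk : Above η k) :
    energy α β w ((1 / 2 : ℝ) • (g + k)) ≤
      (energy α β w g + energy α β w k) / 2 - α / 4 * ‖g - k‖ ^ 2 := by
  have hn : ‖(1 / 2 : ℝ) • (g + k)‖ ^ 2 = (‖g‖ ^ 2 + ‖k‖ ^ 2) / 2 - ‖g - k‖ ^ 2 / 4 := by
    rw [norm_smul, mul_pow, Real.norm_of_nonneg (by norm_num)]
    have := parallelogram_law_with_norm ℝ g k
    nlinarith
  have hi := hg.midpoint hk
  have e1 : ((∫ s in (0 : ℝ)..1, (prim g s) ^ (2 / 3 : ℝ)) +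
      ∫ s in (0 : ℝ)..1, (prim k s) ^ (2 / 3 : ℝ)) / 2 ≤
      ∫ s in (0 : ℝ)..1, (prim ((1 / 2 : ℝ) • (g + k)) s) ^ (2 / 3 : ℝ) := by
    rw [← intervalIntegral.integral_add (intervalIntegrable_prim_rpow g (by norm_num))
      (intervalIntegrable_prim_rpow k (by norm_num)), ← intervalIntegral.integral_div]
    refine intervalIntegral.integral_mono_on zero_le_one
      (((intervalIntegrable_prim_rpow g (by norm_num)).add
      (intervalIntegrable_prim_rpow k (by norm_num))).div_const 2)
      (intervalIntegrable_prim_rpow _ (by norm_num)) fun s hs => ?_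
    rw [prim_smul, prim_add]
    exact rpow_midpoint_ge (hg.nonneg hη hs) (hk.nonneg hη hs)
  have e2 : ∫ s in (0 : ℝ)..1, w s * (prim ((1 / 2 : ℝ) • (g + k)) s) ^ (-(2 / 3) : ℝ) ≤
      ((∫ s in (0 : ℝ)..1, w s * (prim g s) ^ (-(2 / 3) : ℝ)) +
      ∫ s in (0 : ℝ)..1, w s * (prim k s) ^ (-(2 / 3) : ℝ)) / 2 := by
    rw [← intervalIntegral.integral_add (hg.intervalIntegrable hη hw)
      (hk.intervalIntegrable hη hw), ← intervalIntegral.integral_div]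
    refine intervalIntegral.integral_mono_on_of_le_Ioo zero_le_one
      (hi.intervalIntegrable hη hw)
      (((hg.intervalIntegrable hη hw).add (hk.intervalIntegrable hη hw)).div_const 2)
      fun s hs => ?_
    rw [prim_smul, prim_add]
    have := rpow_neg_midpoint_le (hg.pos hη hs) (hk.pos hη hs)
    have := mul_le_mul_of_nonneg_left this (hw0 s ⟨hs.1.le, hs.2.le⟩)
    linarith
  unfold energy
  rw [hn]
  have := mul_le_mul_of_nonneg_left e1 hβ
  linarith

/-- Coercivity: the concave term grows at most linearly in the norm and the singular term is
nonnegative. -/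
lemma le_energy {α β : ℝ} {w : ℝ → ℝ} (hβ : 0 ≤ β)
    (hw0 : ∀ s ∈ Icc (0 : ℝ) 1, 0 ≤ w s) {η : ℝ} (hη : 0 < η) {g : L2I} (hg : Above η g) :
    α * ‖g‖ ^ 2 - β * (1 + ‖g‖) ≤ energy α β w g := by
  have h1 := mul_le_mul_of_nonneg_left (integral_prim_rpow_le g hg hη) hβ
  have h2 : 0 ≤ ∫ s in (0 : ℝ)..1, w s * (prim g s) ^ (-(2 / 3) : ℝ) :=
    intervalIntegral.integral_nonneg zero_le_one fun s hs =>
      mul_nonneg (hw0 s hs) (Real.rpow_nonneg (hg.nonneg hη hs) _)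
  unfold energy
  linarith

lemma tendsto_energy {α β : ℝ} {w : ℝ → ℝ} (hw : ContinuousOn w (Icc 0 1)) {η : ℝ} (hη : 0 < η)
    {g : ℕ → L2I} {g₀ : L2I} (hg : ∀ n, Above η (g n)) (h : Tendsto g atTop (𝓝 g₀)) :
    Tendsto (fun n => energy α β w (g n)) atTop (𝓝 (energy α β w g₀)) := by
  obtain ⟨C, hC⟩ := isCompact_Icc.exists_bound_of_continuousOn hw
  exact (((h.norm.pow 2).const_mul α).sub
    ((tendsto_integral_prim_rpow h (by norm_num)).const_mul β)).add
    (tendsto_integral_prim_rpow_neg hη h (.of_forall hg) (Above.of_tendsto hg h)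
      (.of_forall fun _ => hw) (.of_forall fun _ => hC) fun _ _ => tendsto_const_nhds)

lemma exists_above : ∃ g : L2I, Above 1 g := by
  have hm : MemLp (fun s : ℝ => 1 - 2 * s) 2 (volume.restrict (Ioc (0 : ℝ) 1)) := by
    refine MemLp.of_bound (by fun_prop) 1 ?_
    filter_upwards [ae_restrict_mem measurableSet_Ioc] with s hs
    rw [Real.norm_eq_abs, abs_le]
    constructor <;> linarith [hs.1, hs.2]
  obtain ⟨g, hg, -⟩ := exists_prim_eq (f := fun s => s * (1 - s)) (f' := fun s => 1 - 2 * s)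
    (by fun_prop) (fun s _ => by
      exact ((hasDerivAt_id' s).mul ((hasDerivAt_id' s).const_sub 1)).congr_deriv (by ring)) (by simp) hm
  exact ⟨g, by rw [hg 1 ⟨zero_le_one, le_rfl⟩]; simp, fun s hs => by rw [hg s hs, one_mul]⟩

/-- Existence of a minimiser of the energy above a barrier, with the strong convexity estimate. -/
lemma exists_energy_min {α β : ℝ} {w : ℝ → ℝ} (hα : 0 < α) (hβ : 0 ≤ β)
    (hw : ContinuousOn w (Icc 0 1)) (hw0 : ∀ s ∈ Icc (0 : ℝ) 1, 0 ≤ w s) {η : ℝ} (hη : 0 < η)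
    (hη1 : η ≤ 1) :
    ∃ g : L2I, Above η g ∧
      ∀ k, Above η k → energy α β w g + α / 2 * ‖k - g‖ ^ 2 ≤ energy α β w k := by
  set E : Set ℝ := energy α β w '' {g | Above η g} with hE
  have hbdd : BddBelow E := by
    refine ⟨-β - β ^ 2 / (4 * α), ?_⟩
    rintro _ ⟨g, hg, rfl⟩
    refine le_trans ?_ (le_energy hβ hw0 hη hg)
    have : α * ‖g‖ ^ 2 - β * (1 + ‖g‖) - (-β - β ^ 2 / (4 * α)) =
      (2 * α * ‖g‖ - β) ^ 2 / (4 * α) := by field_simp; ring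
    have h2 : 0 ≤ (2 * α * ‖g‖ - β) ^ 2 / (4 * α) := by positivity
    linarith
  have hne : E.Nonempty := by
    obtain ⟨g, hg⟩ := exists_above
    exact ⟨_, g, hg.mono hη1, rfl⟩
  have hlow : ∀ k, Above η k → sInf E ≤ energy α β w k := fun k hk => csInf_le hbdd ⟨k, hk, rfl⟩
  have hseq : ∀ n : ℕ, ∃ g, Above η g ∧ energy α β w g < sInf E + α / 4 * (1 / (n + 1)) ^ 2 := by
    intro n
    obtain ⟨_, ⟨g, hg, rfl⟩, h⟩ := exists_lt_of_csInf_lt hne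
      (show sInf E < sInf E + α / 4 * (1 / ((n : ℝ) + 1)) ^ 2 by
        have : 0 < α / 4 * (1 / ((n : ℝ) + 1)) ^ 2 := by positivity
        linarith)
    exact ⟨g, hg, h⟩
  choose g hg hlt using hseq
  -- Uniform convexity replaces weak compactness. The excess α/4 · (1/(n+1))² in the minimising
  -- sequence is tuned to the constant α/4 of the midpoint inequality, so that distances are at most
  -- 1/(N+1).
  have hc : CauchySeq g := by
    refine cauchySeq_of_le_tendsto_0 (fun n : ℕ => 1 / ((n : ℝ) + 1)) ?_
      tendsto_one_div_add_atTop_nhds_zero_nat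
    intro n m N hn hm
    have h1 := hlow _ ((hg n).midpoint (hg m))
    have h2 := energy_midpoint_le (α := α) hβ hw hw0 hη (hg n) (hg m)
    have hmono : ∀ j : ℕ, N ≤ j → (1 / ((j : ℝ) + 1)) ^ 2 ≤ (1 / ((N : ℝ) + 1)) ^ 2 := by
      intro j hj
      have : (N : ℝ) ≤ j := by exact_mod_cast hj
      gcongr
    have h3 := hmono n hn
    have h4 := hmono m hm
    have h5 := hlt n
    have h6 := hlt m
    rw [dist_eq_norm]
    refine le_of_sq_le_sq ?_ (by positivity)
    have h7 : α / 4 * ‖g n - g m‖ ^ 2 ≤ α / 4 * (1 / ((N : ℝ) + 1)) ^ 2 := by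
      have := mul_le_mul_of_nonneg_left h3 (show 0 ≤ α / 4 by positivity)
      have := mul_le_mul_of_nonneg_left h4 (show 0 ≤ α / 4 by positivity)
      linarith
    exact le_of_mul_le_mul_left h7 (by positivity)
  obtain ⟨g₀, hg₀⟩ := cauchySeq_tendsto_of_complete hc
  have hA := Above.of_tendsto hg hg₀
  have hmin : energy α β w g₀ ≤ sInf E := by
    have h1 : Tendsto (fun n : ℕ => sInf E + α / 4 * (1 / ((n : ℝ) + 1)) ^ 2) atTop
        (𝓝 (sInf E + α / 4 * 0 ^ 2)) :=
      (((tendsto_one_div_add_atTop_nhds_zero_nat (𝕜 := ℝ)).pow 2).const_mul _).const_add _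
    have := le_of_tendsto_of_tendsto' (tendsto_energy hw hη hg hg₀) h1 fun n => (hlt n).le
    simpa using this
  refine ⟨g₀, hA, fun k hk => ?_⟩
  have h1 := hlow _ (hk.midpoint hA)
  have h2 := energy_midpoint_le (α := α) hβ hw hw0 hη hk hA
  linarith

/-! ### Tent functions and independence of the barrier. -/

/-- The tent function of height and half-width `r` centred at `s₀`. -/
noncomputable def tent (s₀ r s : ℝ) : ℝ := max 0 (r - |s - s₀|)

/-- The element of `L2I` whose primitive is the tent function. -/
noncomputable def tentKer (s₀ r : ℝ) : L2I :=
  (2 : ℝ) • brownKer s₀ - brownKer (s₀ + r) - brownKer (s₀ - r)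

/-- The derivative of a tent is a step function, so pairing with it yields minus a second
difference. This is how the weak second derivative of a profile is accessed. -/
lemma inner_tentKer (g : L2I) (s₀ r : ℝ) :
    inner ℝ g (tentKer s₀ r) = 2 * prim g s₀ - prim g (s₀ + r) - prim g (s₀ - r) := by
  unfold tentKer prim
  rw [inner_sub_right, inner_sub_right, real_inner_smul_right, real_inner_comm g,
    real_inner_comm g, real_inner_comm g]

lemma prim_tentKer {s₀ r s : ℝ} (hr : 0 < r) (h0 : 0 ≤ s₀ - r) (h1 : s₀ + r ≤ 1)
    (hs : s ∈ Icc (0 : ℝ) 1) : prim (tentKer s₀ r) s = tent s₀ r s := by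
  unfold tentKer tent
  rw [prim_sub, prim_sub, prim_smul, prim_brownKer hs ⟨by linarith, by linarith⟩,
    prim_brownKer hs ⟨by linarith, by linarith⟩, prim_brownKer hs ⟨by linarith, by linarith⟩]
  grind

lemma norm_tentKer_sq {s₀ r : ℝ} (hr : 0 < r) (h0 : 0 ≤ s₀ - r) (h1 : s₀ + r ≤ 1) :
    ‖tentKer s₀ r‖ ^ 2 = 2 * r := by
  rw [← real_inner_self_eq_norm_sq, inner_tentKer,
    prim_tentKer hr h0 h1 ⟨by linarith, by linarith⟩,
    prim_tentKer hr h0 h1 ⟨by linarith, by linarith⟩,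
    prim_tentKer hr h0 h1 ⟨by linarith, by linarith⟩]
  unfold tent
  grind

/-- Integration by parts on the two halves of the tent: the terms in z₁ cancel at the apex and
vanish at the feet. -/
lemma integral_mul_tent {m z z₁ : ℝ → ℝ} {s₀ r : ℝ} (hr : 0 < r) (h0 : 0 ≤ s₀ - r)
    (h1 : s₀ + r ≤ 1) (hz : ∀ s ∈ Icc (s₀ - r) (s₀ + r), HasDerivAt z (z₁ s) s)
    (hz₁ : ∀ s ∈ Icc (s₀ - r) (s₀ + r), HasDerivAt z₁ (m s) s)
    (hm : ContinuousOn m (Icc (s₀ - r) (s₀ + r))) :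
    ∫ s in (0 : ℝ)..1, m s * tent s₀ r s = z (s₀ + r) + z (s₀ - r) - 2 * z s₀ := by
  have i1 : ∀ s ∈ uIoc 0 (s₀ - r), m s * tent s₀ r s = 0 := by
    intro s hs
    rw [uIoc_of_le h0] at hs
    have := hs.2
    have : tent s₀ r s = 0 := by unfold tent; grind
    rw [this, mul_zero]
  have i2 : ∀ s ∈ uIoc (s₀ - r) s₀, m s * tent s₀ r s = m s * (s - (s₀ - r)) := by
    intro s hs
    rw [uIoc_of_le (by linarith)] at hs
    have := hs.1
    have := hs.2
    have : tent s₀ r s = s - (s₀ - r) := by unfold tent; grind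
    rw [this]
  have i3 : ∀ s ∈ uIoc s₀ (s₀ + r), m s * tent s₀ r s = m s * (s₀ + r - s) := by
    intro s hs
    rw [uIoc_of_le (by linarith)] at hs
    have := hs.1
    have := hs.2
    have : tent s₀ r s = s₀ + r - s := by unfold tent; grind
    rw [this]
  have i4 : ∀ s ∈ uIoc (s₀ + r) 1, m s * tent s₀ r s = 0 := by
    intro s hs
    rw [uIoc_of_le h1] at hs
    have := hs.1
    have : tent s₀ r s = 0 := by unfold tent; grind
    rw [this, mul_zero]
  have hm2 : ContinuousOn m (Icc (s₀ - r) s₀) := hm.mono (Icc_subset_Icc_right (by linarith))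
  have hm3 : ContinuousOn m (Icc s₀ (s₀ + r)) := hm.mono (Icc_subset_Icc_left (by linarith))
  have j2 : IntervalIntegrable (fun s => m s * (s - (s₀ - r))) volume (s₀ - r) s₀ :=
    ContinuousOn.intervalIntegrable (by
      rw [uIcc_of_le (by linarith)]; exact hm2.mul (by fun_prop))
  have j3 : IntervalIntegrable (fun s => m s * (s₀ + r - s)) volume s₀ (s₀ + r) :=
    ContinuousOn.intervalIntegrable (by
      rw [uIcc_of_le (by linarith)]; exact hm3.mul (by fun_prop))
  have k1 : IntervalIntegrable (fun s => m s * tent s₀ r s) volume 0 (s₀ - r) :=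
    (intervalIntegrable_const (c := (0 : ℝ))).congr fun s hs => (i1 s hs).symm
  have k2 : IntervalIntegrable (fun s => m s * tent s₀ r s) volume (s₀ - r) s₀ :=
    j2.congr fun s hs => (i2 s hs).symm
  have k3 : IntervalIntegrable (fun s => m s * tent s₀ r s) volume s₀ (s₀ + r) :=
    j3.congr fun s hs => (i3 s hs).symm
  have k4 : IntervalIntegrable (fun s => m s * tent s₀ r s) volume (s₀ + r) 1 :=
    (intervalIntegrable_const (c := (0 : ℝ))).congr fun s hs => (i4 s hs).symm
  rw [← intervalIntegral.integral_add_adjacent_intervals ((k1.trans k2).trans k3) k4,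
    ← intervalIntegral.integral_add_adjacent_intervals (k1.trans k2) k3,
    ← intervalIntegral.integral_add_adjacent_intervals k1 k2,
    intervalIntegral.integral_congr_ae (ae_of_all _ i1),
    intervalIntegral.integral_congr_ae (ae_of_all _ i2),
    intervalIntegral.integral_congr_ae (ae_of_all _ i3),
    intervalIntegral.integral_congr_ae (ae_of_all _ i4)]
  have f2 : ∫ s in (s₀ - r)..s₀, m s * (s - (s₀ - r)) =
      (z₁ s₀ * (s₀ - (s₀ - r)) - z s₀) - (z₁ (s₀ - r) * (s₀ - r - (s₀ - r)) - z (s₀ - r)) := by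
    refine intervalIntegral.integral_eq_sub_of_hasDerivAt
      (f := fun s => z₁ s * (s - (s₀ - r)) - z s) (fun s hs => ?_) j2
    rw [uIcc_of_le (by linarith)] at hs
    have hs' : s ∈ Icc (s₀ - r) (s₀ + r) := ⟨hs.1, by linarith [hs.2]⟩
    exact (((hz₁ s hs').mul ((hasDerivAt_id' s).sub_const _)).sub (hz s hs')).congr_deriv
      (by ring)
  have f3 : ∫ s in s₀..(s₀ + r), m s * (s₀ + r - s) =
      (z₁ (s₀ + r) * (s₀ + r - (s₀ + r)) + z (s₀ + r)) - (z₁ s₀ * (s₀ + r - s₀) + z s₀) := by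
    refine intervalIntegral.integral_eq_sub_of_hasDerivAt
      (f := fun s => z₁ s * (s₀ + r - s) + z s) (fun s hs => ?_) j3
    rw [uIcc_of_le (by linarith)] at hs
    have hs' : s ∈ Icc (s₀ - r) (s₀ + r) := ⟨by linarith [hs.1], hs.2⟩
    exact (((hz₁ s hs').mul ((hasDerivAt_id' s).const_sub _)).add (hz s hs')).congr_deriv
      (by ring)
  rw [f2, f3]
  simp only [intervalIntegral.integral_zero]
  ring

lemma integral_tent {s₀ r : ℝ} (hr : 0 < r) (h0 : 0 ≤ s₀ - r) (h1 : s₀ + r ≤ 1) :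
    ∫ s in (0 : ℝ)..1, tent s₀ r s = r ^ 2 := by
  have := integral_mul_tent (m := fun _ => 1) (z := fun s => s ^ 2 / 2) (z₁ := fun s => s) hr h0 h1
    (fun s _ => ((hasDerivAt_pow 2 s).div_const 2).congr_deriv (by simp))
    (fun s _ => hasDerivAt_id' s) continuousOn_const
  simp only [one_mul] at this
  rw [this]; ring

lemma tent_nonneg (s₀ r s : ℝ) : 0 ≤ tent s₀ r s := le_max_left _ _

lemma tent_le {s₀ r : ℝ} (hr : 0 ≤ r) (s : ℝ) : tent s₀ r s ≤ r :=
  max_le hr (by linarith [abs_nonneg (s - s₀)])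

lemma tent_eq_zero {s₀ r s : ℝ} (h : s ∉ Icc (s₀ - r) (s₀ + r)) : tent s₀ r s = 0 := by
  unfold tent
  simp only [mem_Icc, not_and_or, not_le] at h
  grind

lemma tent_continuous (s₀ r : ℝ) : Continuous (tent s₀ r) := by unfold tent; fun_prop

/-- On (0, 1] the derivative −(2/3) x^{-5/3} is at most −2/3. -/
lemma rpow_neg_sub_ge {x y : ℝ} (hx : 0 < x) (hxy : x ≤ y) (hy : y ≤ 1) :
    2 / 3 * (y - x) ≤ x ^ (-(2 / 3) : ℝ) - y ^ (-(2 / 3) : ℝ) := by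
  have hanti : AntitoneOn (fun t : ℝ => t ^ (-(2 / 3) : ℝ) + 2 / 3 * t) (Ioc 0 1) := by
    refine antitoneOn_of_deriv_nonpos (convex_Ioc 0 1) ?_ ?_ ?_
    · exact (continuousOn_id.rpow_const fun t ht => Or.inl ht.1.ne').add (by fun_prop)
    · rw [interior_Ioc]
      intro t ht
      exact ((Real.hasDerivAt_rpow_const (Or.inl ht.1.ne')).add
        ((hasDerivAt_id' t).const_mul _)).differentiableAt.differentiableWithinAt
    · rw [interior_Ioc]
      intro t ht
      have hd : HasDerivAt (fun t : ℝ => t ^ (-(2 / 3) : ℝ) + 2 / 3 * t)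
          (-(2 / 3) * t ^ (-(2 / 3) - 1 : ℝ) + 2 / 3 * 1) t :=
        (Real.hasDerivAt_rpow_const (Or.inl ht.1.ne')).add ((hasDerivAt_id' t).const_mul _)
      rw [hd.deriv]
      have := Real.one_le_rpow_of_pos_of_le_one_of_nonpos ht.1 ht.2.le
        (show (-(2 / 3) - 1 : ℝ) ≤ 0 by norm_num)
      linarith
  have := hanti (a := x) (b := y) ⟨hx, hxy.trans hy⟩ ⟨hx.trans_le hxy, hy⟩ hxy
  simp only at this
  linarith

/-- Minimisers above a low barrier lie above the barrier whose height is determined by the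
singular term. -/
lemma above_of_energy_min {α β w₀ η η' : ℝ} {w : ℝ → ℝ} (hα : 0 < α) (hβ : 0 ≤ β)
    (hw : ContinuousOn w (Icc 0 1)) (hw₀ : 0 < w₀) (hw0 : ∀ s ∈ Icc (0 : ℝ) 1, w₀ ≤ w s)
    (hη' : 0 < η') (hη1 : η ≤ 1) (hηw : 8 * α * η ≤ w₀) {g : L2I}
    (hg : Above η' g) (hmin : ∀ k, Above η' k → energy α β w g ≤ energy α β w k) :
    Above η g := by
  refine ⟨hg.1, ?_⟩
  by_contra! hcon
  obtain ⟨s₁, hs₁, hlt₁⟩ := hcon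
  have hdc : ContinuousOn (fun s => prim g s - η * (s * (1 - s))) (Icc 0 1) :=
    (prim_continuousOn g).sub (by fun_prop)
  obtain ⟨s₀, hs₀, hmin₀⟩ := isCompact_Icc.exists_isMinOn ⟨s₁, hs₁⟩ hdc
  have hle : ∀ s ∈ Icc (0 : ℝ) 1,
      prim g s₀ - η * (s₀ * (1 - s₀)) ≤ prim g s - η * (s * (1 - s)) := fun s hs => hmin₀ hs
  set μ := -(prim g s₀ - η * (s₀ * (1 - s₀))) with hμ
  have hμ0 : 0 < μ := by have := hle s₁ hs₁; linarith
  have hs₀0 : 0 < s₀ := by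
    rcases hs₀.1.eq_or_lt with h | h
    · rw [← h, prim_zero] at hμ; simp at hμ; linarith
    · exact h
  have hs₀1 : s₀ < 1 := by
    rcases hs₀.2.eq_or_lt with h | h
    · rw [h, hg.1] at hμ; simp at hμ; linarith
    · exact h
  have hnear : ∀ᶠ s in 𝓝 s₀, prim g s - η * (s * (1 - s)) < -(μ / 2) ∧ s ∈ Ioo (0 : ℝ) 1 := by
    have hca : ContinuousAt (fun s => prim g s - η * (s * (1 - s))) s₀ :=
      hdc.continuousAt (Icc_mem_nhds hs₀0 hs₀1)
    exact (hca.eventually (gt_mem_nhds (show prim g s₀ - η * (s₀ * (1 - s₀)) < -(μ / 2) by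
      linarith))).and (Ioo_mem_nhds hs₀0 hs₀1)
  obtain ⟨ρ, hρ, hball⟩ := Metric.eventually_nhds_iff.1 hnear
  set r := ρ / 2 with hr
  have hr0 : 0 < r := by positivity
  have hI : ∀ s ∈ Icc (s₀ - r) (s₀ + r), prim g s - η * (s * (1 - s)) < -(μ / 2) ∧
      s ∈ Ioo (0 : ℝ) 1 := fun s hs => hball (by
    rw [Real.dist_eq, abs_lt]; constructor <;> linarith [hs.1, hs.2])
  have hl := (hI (s₀ - r) ⟨le_rfl, by linarith⟩).2
  have hu := (hI (s₀ + r) ⟨by linarith, le_rfl⟩).2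
  have h0 : 0 ≤ s₀ - r := hl.1.le
  have h1 : s₀ + r ≤ 1 := hu.2.le
  set ψ := tentKer s₀ r with hψ
  -- At a minimum of the difference, the second difference of the profile is at least that of the
  -- parabola, which is −2ηr².
  have hinner : inner ℝ g ψ ≤ 2 * η * r ^ 2 := by
    rw [hψ, inner_tentKer]
    have a1 := hle (s₀ - r) ⟨h0, by linarith⟩
    have a2 := hle (s₀ + r) ⟨by linarith, h1⟩
    linarith
  -- compare with a small multiple of the tent
  set t := min (μ / (2 * r)) (w₀ * r / (24 * α)) with ht
  have ht0 : 0 < t := by positivity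
  have htr : t * r ≤ μ / 2 := by
    calc t * r ≤ μ / (2 * r) * r := by gcongr; exact min_le_left _ _
      _ = μ / 2 := by field_simp
  have htw : 24 * α * t ≤ w₀ * r := by
    calc 24 * α * t ≤ 24 * α * (w₀ * r / (24 * α)) := by gcongr; exact min_le_right _ _
      _ = w₀ * r := by field_simp
  have hprim : ∀ s ∈ Icc (0 : ℝ) 1, prim (g + t • ψ) s = prim g s + t * tent s₀ r s := by
    intro s hs
    rw [prim_add, prim_smul, prim_tentKer hr0 h0 h1 hs]
  have hk : Above η' (g + t • ψ) := by
    refine ⟨?_, fun s hs => ?_⟩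
    · rw [hprim 1 ⟨zero_le_one, le_rfl⟩, hg.1, tent_eq_zero (by
        intro h; linarith [h.2, hu.2])]; simp
    · rw [hprim s hs]
      have := hg.2 s hs
      have := mul_nonneg ht0.le (tent_nonneg s₀ r s)
      linarith
  have hcmp := hmin _ hk
  have e1 : ‖g + t • ψ‖ ^ 2 = ‖g‖ ^ 2 + 2 * t * inner ℝ g ψ + t ^ 2 * (2 * r) := by
    rw [norm_add_sq_real, norm_smul, mul_pow, hψ, norm_tentKer_sq hr0 h0 h1, real_inner_smul_right,
      Real.norm_eq_abs, sq_abs]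
    ring
  have e2 : ∫ s in (0 : ℝ)..1, (prim g s) ^ (2 / 3 : ℝ) ≤
      ∫ s in (0 : ℝ)..1, (prim (g + t • ψ) s) ^ (2 / 3 : ℝ) := by
    refine intervalIntegral.integral_mono_on zero_le_one
      (intervalIntegrable_prim_rpow g (by norm_num))
      (intervalIntegrable_prim_rpow _ (by norm_num)) fun s hs => ?_
    rw [hprim s hs]
    exact Real.rpow_le_rpow (hg.nonneg hη' hs)
      (by have := mul_nonneg ht0.le (tent_nonneg s₀ r s); linarith) (by norm_num)
  have e3 : ∫ s in (0 : ℝ)..1, w s * (prim (g + t • ψ) s) ^ (-(2 / 3) : ℝ) ≤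
      (∫ s in (0 : ℝ)..1, w s * (prim g s) ^ (-(2 / 3) : ℝ)) - w₀ * (2 / 3) * t * r ^ 2 := by
    have hint := hg.intervalIntegrable hη' hw
    have hti : IntervalIntegrable (fun s => w₀ * (2 / 3) * t * tent s₀ r s) volume 0 1 :=
      (continuous_const.mul (tent_continuous s₀ r)).intervalIntegrable _ _
    rw [← integral_tent hr0 h0 h1, ← intervalIntegral.integral_const_mul,
      ← intervalIntegral.integral_sub hint hti]
    refine intervalIntegral.integral_mono_on_of_le_Ioo zero_le_one
      (hk.intervalIntegrable hη' hw) (hint.sub hti) fun s hs => ?_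
    have hs' : s ∈ Icc (0 : ℝ) 1 := ⟨hs.1.le, hs.2.le⟩
    rw [hprim s hs']
    have hp := hg.pos hη' hs
    have hT := tent_nonneg s₀ r s
    -- On the support of the tent the perturbation is at most μ/2, so the perturbed profile stays
    -- below the parabola. There it is at most 1, and the singular term drops at rate at least 2/3.
    by_cases hsI : s ∈ Icc (s₀ - r) (s₀ + r)
    · have b1 := (hI s hsI).1
      have b2 : t * tent s₀ r s ≤ μ / 2 :=
        (mul_le_mul_of_nonneg_left (tent_le hr0.le s) ht0.le).trans htr
      have b3 : η * (s * (1 - s)) ≤ 1 := by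
        have : s * (1 - s) ≤ 1 := by nlinarith [hs.1, hs.2]
        have : 0 ≤ s * (1 - s) := mul_nonneg hs.1.le (by linarith [hs.2])
        nlinarith
      have b4 := rpow_neg_sub_ge hp
        (show prim g s ≤ prim g s + t * tent s₀ r s by linarith [mul_nonneg ht0.le hT])
        (by linarith)
      have b5 := hw0 s hs'
      have b6 : 0 ≤ 2 / 3 * (prim g s + t * tent s₀ r s - prim g s) := by
        have := mul_nonneg ht0.le hT; linarith
      have b7 := mul_le_mul b5 b4 b6 (hw₀.le.trans b5)
      linarith
    · rw [tent_eq_zero hsI]; simp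
  unfold energy at hcmp
  rw [e1] at hcmp
  -- Balance in units of w₀ t r²: the singular term gains at least 2/3, the linear kinetic cost is
  -- at most 1/2 because 8αη ≤ w₀, and the quadratic cost is at most 1/12 by the choice of t.
  have c1 := mul_le_mul_of_nonneg_left e2 hβ
  have c2 : w₀ * (2 / 3) * t * r ^ 2 ≤ α * (2 * t * inner ℝ g ψ + t ^ 2 * (2 * r)) := by linarith
  have c3 : α * (2 * t * inner ℝ g ψ) ≤ α * (2 * t * (2 * η * r ^ 2)) := by gcongr
  have c4 : α * (2 * t * (2 * η * r ^ 2)) ≤ w₀ / 2 * t * r ^ 2 := by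
    have := mul_le_mul_of_nonneg_right hηw (show 0 ≤ t * r ^ 2 / 2 by positivity)
    linarith
  have c5 : α * (t ^ 2 * (2 * r)) ≤ w₀ / 12 * t * r ^ 2 := by
    have := mul_le_mul_of_nonneg_right htw (show 0 ≤ t * r / 12 by positivity)
    linarith
  have c6 : 0 < w₀ * t * r ^ 2 := by positivity
  linarith

/-- `g` minimises the energy among all profiles lying above some parabola. -/
def IsEnergyMin (α β : ℝ) (w : ℝ → ℝ) (g : L2I) : Prop :=
  ∀ η > 0, ∀ k, Above η k → energy α β w g + α / 2 * ‖k - g‖ ^ 2 ≤ energy α β w k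

/-- Lowering the barrier does not change the minimiser. The one above the lower barrier already lies
above η by `above_of_energy_min`, and strong convexity identifies the two. Hence the constraint is
inactive and two-sided variations are allowed. -/
lemma exists_isEnergyMin {α β w₀ η : ℝ} {w : ℝ → ℝ} (hα : 0 < α) (hβ : 0 ≤ β)
    (hw : ContinuousOn w (Icc 0 1)) (hw₀ : 0 < w₀) (hw0 : ∀ s ∈ Icc (0 : ℝ) 1, w₀ ≤ w s)
    (hη : 0 < η) (hη1 : η ≤ 1) (hηw : 8 * α * η ≤ w₀) :
    ∃ g : L2I, Above η g ∧ IsEnergyMin α β w g := by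
  have hw0' : ∀ s ∈ Icc (0 : ℝ) 1, 0 ≤ w s := fun s hs => hw₀.le.trans (hw0 s hs)
  obtain ⟨g, hg, hgmin⟩ := exists_energy_min hα hβ hw hw0' hη hη1
  refine ⟨g, hg, fun η' hη' k hk => ?_⟩
  have hε : 0 < min η η' := lt_min hη hη'
  obtain ⟨g', hg', hgmin'⟩ := exists_energy_min hα hβ hw hw0' hε ((min_le_left _ _).trans hη1)
  have habove : Above η g' := above_of_energy_min hα hβ hw hw₀ hw0 hε hη1 hηw hg' fun j hj => by
    have := hgmin' j hj
    have : 0 ≤ α / 2 * ‖j - g'‖ ^ 2 := by positivity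
    linarith
  have h1 := hgmin g' habove
  have h2 := hgmin' g (hg.mono (min_le_left _ _))
  have h3 : g' = g := by
    have : 0 ≤ α / 2 * ‖g - g'‖ ^ 2 := by positivity
    have h4 : α / 2 * ‖g' - g‖ ^ 2 = 0 := le_antisymm (by linarith) (by positivity)
    have h5 : ‖g' - g‖ ^ 2 = 0 := (mul_eq_zero.1 h4).resolve_left (by positivity)
    exact sub_eq_zero.1 (norm_eq_zero.1 (pow_eq_zero_iff two_ne_zero |>.1 h5))
  rw [← h3]
  exact hgmin' k (hk.mono (min_le_right _ _))

/-! ### First variation and the Euler–Lagrange equation. -/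

lemma hasDerivAt_integral_prim_rpow {η C r : ℝ} {g ψ : L2I} {k : ℝ → ℝ} (hη : 0 < η)
    (hg : Above η g) (hC0 : 0 ≤ C)
    (hC : ∀ s ∈ Icc (0 : ℝ) 1, |prim ψ s| ≤ C * prim g s)
    (hr : r < 1) (hk : ContinuousOn k (Icc 0 1))
    (hint : IntervalIntegrable (fun s => k s * (prim g s) ^ r) volume 0 1) :
    HasDerivAt (fun t : ℝ => ∫ s in (0 : ℝ)..1, k s * (prim (g + t • ψ) s) ^ r)
      (r * ∫ s in (0 : ℝ)..1, k s * ((prim g s) ^ (r - 1) * prim ψ s)) 0 := by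
  -- For |t| < ε the perturbed profile keeps at least half of the original one, which dominates all
  -- singular powers uniformly in t.
  set ε := 1 / (2 * (C + 1)) with hε
  have hε0 : 0 < ε := by positivity
  have hlow : ∀ t : ℝ, |t| < ε → ∀ s ∈ Icc (0 : ℝ) 1,
      prim g s / 2 ≤ prim g s + t * prim ψ s := by
    intro t ht s hs
    have h1 : |t * prim ψ s| ≤ ε * (C * prim g s) := by
      rw [abs_mul]; exact mul_le_mul ht.le (hC s hs) (abs_nonneg _) hε0.le
    have h2 : ε * (C * prim g s) ≤ prim g s / 2 := by
      have h0 := hg.nonneg hη hs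
      have : ε * C ≤ 1 / 2 := by
        rw [hε]; rw [div_mul_eq_mul_div, one_mul, div_le_div_iff₀ (by positivity) (by norm_num)]
        linarith
      calc ε * (C * prim g s) = (ε * C) * prim g s := by ring
        _ ≤ 1 / 2 * prim g s := by gcongr
        _ = prim g s / 2 := by ring
    have := neg_abs_le (t * prim ψ s)
    linarith
  have key := intervalIntegral.hasDerivAt_integral_of_dominated_loc_of_deriv_le
    (μ := volume) (a := (0 : ℝ)) (b := 1)
    (F := fun t s => k s * (prim g s + t * prim ψ s) ^ r)
    (F' := fun t s => k s * (r * (prim g s + t * prim ψ s) ^ (r - 1) * prim ψ s))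
    (x₀ := (0 : ℝ)) (s := Metric.ball 0 ε)
    (bound := fun s => |r| * (1 / 2) ^ (r - 1) * C * |k s * (prim g s) ^ r|)
    (Metric.ball_mem_nhds _ hε0) ?_ ?_ ?_ ?_ ?_ ?_
  · have h2 := key.2
    have e1 : (fun t : ℝ => ∫ s in (0 : ℝ)..1, k s * (prim (g + t • ψ) s) ^ r) =
        fun t => ∫ s in (0 : ℝ)..1, k s * (prim g s + t * prim ψ s) ^ r := by
      funext t; simp_rw [prim_add, prim_smul]
    rw [e1]
    refine h2.congr_deriv ?_
    rw [← intervalIntegral.integral_const_mul]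
    congr 1; funext s
    simp only [zero_mul, add_zero]; ring
  · refine Eventually.of_forall fun t => ?_
    simpa only [prim_add, prim_smul] using aestronglyMeasurable_mul_prim_rpow (g + t • ψ) hk r
  · simpa using hint
  · simp only [zero_mul, add_zero]
    have h1 := aestronglyMeasurable_mul_prim_rpow g (hk.mul (prim_continuousOn ψ)) (r - 1)
    have h2 := h1.const_mul r
    refine h2.congr (Eventually.of_forall fun s => ?_)
    simp only [Pi.mul_apply]; ring
  · have hne : ∀ᵐ s : ℝ ∂volume, s ≠ 1 := by
      simp [ae_iff]
    filter_upwards [hne] with s hs1 hs t ht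
    rw [uIoc_of_le zero_le_one] at hs
    have hs' : s ∈ Icc (0 : ℝ) 1 := ⟨hs.1.le, hs.2⟩
    have hp := hg.pos hη ⟨hs.1, lt_of_le_of_ne hs.2 hs1⟩
    have hb := hlow t (by simpa using ht) s hs'
    have h1 : (prim g s + t * prim ψ s) ^ (r - 1) ≤ (1 / 2) ^ (r - 1) * (prim g s) ^ (r - 1) := by
      rw [← Real.mul_rpow (by norm_num) hp.le]
      exact Real.rpow_le_rpow_of_nonpos (by positivity) (by linarith) (by linarith)
    have h0 : 0 ≤ (prim g s + t * prim ψ s) ^ (r - 1) := Real.rpow_nonneg (by linarith) _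
    have h3 : (prim g s) ^ r = (prim g s) ^ (r - 1) * prim g s := by
      rw [← Real.rpow_add_one hp.ne']; ring_nf
    rw [norm_mul, norm_mul, norm_mul, Real.norm_eq_abs, Real.norm_eq_abs, Real.norm_eq_abs,
      Real.norm_eq_abs, abs_of_nonneg h0, abs_mul, abs_of_nonneg (Real.rpow_nonneg hp.le r), h3]
    calc |k s| * (|r| * (prim g s + t * prim ψ s) ^ (r - 1) * |prim ψ s|)
        ≤ |k s| * (|r| * ((1 / 2) ^ (r - 1) * (prim g s) ^ (r - 1)) * (C * prim g s)) := by
          gcongr; exact hC s hs'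
      _ = _ := by ring
  · exact hint.abs.const_mul _
  · have hne : ∀ᵐ s : ℝ ∂volume, s ≠ 1 := by
      simp [ae_iff]
    filter_upwards [hne] with s hs1 hs t ht
    rw [uIoc_of_le zero_le_one] at hs
    have hs' : s ∈ Icc (0 : ℝ) 1 := ⟨hs.1.le, hs.2⟩
    have hp := hg.pos hη ⟨hs.1, lt_of_le_of_ne hs.2 hs1⟩
    have hb := hlow t (by simpa using ht) s hs'
    have hpos : 0 < prim g s + t * prim ψ s := by linarith
    have hd : HasDerivAt (fun t => prim g s + t * prim ψ s) (prim ψ s) t := by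
      simpa using ((hasDerivAt_id' t).mul_const (prim ψ s)).const_add (prim g s)
    exact ((hd.rpow_const (p := r) (Or.inl hpos.ne')).const_mul (k s)).congr_deriv (by ring)

/-- First variation of the energy at a minimiser. -/
lemma IsEnergyMin.variation {α β η C : ℝ} {w : ℝ → ℝ} (hα : 0 < α) {g ψ : L2I}
    (hw : ContinuousOn w (Icc 0 1)) (hη : 0 < η) (hg : Above η g)
    (hmin : IsEnergyMin α β w g) (hψ1 : prim ψ 1 = 0) (hC0 : 0 ≤ C)
    (hC : ∀ s ∈ Icc (0 : ℝ) 1, |prim ψ s| ≤ C * prim g s) :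
    2 * α * inner ℝ g ψ =
      2 / 3 * β * (∫ s in (0 : ℝ)..1, (prim g s) ^ (-(1 / 3) : ℝ) * prim ψ s) +
      2 / 3 * ∫ s in (0 : ℝ)..1, w s * ((prim g s) ^ (-(5 / 3) : ℝ) * prim ψ s) := by
  have d1 := hasDerivAt_integral_prim_rpow (r := 2 / 3) (k := fun _ => 1) hη hg hC0 hC
    (by norm_num) continuousOn_const
    (by simpa using intervalIntegrable_prim_rpow g (r := 2 / 3) (by norm_num))
  have d2 := hasDerivAt_integral_prim_rpow (r := -(2 / 3)) hη hg hC0 hC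
    (by norm_num) hw (hg.intervalIntegrable hη hw)
  simp only [one_mul] at d1
  have d3 : HasDerivAt (fun t : ℝ => α * ‖g + t • ψ‖ ^ 2) (2 * α * inner ℝ g ψ) 0 := by
    have : (fun t : ℝ => α * ‖g + t • ψ‖ ^ 2) =
        fun t => α * (‖g‖ ^ 2 + 2 * inner ℝ g ψ * t + ‖ψ‖ ^ 2 * t ^ 2) := by
      funext t
      rw [norm_add_sq_real, norm_smul, mul_pow, real_inner_smul_right, Real.norm_eq_abs, sq_abs]
      ring
    rw [this]
    exact (((((hasDerivAt_id' (0 : ℝ)).const_mul (2 * inner ℝ g ψ)).const_add (‖g‖ ^ 2)).add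
      ((hasDerivAt_pow 2 (0 : ℝ)).const_mul (‖ψ‖ ^ 2))).const_mul α).congr_deriv
      (by simp; ring)
  have d4 := (d3.sub (d1.const_mul β)).add d2
  have hloc : IsLocalMin (fun t : ℝ => energy α β w (g + t • ψ)) 0 := by
    have hnh : Metric.ball (0 : ℝ) (1 / (2 * (C + 1))) ∈ 𝓝 (0 : ℝ) :=
      Metric.ball_mem_nhds _ (by positivity)
    filter_upwards [hnh] with t ht
    have ht' : |t| < 1 / (2 * (C + 1)) := by simpa using ht
    have hk : Above (η / 2) (g + t • ψ) := by
      refine ⟨by rw [prim_add, prim_smul, hg.1, hψ1]; ring, fun s hs => ?_⟩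
      rw [prim_add, prim_smul]
      have h0 := hg.nonneg hη hs
      have h1 : |t * prim ψ s| ≤ 1 / (2 * (C + 1)) * (C * prim g s) := by
        rw [abs_mul]; exact mul_le_mul ht'.le (hC s hs) (abs_nonneg _) (by positivity)
      have h2 : 1 / (2 * (C + 1)) * (C * prim g s) ≤ 1 / 2 * prim g s := by
        rw [← mul_assoc]
        refine mul_le_mul_of_nonneg_right ?_ h0
        rw [div_mul_eq_mul_div, one_mul, div_le_div_iff₀ (by positivity) (by norm_num)]
        linarith
      have := neg_abs_le (t * prim ψ s)
      have := hg.2 s hs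
      linarith
    have := hmin _ (half_pos hη) _ hk
    have h5 : 0 ≤ α / 2 * ‖g + t • ψ - g‖ ^ 2 := by positivity
    simp only [zero_smul, add_zero]
    linarith
  have := hloc.hasDerivAt_eq_zero d4
  norm_num at this ⊢
  linarith

/-- The virial identity at a minimiser. -/
lemma IsEnergyMin.virial {α β η : ℝ} {w : ℝ → ℝ} (hα : 0 < α) {g : L2I}
    (hw : ContinuousOn w (Icc 0 1)) (hη : 0 < η) (hg : Above η g)
    (hmin : IsEnergyMin α β w g) :
    3 * (α * ‖g‖ ^ 2) = β * (∫ s in (0 : ℝ)..1, (prim g s) ^ (2 / 3 : ℝ)) +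
      ∫ s in (0 : ℝ)..1, w s * (prim g s) ^ (-(2 / 3) : ℝ) := by
  have h := hmin.variation (ψ := g) (C := 1) hα hw hη hg hg.1 zero_le_one
    (fun s hs => by rw [abs_of_nonneg (hg.nonneg hη hs), one_mul])
  rw [real_inner_self_eq_norm_sq] at h
  have e : ∀ r : ℝ, r ≠ 0 → r - 1 ≠ 0 → ∀ s ∈ Icc (0 : ℝ) 1,
      (prim g s) ^ (r - 1) * prim g s = (prim g s) ^ r := by
    intro r hr hr1 s hs
    rcases (hg.nonneg hη hs).eq_or_lt with h0 | h0
    · rw [← h0, Real.zero_rpow hr, mul_zero]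
    · rw [← Real.rpow_add_one h0.ne']; ring_nf
  have e1 : ∫ s in (0 : ℝ)..1, (prim g s) ^ (-(1 / 3) : ℝ) * prim g s =
      ∫ s in (0 : ℝ)..1, (prim g s) ^ (2 / 3 : ℝ) := by
    refine intervalIntegral.integral_congr fun s hs => ?_
    rw [uIcc_of_le zero_le_one] at hs
    have := e (2 / 3) (by norm_num) (by norm_num) s hs
    norm_num at this ⊢
    exact this
  have e2 : ∫ s in (0 : ℝ)..1, w s * ((prim g s) ^ (-(5 / 3) : ℝ) * prim g s) =
      ∫ s in (0 : ℝ)..1, w s * (prim g s) ^ (-(2 / 3) : ℝ) := by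
    refine intervalIntegral.integral_congr fun s hs => ?_
    rw [uIcc_of_le zero_le_one] at hs
    have := e (-(2 / 3)) (by norm_num) (by norm_num) s hs
    norm_num at this ⊢
    left
    exact this
  rw [e1, e2] at h
  linarith

lemma exists_second_primitive {m : ℝ → ℝ} (hm : ContinuousOn m (Ioo 0 1)) :
    ∃ z z₁ : ℝ → ℝ, ∀ s ∈ Ioo (0 : ℝ) 1, HasDerivAt z (z₁ s) s ∧ HasDerivAt z₁ (m s) s := by
  have key : ∀ k : ℝ → ℝ, ContinuousOn k (Ioo 0 1) → ∀ s ∈ Ioo (0 : ℝ) 1,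
      HasDerivAt (fun x => ∫ t in (1 / 2 : ℝ)..x, k t) (k s) s := by
    intro k hk s hs
    have hsub : uIcc (1 / 2) s ⊆ Ioo (0 : ℝ) 1 :=
      ordConnected_Ioo.uIcc_subset (by constructor <;> norm_num) hs
    exact intervalIntegral.integral_hasDerivAt_right (hk.mono hsub).intervalIntegrable
      (hk.stronglyMeasurableAtFilter isOpen_Ioo s hs) (hk.continuousAt (Ioo_mem_nhds hs.1 hs.2))
  have h1 := key m hm
  have h2 := key (fun x => ∫ t in (1 / 2 : ℝ)..x, m t)
    (fun s hs => (h1 s hs).continuousAt.continuousWithinAt)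
  exact ⟨_, _, fun s hs => ⟨h2 s hs, h1 s hs⟩⟩

/-- A discrete maximum principle: after adding the strictly convex function ε(s − p)(s − q) an
interior maximum would have a positive second difference. -/
lemma le_zero_of_second_difference {d : ℝ → ℝ} {p q : ℝ} (hpq : p < q)
    (hd : ContinuousOn d (Icc p q)) (hp : d p = 0) (hq : d q = 0)
    (h : ∀ s r, 0 < r → p ≤ s - r → s + r ≤ q → 2 * d s - d (s + r) - d (s - r) = 0) :
    ∀ s ∈ Icc p q, d s ≤ 0 := by
  have key : ∀ ε > 0, ∀ s ∈ Icc p q, d s + ε * ((s - p) * (s - q)) ≤ 0 := by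
    intro ε hε s hs
    obtain ⟨s₀, hs₀, hmax⟩ := isCompact_Icc.exists_isMaxOn ⟨s, hs⟩
      (hd.add (by fun_prop : ContinuousOn (fun s => ε * ((s - p) * (s - q))) (Icc p q)))
    have hle : ∀ t ∈ Icc p q, d t + ε * ((t - p) * (t - q)) ≤ d s₀ + ε * ((s₀ - p) * (s₀ - q)) :=
      fun t ht => hmax ht
    refine (hle s hs).trans ?_
    rcases hs₀.1.eq_or_lt with e | h1
    · rw [← e, hp]; simp
    rcases hs₀.2.eq_or_lt with e | h2
    · rw [e, hq]; simp
    exfalso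
    set r := min (s₀ - p) (q - s₀)
    have hr : 0 < r := lt_min (by linarith) (by linarith)
    have r1 : r ≤ s₀ - p := min_le_left _ _
    have r2 : r ≤ q - s₀ := min_le_right _ _
    have a1 := hle (s₀ - r) ⟨by linarith, by linarith⟩
    have a2 := hle (s₀ + r) ⟨by linarith, by linarith⟩
    have a3 := h s₀ r hr (by linarith) (by linarith)
    have a4 : 0 < ε * r ^ 2 := by positivity
    linarith
  intro s hs
  by_contra! hcon
  have hpos : 0 < (q - p) ^ 2 := by have : 0 < q - p := by linarith
                                    positivity
  have := key (d s / (2 * (q - p) ^ 2)) (by positivity) s hs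
  have h2 : -((s - p) * (s - q)) ≤ (q - p) ^ 2 := by nlinarith [hs.1, hs.2]
  have h3 : d s / (2 * (q - p) ^ 2) * (-((s - p) * (s - q))) ≤
      d s / (2 * (q - p) ^ 2) * (q - p) ^ 2 := mul_le_mul_of_nonneg_left h2 (by positivity)
  have h4 : d s / (2 * (q - p) ^ 2) * (q - p) ^ 2 = d s / 2 := by
    have : q - p ≠ 0 := by linarith
    field_simp
  linarith

/-- On a compact subinterval the maximum principle, applied to both signs of the difference,
identifies the function with its chord. Every point shares such a subinterval with 1/3 and 2/3. -/
lemma affine_of_second_difference {d : ℝ → ℝ} (hd : ContinuousOn d (Ioo 0 1))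
    (h : ∀ s r, 0 < r → 0 < s - r → s + r < 1 → 2 * d s - d (s + r) - d (s - r) = 0) :
    ∃ A B : ℝ, ∀ s ∈ Ioo (0 : ℝ) 1, d s = A + B * s := by
  have chord : ∀ p q, 0 < p → p < q → q < 1 → ∀ s ∈ Icc p q,
      d s = d p + (d q - d p) / (q - p) * (s - p) := by
    intro p q hp hpq hq s hs
    have hc : ContinuousOn d (Icc p q) := hd.mono (Icc_subset_Ioo hp hq)
    have hqp : q - p ≠ 0 := by linarith
    have e1 := le_zero_of_second_difference
      (d := fun s => d s - (d p + (d q - d p) / (q - p) * (s - p))) hpq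
      (hc.sub (by fun_prop)) (by simp) (by field_simp; ring) (fun s r hr h1 h2 => by
        have := h s r hr (by linarith) (by linarith)
        linarith) s hs
    have e2 := le_zero_of_second_difference
      (d := fun s => (d p + (d q - d p) / (q - p) * (s - p)) - d s) hpq
      (ContinuousOn.sub (by fun_prop) hc) (by simp) (by field_simp; ring) (fun s r hr h1 h2 => by
        have := h s r hr (by linarith) (by linarith)
        linarith) s hs
    linarith
  refine ⟨d (1 / 3) - (d (2 / 3) - d (1 / 3)) / (1 / 3) * (1 / 3),
    (d (2 / 3) - d (1 / 3)) / (1 / 3), fun s hs => ?_⟩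
  set p := min (s / 2) (1 / 4)
  set q := max ((1 + s) / 2) (3 / 4)
  have hp : 0 < p := lt_min (by linarith [hs.1]) (by norm_num)
  have hq : q < 1 := max_lt (by linarith [hs.2]) (by norm_num)
  have p1 : p ≤ s / 2 := min_le_left _ _
  have p2 : p ≤ 1 / 4 := min_le_right _ _
  have q1 : (1 + s) / 2 ≤ q := le_max_left _ _
  have q2 : 3 / 4 ≤ q := le_max_right _ _
  have hpq : p < q := by linarith
  have c := chord p q hp hpq hq
  rw [c s ⟨by linarith [hs.1], by linarith [hs.2]⟩, c (1 / 3) ⟨by linarith, by linarith⟩,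
    c (2 / 3) ⟨by linarith, by linarith⟩]
  ring

/-- The Euler-Lagrange equation at a minimiser. -/
lemma IsEnergyMin.ode {α β η : ℝ} {w : ℝ → ℝ} (hα : 0 < α) {g : L2I}
    (hw : ContinuousOn w (Icc 0 1)) (hη : 0 < η) (hg : Above η g)
    (hmin : IsEnergyMin α β w g) :
    ∃ y₁ : ℝ → ℝ, ∀ s ∈ Ioo (0 : ℝ) 1, HasDerivAt (prim g) (y₁ s) s ∧
      HasDerivAt y₁ (-(1 / (3 * α) * (β * (prim g s) ^ (-(1 / 3) : ℝ) +
        w s * (prim g s) ^ (-(5 / 3) : ℝ)))) s := by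
  have hcy : ContinuousOn (prim g) (Ioo 0 1) := (prim_continuousOn g).mono Ioo_subset_Icc_self
  have hpow : ∀ r : ℝ, ContinuousOn (fun s => (prim g s) ^ r) (Ioo 0 1) := fun r =>
    hcy.rpow_const fun s hs => Or.inl (hg.pos hη hs).ne'
  have hca := hpow (-(1 / 3))
  have hcb : ContinuousOn (fun s => w s * (prim g s) ^ (-(5 / 3) : ℝ)) (Ioo 0 1) :=
    (hw.mono Ioo_subset_Icc_self).mul (hpow _)
  obtain ⟨za, za₁, ha⟩ := exists_second_primitive hca
  obtain ⟨zb, zb₁, hb⟩ := exists_second_primitive hcb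
  -- A second primitive of the right-hand side of the expected equation. Testing with tents shows
  -- that the profile minus z has vanishing second differences, hence is affine.
  set z : ℝ → ℝ := fun s => -(1 / (3 * α)) * (β * za s + zb s) with hz
  have hzc : ContinuousOn z (Ioo 0 1) := fun s hs =>
    ((((ha s hs).1.const_mul β).add (hb s hs).1).const_mul _).continuousAt.continuousWithinAt
  have hsd : ∀ s r, 0 < r → 0 < s - r → s + r < 1 →
      2 * (prim g s - z s) - (prim g (s + r) - z (s + r)) - (prim g (s - r) - z (s - r)) = 0 := by
    intro s r hr h0 h1
    have hsub : Icc (s - r) (s + r) ⊆ Ioo 0 1 := Icc_subset_Ioo h0 h1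
    obtain ⟨s₁, hs₁, hmin₁⟩ := isCompact_Icc.exists_isMinOn
      (nonempty_Icc.2 (by linarith : s - r ≤ s + r)) (hcy.mono hsub)
    have hm := hg.pos hη (hsub hs₁)
    have hone : (1 : ℝ) ∉ Icc (s - r) (s + r) := fun h => by linarith [h.2]
    -- The tent is admissible because its support lies in the open interval, where the profile has a
    -- positive minimum; the constant C compares the two.
    have hv := hmin.variation (ψ := tentKer s r) (C := r / prim g s₁) hα hw hη hg
      (by rw [prim_tentKer hr h0.le h1.le ⟨zero_le_one, le_rfl⟩, tent_eq_zero hone])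
      (by positivity) (fun t ht => by
        rw [prim_tentKer hr h0.le h1.le ht, abs_of_nonneg (tent_nonneg _ _ _)]
        by_cases hI : t ∈ Icc (s - r) (s + r)
        · have h2 : prim g s₁ ≤ prim g t := hmin₁ hI
          calc tent s r t ≤ r := tent_le hr.le t
            _ = r / prim g s₁ * prim g s₁ := by field_simp
            _ ≤ r / prim g s₁ * prim g t := by gcongr
        · rw [tent_eq_zero hI]
          have := hg.nonneg hη ht
          positivity)
    have e1 : ∫ t in (0 : ℝ)..1, (prim g t) ^ (-(1 / 3) : ℝ) * prim (tentKer s r) t =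
        za (s + r) + za (s - r) - 2 * za s := by
      rw [← integral_mul_tent hr h0.le h1.le (fun t ht => (ha t (hsub ht)).1)
        (fun t ht => (ha t (hsub ht)).2) (hca.mono hsub)]
      refine intervalIntegral.integral_congr fun t ht => ?_
      rw [uIcc_of_le zero_le_one] at ht
      simp only [prim_tentKer hr h0.le h1.le ht]
    have e2 : ∫ t in (0 : ℝ)..1, w t * ((prim g t) ^ (-(5 / 3) : ℝ) * prim (tentKer s r) t) =
        zb (s + r) + zb (s - r) - 2 * zb s := by
      rw [← integral_mul_tent hr h0.le h1.le (fun t ht => (hb t (hsub ht)).1)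
        (fun t ht => (hb t (hsub ht)).2) (hcb.mono hsub)]
      refine intervalIntegral.integral_congr fun t ht => ?_
      rw [uIcc_of_le zero_le_one] at ht
      simp only [prim_tentKer hr h0.le h1.le ht]
      ring
    rw [inner_tentKer, e1, e2] at hv
    simp only [hz]
    field_simp
    linarith
  obtain ⟨A, B, hAB⟩ := affine_of_second_difference (hcy.sub hzc) hsd
  refine ⟨fun s => -(1 / (3 * α)) * (β * za₁ s + zb₁ s) + B, fun s hs => ⟨?_, ?_⟩⟩
  · have h1 : HasDerivAt (fun s => z s + (A + B * s))
        (-(1 / (3 * α)) * (β * za₁ s + zb₁ s) + B) s :=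
      ((((ha s hs).1.const_mul β).add (hb s hs).1).const_mul _).add
        ((((hasDerivAt_id' s).const_mul B).const_add A).congr_deriv (by simp))
    refine h1.congr_of_eventuallyEq ?_
    filter_upwards [Ioo_mem_nhds hs.1 hs.2] with t ht
    rw [← hAB t ht]; simp
  · exact (((((ha s hs).2.const_mul β).add (hb s hs).2).const_mul _).add_const B).congr_deriv
      (by ring)

/-! ### Laps in the height variable and their derivatives up to the turning points. -/

lemma rpow_third {x : ℝ} (hx : 0 < x) :
    0 < x ^ (1 / 3 : ℝ) ∧ x ^ (2 / 3 : ℝ) = (x ^ (1 / 3 : ℝ)) ^ 2 ∧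
      x ^ (-(2 / 3) : ℝ) = ((x ^ (1 / 3 : ℝ)) ^ 2)⁻¹ ∧ x ^ (-(1 / 3) : ℝ) = (x ^ (1 / 3 : ℝ))⁻¹ ∧
      x ^ (-(5 / 3) : ℝ) = ((x ^ (1 / 3 : ℝ)) ^ 5)⁻¹ := by
  have key : ∀ n : ℕ, (x ^ (1 / 3 : ℝ)) ^ n = x ^ (1 / 3 * n : ℝ) := fun n => by
    rw [Real.rpow_mul hx.le, Real.rpow_natCast]
  refine ⟨by positivity, ?_, ?_, ?_, ?_⟩
  · rw [key]; norm_num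
  · rw [key, ← Real.rpow_neg hx.le]; norm_num
  · rw [← Real.rpow_neg hx.le]
  · rw [key, ← Real.rpow_neg hx.le]; norm_num

lemma eq_add_integral_of_hasDerivAt {f f' : ℝ → ℝ} (hd : ∀ s ∈ Ioo (0 : ℝ) 1, HasDerivAt f (f' s) s)
    (hint : IntervalIntegrable f' volume 0 1) {s : ℝ} (hs : s ∈ Ioo (0 : ℝ) 1) :
    f s = f (1 / 2) + ∫ t in (1 / 2 : ℝ)..s, f' t := by
  have hsub : uIcc (1 / 2) s ⊆ Ioo (0 : ℝ) 1 :=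
    ordConnected_Ioo.uIcc_subset (by constructor <;> norm_num) hs
  rw [intervalIntegral.integral_eq_sub_of_hasDerivAt (fun t ht => hd t (hsub ht))
    (hint.mono_set (by rw [uIcc_of_le zero_le_one]; exact hsub.trans Ioo_subset_Icc_self))]
  ring

/-- A function on the open unit interval with integrable derivative extends continuously. -/
lemma exists_continuousOn_extension {f f' : ℝ → ℝ}
    (hd : ∀ s ∈ Ioo (0 : ℝ) 1, HasDerivAt f (f' s) s)
    (hint : IntervalIntegrable f' volume 0 1) :
    ∃ k : ℝ → ℝ, ContinuousOn k (Icc 0 1) ∧ ∀ s ∈ Ioo (0 : ℝ) 1, k s = f s := by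
  refine ⟨fun s => f (1 / 2) + ∫ t in (1 / 2 : ℝ)..s, f' t, ?_,
    fun s hs => (eq_add_integral_of_hasDerivAt hd hint hs).symm⟩
  have := intervalIntegral.continuousOn_primitive_interval' hint
    (show (1 / 2 : ℝ) ∈ uIcc 0 1 by rw [uIcc_of_le zero_le_one]; constructor <;> norm_num)
  rw [uIcc_of_le zero_le_one] at this
  exact continuousOn_const.add this

/-- The action of a monotone lap from `a` to `a + h`, written in terms of `y = (u')^{3/2}`. -/
noncomputable def lapEnergy (F : ℝ → ℝ) (q e a h : ℝ) (g : L2I) : ℝ :=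
  energy (2 / (9 * h)) (q / 2 * h) (fun s => h * (F (a + h * s) + e)) g

/-- `g` minimises the action of laps from `a` to `a + h`. -/
def IsLapMin (F : ℝ → ℝ) (q e a h : ℝ) (g : L2I) : Prop :=
  IsEnergyMin (2 / (9 * h)) (q / 2 * h) (fun s => h * (F (a + h * s) + e)) g

/-- The barrier height 9h²e/16 is the solution of 8αη = w₀ for α = 2/(9h) and w₀ = he. -/
lemma exists_isLapMin {F : ℝ → ℝ} (hF : Continuous F) (hF0 : ∀ t, 0 ≤ F t) {q e a h : ℝ}
    (hq : 0 ≤ q) (he : 0 < e) (hh : 0 < h) :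
    ∃ g, Above (min 1 (9 * h ^ 2 * e / 16)) g ∧ IsLapMin F q e a h g := by
  refine exists_isEnergyMin (w₀ := h * e) (by positivity) (by positivity)
    (by fun_prop) (by positivity) (fun s _ => ?_) (by positivity) (min_le_left _ _) ?_
  · have := hF0 (a + h * s)
    gcongr
    linarith
  · calc 8 * (2 / (9 * h)) * min 1 (9 * h ^ 2 * e / 16)
        ≤ 8 * (2 / (9 * h)) * (9 * h ^ 2 * e / 16) := by gcongr; exact min_le_right _ _
      _ = h * e := by field_simp; norm_num

/-- The derivatives of a lap as functions of the (normalised) height, continuous up to the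
turning points. -/
structure LapProfile (F F' : ℝ → ℝ) (q e a h : ℝ) (y P₂ P₃ : ℝ → ℝ) : Prop where
  cont₂ : ContinuousOn P₂ (Icc 0 1)
  cont₃ : ContinuousOn P₃ (Icc 0 1)
  deriv₁ : ∀ s ∈ Ioo (0 : ℝ) 1,
    HasDerivAt (fun s => (y s) ^ (2 / 3 : ℝ)) (h * (y s) ^ (-(2 / 3) : ℝ) * P₂ s) s
  deriv₂ : ∀ s ∈ Ioo (0 : ℝ) 1, HasDerivAt P₂ (h * (y s) ^ (-(2 / 3) : ℝ) * P₃ s) s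
  deriv₃ : ∀ s ∈ Ioo (0 : ℝ) 1,
    HasDerivAt P₃ (h * (y s) ^ (-(2 / 3) : ℝ) * (-q * P₂ s - F' (a + h * s))) s
  conservation : ∀ s ∈ Icc (0 : ℝ) 1, P₃ s * (y s) ^ (2 / 3 : ℝ) - P₂ s ^ 2 / 2 +
    q * ((y s) ^ (2 / 3 : ℝ)) ^ 2 / 2 + F (a + h * s) + e = 0

/-- With c = y^{1/3} one has u' = c², and the chain rule gives u''. The third derivative is defined
by solving the energy law for it. The fourth order equation then follows from the Euler–Lagrange
equation, and the remaining point is continuity at the turning points. -/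
lemma exists_lapProfile {F F' : ℝ → ℝ} (hF : ∀ t, HasDerivAt F (F' t) t) (hF' : Continuous F')
    {q e a h η : ℝ} (hh : 0 < h) {g : L2I} (hη : 0 < η) (hg : Above η g)
    (hmin : IsLapMin F q e a h g) :
    ∃ P₂ P₃, LapProfile F F' q e a h (prim g) P₂ P₃ := by
  have hFc : Continuous F := continuous_iff_continuousAt.2 fun t => (hF t).continuousAt
  obtain ⟨y₁, hy₁⟩ := hmin.ode (by positivity) (by fun_prop) hη hg
  set y := prim g with hy
  set c : ℝ → ℝ := fun s => (y s) ^ (1 / 3 : ℝ) with hc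
  set G : ℝ → ℝ := fun s => F (a + h * s) + e with hG
  have hpos : ∀ s ∈ Ioo (0 : ℝ) 1, 0 < y s := fun s hs => hg.pos hη hs
  have hcpos : ∀ s ∈ Ioo (0 : ℝ) 1, 0 < c s := fun s hs => (rpow_third (hpos s hs)).1
  have hdc : ∀ s ∈ Ioo (0 : ℝ) 1, HasDerivAt c (y₁ s / (3 * c s ^ 2)) s := by
    intro s hs
    have h1 := (hy₁ s hs).1.rpow_const (p := 1 / 3) (Or.inl (hpos s hs).ne')
    refine h1.congr_deriv ?_
    have h2 := (rpow_third (hpos s hs)).2.2.1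
    have h3 : (1 / 3 - 1 : ℝ) = -(2 / 3) := by norm_num
    rw [h3, h2]
    change y₁ s * (1 / 3) * (c s ^ 2)⁻¹ = _
    have := (hcpos s hs).ne'
    field_simp
  have hdy : ∀ s ∈ Ioo (0 : ℝ) 1,
      HasDerivAt y₁ (-(3 * h / 2 * (q / 2 * h / c s + h * G s / c s ^ 5))) s := by
    intro s hs
    refine (hy₁ s hs).2.congr_deriv ?_
    obtain ⟨-, -, -, h3, h4⟩ := rpow_third (hpos s hs)
    rw [h3, h4]
    simp only [hc, hG]
    field_simp
    norm_num
  have hdG : ∀ s, HasDerivAt G (F' (a + h * s) * h) s := by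
    intro s
    have h1 : HasDerivAt (fun s => a + h * s) h s := by
      simpa using ((hasDerivAt_id' s).const_mul h).const_add a
    exact ((hF (a + h * s)).comp s h1).add_const e
  set Q₁ : ℝ → ℝ := fun s => c s ^ 2 with hQ₁
  set Q₂ : ℝ → ℝ := fun s => 2 / (3 * h) * (c s * y₁ s) with hQ₂
  set Q₃ : ℝ → ℝ := fun s => 2 / (9 * h ^ 2) * y₁ s ^ 2 - q / 2 * c s ^ 2 - G s / c s ^ 2 with hQ₃
  set ρ : ℝ → ℝ := fun s => h * (y s) ^ (-(2 / 3) : ℝ) with hρ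
  have hρc : ∀ s ∈ Ioo (0 : ℝ) 1, ρ s = h / c s ^ 2 := by
    intro s hs
    simp only [hρ]
    rw [(rpow_third (hpos s hs)).2.2.1]
    rfl
  have hd1 : ∀ s ∈ Ioo (0 : ℝ) 1, HasDerivAt Q₁ (ρ s * Q₂ s) s := by
    intro s hs
    refine ((hdc s hs).pow 2).congr_deriv ?_
    rw [hρc s hs]
    have := (hcpos s hs).ne'
    simp only [hQ₂]
    field_simp
    norm_num
    try ring
  have hd2 : ∀ s ∈ Ioo (0 : ℝ) 1, HasDerivAt Q₂ (ρ s * Q₃ s) s := by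
    intro s hs
    refine (((hdc s hs).mul (hdy s hs)).const_mul (2 / (3 * h))).congr_deriv ?_
    rw [hρc s hs]
    have := (hcpos s hs).ne'
    simp only [hQ₃]
    field_simp
    ring
  have hd3 : ∀ s ∈ Ioo (0 : ℝ) 1,
      HasDerivAt Q₃ (ρ s * (-q * Q₂ s - F' (a + h * s))) s := by
    intro s hs
    refine (((((hdy s hs).pow 2).const_mul (2 / (9 * h ^ 2))).sub
      (((hdc s hs).pow 2).const_mul (q / 2))).sub
      ((hdG s).div ((hdc s hs).pow 2) (pow_ne_zero 2 (hcpos s hs).ne'))).congr_deriv ?_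
    rw [hρc s hs]
    have := (hcpos s hs).ne'
    simp only [hQ₂]
    field_simp
    norm_num
    try ring
  have hρi : ∀ k : ℝ → ℝ, ContinuousOn k (Icc 0 1) →
      IntervalIntegrable (fun s => ρ s * k s) volume 0 1 := by
    intro k hk
    refine (hg.intervalIntegrable hη ((continuousOn_const (c := h)).mul hk)).congr fun s _ => ?_
    simp only [hρ, hy, Pi.mul_apply]; ring
  have hQ₁y : ∀ s ∈ Ioo (0 : ℝ) 1, Q₁ s = (y s) ^ (2 / 3 : ℝ) := fun s hs =>
    (rpow_third (hpos s hs)).2.1.symm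
  -- The formula for Q₃ degenerates at the ends, but u''' + qu' has derivative −ρF' with ρ
  -- integrable, so it extends continuously. Then u'' + qu has derivative ρZ₁ and extends as well.
  obtain ⟨Z₁, hZ₁c, hZ₁⟩ := exists_continuousOn_extension (f := fun s => Q₃ s + q * Q₁ s)
    (f' := fun s => ρ s * (-F' (a + h * s)))
    (fun s hs => ((hd3 s hs).add ((hd1 s hs).const_mul q)).congr_deriv (by ring))
    (hρi _ (by fun_prop))
  have hb : ∀ s, HasDerivAt (fun s => a + h * s) h s := fun s => by
      simpa using ((hasDerivAt_id' s).const_mul h).const_add a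
  obtain ⟨Z₀, hZ₀c, hZ₀⟩ := exists_continuousOn_extension (f := fun s => Q₂ s + q * (a + h * s))
    (f' := fun s => ρ s * Z₁ s)
    (fun s hs => ((hd2 s hs).add ((hb s).const_mul q)).congr_deriv (by
      rw [hZ₁ s hs, hρc s hs]
      have := (hcpos s hs).ne'
      simp only [hQ₁]
      field_simp))
    (hρi _ hZ₁c)
  have hyc : ContinuousOn (fun s => (y s) ^ (2 / 3 : ℝ)) (Icc 0 1) :=
    (prim_continuousOn g).rpow_const fun _ _ => Or.inr (by norm_num)
  have hP2 : ∀ s ∈ Ioo (0 : ℝ) 1, Z₀ s - q * (a + h * s) = Q₂ s := fun s hs => by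
    rw [hZ₀ s hs]; ring
  have hP3 : ∀ s ∈ Ioo (0 : ℝ) 1, Z₁ s - q * (y s) ^ (2 / 3 : ℝ) = Q₃ s := fun s hs => by
    rw [hZ₁ s hs, hQ₁y s hs]; ring
  have hc2 : ContinuousOn (fun s => Z₀ s - q * (a + h * s)) (Icc 0 1) := hZ₀c.sub (by fun_prop)
  have hc3 : ContinuousOn (fun s => Z₁ s - q * (y s) ^ (2 / 3 : ℝ)) (Icc 0 1) :=
    hZ₁c.sub (hyc.const_mul q)
  refine ⟨fun s => Z₀ s - q * (a + h * s), fun s => Z₁ s - q * (y s) ^ (2 / 3 : ℝ), hc2, hc3,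
    ?_, ?_, ?_, ?_⟩
  · intro s hs
    simp only [hP2 s hs]
    exact (hd1 s hs).congr_of_eventuallyEq (by
      filter_upwards [Ioo_mem_nhds hs.1 hs.2] with t ht using (hQ₁y t ht).symm)
  · intro s hs
    simp only [hP3 s hs]
    exact (hd2 s hs).congr_of_eventuallyEq (by
      filter_upwards [Ioo_mem_nhds hs.1 hs.2] with t ht using hP2 t ht)
  · intro s hs
    simp only [hP2 s hs]
    exact (hd3 s hs).congr_of_eventuallyEq (by
      filter_upwards [Ioo_mem_nhds hs.1 hs.2] with t ht using hP3 t ht)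
  · have hclos : Icc (0 : ℝ) 1 = closure (Ioo 0 1) := (closure_Ioo (by norm_num)).symm
    have hEq : EqOn (fun s => (Z₁ s - q * (y s) ^ (2 / 3 : ℝ)) * (y s) ^ (2 / 3 : ℝ) -
        (Z₀ s - q * (a + h * s)) ^ 2 / 2 + q * ((y s) ^ (2 / 3 : ℝ)) ^ 2 / 2 + F (a + h * s) + e)
        (fun _ => 0) (Ioo 0 1) := by
      intro s hs
      simp only
      rw [hP2 s hs, hP3 s hs, ← hQ₁y s hs]
      have := (hcpos s hs).ne'
      simp only [hQ₁, hQ₂, hQ₃, hG]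
      field_simp
      ring
    exact hEq.of_subset_closure
      (((((hc3.mul hyc).sub ((hc2.pow 2).div_const 2)).add
        (((hyc.pow 2).const_mul q).div_const 2)).add
        (hFc.comp (by fun_prop)).continuousOn).add continuousOn_const)
      continuousOn_const Ioo_subset_Icc_self hclos.subset

/-! ### End point derivatives of the action, and positivity for small laps. -/

/-- The partial derivative of the lap action with respect to the height `h` of the lap. -/
noncomputable def partH (F F' : ℝ → ℝ) (q e a h : ℝ) (g : L2I) : ℝ :=
  -(2 / (9 * h ^ 2)) * ‖g‖ ^ 2 - q / 2 * (∫ s in (0 : ℝ)..1, (prim g s) ^ (2 / 3 : ℝ)) +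
    (∫ s in (0 : ℝ)..1, (F (a + h * s) + e) * (prim g s) ^ (-(2 / 3) : ℝ)) +
    h * ∫ s in (0 : ℝ)..1, (F' (a + h * s) * s) * (prim g s) ^ (-(2 / 3) : ℝ)

/-- The partial derivative of the lap action with respect to the starting point `a`. -/
noncomputable def partA (F' : ℝ → ℝ) (a h : ℝ) (g : L2I) : ℝ :=
  h * ∫ s in (0 : ℝ)..1, F' (a + h * s) * (prim g s) ^ (-(2 / 3) : ℝ)

section
variable {F F' : ℝ → ℝ} {q e a h η : ℝ} {g : L2I} {P₂ P₃ : ℝ → ℝ}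

lemma lapEnergy_eq (q e a h : ℝ) (g : L2I) :
    lapEnergy F q e a h g = 2 / (9 * h) * ‖g‖ ^ 2 -
      q / 2 * h * (∫ s in (0 : ℝ)..1, (prim g s) ^ (2 / 3 : ℝ)) +
      h * ∫ s in (0 : ℝ)..1, (F (a + h * s) + e) * (prim g s) ^ (-(2 / 3) : ℝ) := by
  unfold lapEnergy energy
  rw [← intervalIntegral.integral_const_mul h]
  simp only [← mul_assoc]

lemma IsLapMin.virial (hF : Continuous F) (hh : 0 < h) (hη : 0 < η) (hg : Above η g)
    (hmin : IsLapMin F q e a h g) :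
    3 * (2 / (9 * h) * ‖g‖ ^ 2) = q / 2 * h * (∫ s in (0 : ℝ)..1, (prim g s) ^ (2 / 3 : ℝ)) +
      h * ∫ s in (0 : ℝ)..1, (F (a + h * s) + e) * (prim g s) ^ (-(2 / 3) : ℝ) := by
  have := IsEnergyMin.virial (by positivity) (by fun_prop) hη hg hmin
  rw [this, ← intervalIntegral.integral_const_mul h]
  simp only [← mul_assoc]

lemma prim_rpow_zero (g : L2I) : (prim g 0) ^ (2 / 3 : ℝ) = 0 := by
  rw [prim_zero, Real.zero_rpow (by norm_num)]

lemma Above.prim_rpow_one (hg : Above η g) : (prim g 1) ^ (2 / 3 : ℝ) = 0 := by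
  rw [hg.1, Real.zero_rpow (by norm_num)]

lemma prim_rpow_continuousOn (g : L2I) :
    ContinuousOn (fun s => (prim g s) ^ (2 / 3 : ℝ)) (Icc 0 1) :=
  (prim_continuousOn g).rpow_const fun _ _ => Or.inr (by norm_num)

/-- Integrate (u''' + qu')' = −F'(u) over the lap, with u' = 0 at both ends. -/
lemma LapProfile.partA_eq (hP : LapProfile F F' q e a h (prim g) P₂ P₃) (hF' : Continuous F')
    (hη : 0 < η) (hg : Above η g) : partA F' a h g = P₃ 0 - P₃ 1 := by
  have hint := hg.intervalIntegrable hη (k := fun s => F' (a + h * s)) (by fun_prop)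
  have h1 := intervalIntegral.integral_eq_sub_of_hasDerivAt_of_le zero_le_one
    (f := fun s => -(P₃ s + q * (prim g s) ^ (2 / 3 : ℝ)))
    (f' := fun s => h * (F' (a + h * s) * (prim g s) ^ (-(2 / 3) : ℝ)))
    (hP.cont₃.add ((prim_rpow_continuousOn g).const_mul q)).neg
    (fun s hs => ((hP.deriv₃ s hs).add ((hP.deriv₁ s hs).const_mul q)).neg.congr_deriv (by ring))
    (hint.const_mul h)
  rw [intervalIntegral.integral_const_mul, prim_rpow_zero, hg.prim_rpow_one] at h1
  unfold partA
  rw [h1]; ring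

lemma hasDerivAt_add_mul (a h s : ℝ) : HasDerivAt (fun s : ℝ => a + h * s) h s := by
  simpa using ((hasDerivAt_id' s).const_mul h).const_add a

/-- The virial identity eliminates the kinetic term. By the energy law, what remains is, up to the
factor h, the integral of the derivative of −(u''' + qu')(u − a) + u'u''/3, to which only the upper
end contributes. -/
lemma LapProfile.partH_eq (hP : LapProfile F F' q e a h (prim g) P₂ P₃) (hF : Continuous F)
    (hF' : Continuous F') (hh : 0 < h) (hη : 0 < η) (hg : Above η g)
    (hmin : IsLapMin F q e a h g) : partH F F' q e a h g = -P₃ 1 := by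
  have hint1 := hg.intervalIntegrable hη (k := fun s => F (a + h * s) + e) (by fun_prop)
  have hint2 := hg.intervalIntegrable hη (k := fun s => F' (a + h * s) * s) (by fun_prop)
  have hint3 := intervalIntegrable_prim_rpow g (r := 2 / 3) (by norm_num)
  have h1 := intervalIntegral.integral_eq_sub_of_hasDerivAt_of_le zero_le_one
    (f := fun s => -(P₃ s + q * (prim g s) ^ (2 / 3 : ℝ)) * (h * s) +
      1 / 3 * ((prim g s) ^ (2 / 3 : ℝ) * P₂ s))
    (f' := fun s => h * (2 / 3 * ((F (a + h * s) + e) * (prim g s) ^ (-(2 / 3) : ℝ)) -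
      2 / 3 * q * (prim g s) ^ (2 / 3 : ℝ) +
      h * ((F' (a + h * s) * s) * (prim g s) ^ (-(2 / 3) : ℝ))))
    (((hP.cont₃.add ((prim_rpow_continuousOn g).const_mul q)).neg.mul (by fun_prop)).add
      (((prim_rpow_continuousOn g).mul hP.cont₂).const_mul _))
    (fun s hs => by
      refine ((((hP.deriv₃ s hs).add ((hP.deriv₁ s hs).const_mul q)).neg.mul
        ((hasDerivAt_id' s).const_mul h)).add
        (((hP.deriv₁ s hs).mul (hP.deriv₂ s hs)).const_mul (1 / 3))).congr_deriv ?_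
      have hc := hP.conservation s ⟨hs.1.le, hs.2.le⟩
      have hp := hg.pos hη hs
      have hy : (prim g s) ^ (-(2 / 3) : ℝ) * (prim g s) ^ (2 / 3 : ℝ) = 1 := by
        rw [← Real.rpow_add hp]; norm_num
      set Y := (prim g s) ^ (2 / 3 : ℝ)
      set Z := (prim g s) ^ (-(2 / 3) : ℝ)
      have hP2 : P₂ s ^ 2 = 2 * (P₃ s * Y + q * Y ^ 2 / 2 + F (a + h * s) + e) := by linarith
      simp only [Pi.neg_apply, Pi.add_apply]
      linear_combination (1 / 3 * h * Z) * hP2 + h * (P₃ s + 1 / 3 * q * Y) * hy)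
    (((hint1.const_mul _).sub (hint3.const_mul _)).add (hint2.const_mul h) |>.const_mul h)
  rw [intervalIntegral.integral_const_mul,
    intervalIntegral.integral_add ((hint1.const_mul _).sub (hint3.const_mul _)) (hint2.const_mul h),
    intervalIntegral.integral_sub (hint1.const_mul _) (hint3.const_mul _),
    intervalIntegral.integral_const_mul, intervalIntegral.integral_const_mul,
    intervalIntegral.integral_const_mul, prim_rpow_zero, hg.prim_rpow_one] at h1
  have hv := hmin.virial hF hh hη hg
  unfold partH
  set B := ∫ s in (0 : ℝ)..1, (prim g s) ^ (2 / 3 : ℝ)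
  set W := ∫ s in (0 : ℝ)..1, (F (a + h * s) + e) * (prim g s) ^ (-(2 / 3) : ℝ)
  set V := ∫ s in (0 : ℝ)..1, (F' (a + h * s) * s) * (prim g s) ^ (-(2 / 3) : ℝ)
  have e1 : 2 / 3 * W - 2 / 3 * q * B + h * V = -P₃ 1 := by
    have : h * (2 / 3 * W - 2 / 3 * q * B + h * V) = h * -P₃ 1 := by rw [h1]; ring
    exact mul_left_cancel₀ hh.ne' this
  have e2 : 2 / (9 * h ^ 2) * ‖g‖ ^ 2 = (q / 2 * B + W) / 3 := by
    field_simp at hv ⊢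
    linarith
  rw [neg_mul, e2]
  linarith

lemma hasDerivAt_mul_abs (t : ℝ) : HasDerivAt (fun t : ℝ => t * |t|) (2 * |t|) t := by
  rcases lt_trichotomy t 0 with h | h | h
  · refine ((hasDerivAt_id' t).mul (hasDerivAt_abs_neg h)).congr_deriv ?_
    rw [abs_of_neg h]; ring
  · subst h
    rw [hasDerivAt_iff_isLittleO, Asymptotics.isLittleO_iff]
    intro c hc
    filter_upwards [Metric.ball_mem_nhds (0 : ℝ) hc] with x hx
    have hx' : |x| ≤ c := by simpa using (Metric.mem_ball.1 hx).le
    simp only [abs_zero, mul_zero, smul_zero, sub_zero, Real.norm_eq_abs, abs_mul, abs_abs]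
    exact mul_le_mul_of_nonneg_right hx' (abs_nonneg _)
  · refine ((hasDerivAt_id' t).mul (hasDerivAt_abs_pos h)).congr_deriv ?_
    rw [abs_of_pos h]; ring

/-- Multiply by 1/2 − κ and complete the square; the hypothesis is the determinant condition for the
shifted quadratic form. -/
lemma quadratic_coercive {q σ κ X u : ℝ} (hκ : κ < 1 / 2)
    (h : q ^ 2 / 16 ≤ (1 / 2 - κ) * (σ / 2 - κ)) :
    κ * (X ^ 2 + u ^ 2) ≤ 1 / 2 * X ^ 2 + q / 2 * (u * X) + σ / 2 * u ^ 2 := by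
  have hA : 0 < 1 / 2 - κ := by linarith
  have : 0 ≤ (1 / 2 - κ) *
      (1 / 2 * X ^ 2 + q / 2 * (u * X) + σ / 2 * u ^ 2 - κ * (X ^ 2 + u ^ 2)) := by
    have e : (1 / 2 - κ) *
      (1 / 2 * X ^ 2 + q / 2 * (u * X) + σ / 2 * u ^ 2 - κ * (X ^ 2 + u ^ 2)) =
      ((1 / 2 - κ) * X + q / 4 * u) ^ 2 + ((1 / 2 - κ) * (σ / 2 - κ) - q ^ 2 / 16) * u ^ 2 := by
      ring
    rw [e]
    have : 0 ≤ (1 / 2 - κ) * (σ / 2 - κ) - q ^ 2 / 16 := by linarith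
    positivity
  have := nonneg_of_mul_nonneg_right this hA
  linarith

/-- Small laps around the saddle-focus have positive action. -/
lemma LapProfile.barrier (hP : LapProfile F F' q e a h (prim g) P₂ P₃) (hF : Continuous F)
    (he : 0 ≤ e) (hh : 0 < h) (hη : 0 < η) (hg : Above η g) (hmin : IsLapMin F q e a h g) {σ κ δ : ℝ}
    (hκ0 : 0 ≤ κ) (hκ : κ < 1 / 2) (hκσ : q ^ 2 / 16 ≤ (1 / 2 - κ) * (σ / 2 - κ))
    (hσ : ∀ t, |t| ≤ δ → σ / 2 * t ^ 2 ≤ F t) (ha : a ≤ 0) (hb : 0 ≤ a + h) (ha' : -δ ≤ a)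
    (hb' : a + h ≤ δ) :
    2 * κ / 3 * (a ^ 2 + (a + h) ^ 2) ≤ lapEnergy F q e a h g := by
  have hint1 := hg.intervalIntegrable hη (k := fun s => F (a + h * s) + e) (by fun_prop)
  have hint3 := intervalIntegrable_prim_rpow g (r := 2 / 3) (by norm_num)
  have hint := ((hint1.const_mul (4 / 3)).sub (hint3.const_mul (q / 3))).const_mul h
  have hy := prim_rpow_continuousOn g
  -- A calibration. By the virial identity the action is the integral of φ, and along the lap the
  -- function (2κ/3) u|u| − (2κ/3 + q/2) uu' − u'u''/3 grows no faster, thanks to the energy law and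
  -- `quadratic_coercive`. At the turning points only u|u| survives, and a ≤ 0 ≤ a + h turns its
  -- increment into a sum of squares.
  have h1 := intervalIntegral.sub_le_integral_of_hasDeriv_right_of_le zero_le_one
    (g := fun s => 2 * κ / 3 * ((a + h * s) * |a + h * s|) -
      (2 * κ / 3 + q / 2) * ((a + h * s) * (prim g s) ^ (2 / 3 : ℝ)) -
      1 / 3 * ((prim g s) ^ (2 / 3 : ℝ) * P₂ s))
    (g' := fun s => 2 * κ / 3 * (2 * |a + h * s| * h) -
      (2 * κ / 3 + q / 2) * (h * (prim g s) ^ (2 / 3 : ℝ) +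
        (a + h * s) * (h * (prim g s) ^ (-(2 / 3) : ℝ) * P₂ s)) -
      1 / 3 * (h * (prim g s) ^ (-(2 / 3) : ℝ) * P₂ s * P₂ s + (prim g s) ^ (2 / 3 : ℝ) *
        (h * (prim g s) ^ (-(2 / 3) : ℝ) * P₃ s)))
    (φ := fun s => h * (4 / 3 * ((F (a + h * s) + e) * (prim g s) ^ (-(2 / 3) : ℝ)) -
      q / 3 * (prim g s) ^ (2 / 3 : ℝ)))
    ((ContinuousOn.sub (by fun_prop)
      (((by fun_prop : ContinuousOn (fun s : ℝ => a + h * s) (Icc 0 1)).mul hy).const_mul _)).sub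
      ((hy.mul hP.cont₂).const_mul _))
    (fun s hs => by
      have hu := hasDerivAt_add_mul a h s
      exact (((((hasDerivAt_mul_abs (a + h * s)).comp s hu).const_mul (2 * κ / 3)).sub
        ((hu.mul (hP.deriv₁ s hs)).const_mul (2 * κ / 3 + q / 2))).sub
        (((hP.deriv₁ s hs).mul (hP.deriv₂ s hs)).const_mul (1 / 3))).hasDerivWithinAt)
    ((intervalIntegrable_iff_integrableOn_Icc_of_le zero_le_one).1 hint)
    (fun s hs => by
      have hc := hP.conservation s ⟨hs.1.le, hs.2.le⟩
      have hp := hg.pos hη hs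
      have hyz : (prim g s) ^ (-(2 / 3) : ℝ) * (prim g s) ^ (2 / 3 : ℝ) = 1 := by
        rw [← Real.rpow_add hp]; norm_num
      have hZ : 0 < (prim g s) ^ (-(2 / 3) : ℝ) := by positivity
      have hY : 0 < (prim g s) ^ (2 / 3 : ℝ) := by positivity
      set Y := (prim g s) ^ (2 / 3 : ℝ)
      set Z := (prim g s) ^ (-(2 / 3) : ℝ)
      set u := a + h * s with hu
      have hul : -δ ≤ u := by have := mul_nonneg hh.le hs.1.le; linarith
      have huu : u ≤ δ := by nlinarith [hs.2]
      have hFu := hσ u (abs_le.2 ⟨hul, huu⟩)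
      have hquad := quadratic_coercive (X := P₂ s) (u := u) hκ hκσ
      have hu2 : |u| ^ 2 = u ^ 2 := sq_abs u
      have hab : 2 * (|u| * Y) ≤ 3 / 2 * (P₂ s ^ 2 + u ^ 2) + (Y ^ 2 + u * P₂ s) := by
        nlinarith [sq_nonneg (|u| - Y), sq_nonneg (u + P₂ s)]
      have hab' := mul_le_mul_of_nonneg_left hab (show 0 ≤ 2 * κ / 3 by positivity)
      have main : 2 * κ / 3 * (2 * (|u| * Y)) - (2 * κ / 3 + q / 2) * (Y ^ 2 + u * P₂ s) -
          1 / 3 * (P₂ s ^ 2 + Y * P₃ s) ≤ 4 / 3 * (F u + e) - q / 3 * Y ^ 2 := by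
        linarith
      have := mul_le_mul_of_nonneg_left main (show 0 ≤ h * Z by positivity)
      have e1 : h * Z * (2 * κ / 3 * (2 * (|u| * Y)) - (2 * κ / 3 + q / 2) * (Y ^ 2 + u * P₂ s) -
          1 / 3 * (P₂ s ^ 2 + Y * P₃ s)) = 2 * κ / 3 * (2 * |u| * h) -
        (2 * κ / 3 + q / 2) * (h * Y + u * (h * Z * P₂ s)) -
        1 / 3 * (h * Z * P₂ s * P₂ s + Y * (h * Z * P₃ s)) := by
        linear_combination (2 * κ / 3 * 2 * |u| * h - (2 * κ / 3 + q / 2) * h * Y) * hyz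
      have e2 : h * Z * (4 / 3 * (F u + e) - q / 3 * Y ^ 2) =
        h * (4 / 3 * ((F u + e) * Z) - q / 3 * Y) := by
        linear_combination (-(q / 3) * h * Y) * hyz
      rw [e1, e2] at this
      exact this)
  rw [intervalIntegral.integral_const_mul, intervalIntegral.integral_sub (hint1.const_mul _)
    (hint3.const_mul _), intervalIntegral.integral_const_mul, intervalIntegral.integral_const_mul,
    prim_rpow_zero, hg.prim_rpow_one] at h1
  have hv := hmin.virial hF hh hη hg
  rw [lapEnergy_eq]
  simp only [mul_one, mul_zero, add_zero, zero_mul, sub_zero] at h1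
  rw [abs_of_nonpos ha, abs_of_nonneg hb] at h1
  linarith

end

/-! ### From height back to the original independent variable. -/

/-- A positive function on the unit interval is the density of an increasing change of variables. -/
lemma exists_reparametrization {ρ : ℝ → ℝ} (hc : ContinuousOn ρ (Ioo 0 1))
    (hpos : ∀ s ∈ Ioo (0 : ℝ) 1, 0 < ρ s) (hint : IntervalIntegrable ρ volume 0 1) :
    ∃ (T : ℝ) (τ : ℝ → ℝ), 0 < T ∧ Continuous τ ∧ StrictMono τ ∧ τ 0 = 0 ∧ τ T = 1 ∧
      ∀ x ∈ Ioo 0 T, HasDerivAt τ (ρ (τ x))⁻¹ x := by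
  -- The density is continued by 1 outside the unit interval, so that its primitive is an increasing
  -- bijection of the whole line.
  set k : ℝ → ℝ := indicator (Ioo 0 1) (fun s => ρ s - 1) with hk
  have hki : Integrable k := by
    rw [hk, integrable_indicator_iff measurableSet_Ioo]
    have := (intervalIntegrable_iff_integrableOn_Ioo_of_le zero_le_one).1
      (hint.sub (intervalIntegrable_const (c := (1 : ℝ))))
    exact this
  have hk1 : ∀ s, 0 < 1 + k s := fun s => by
    by_cases hs : s ∈ Ioo (0 : ℝ) 1
    · rw [hk, indicator_of_mem hs]; have := hpos s hs; linarith
    · rw [hk, indicator_of_notMem hs]; norm_num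
  set X : ℝ → ℝ := fun s => s + ∫ t in (0 : ℝ)..s, k t with hX
  have hXc : Continuous X :=
    continuous_id.add (intervalIntegral.continuous_primitive (fun _ _ => hki.intervalIntegrable) 0)
  have hXm : StrictMono X := by
    intro s t hst
    have h1 := intervalIntegral.intervalIntegral_pos_of_pos (f := fun s => 1 + k s)
      (intervalIntegrable_const.add hki.intervalIntegrable) hk1 hst
    rw [intervalIntegral.integral_add intervalIntegrable_const hki.intervalIntegrable] at h1
    have h2 := intervalIntegral.integral_interval_sub_left
      (hki.intervalIntegrable (a := 0) (b := t)) (hki.intervalIntegrable (a := 0) (b := s))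
    simp only [intervalIntegral.integral_const, smul_eq_mul, mul_one] at h1
    simp only [hX]
    linarith
  have hXb : ∀ s, |X s - s| ≤ ∫ t, ‖k t‖ := fun s => by
    simp only [hX, add_sub_cancel_left]
    rw [← Real.norm_eq_abs]
    exact (intervalIntegral.norm_integral_le_integral_norm_uIoc).trans
      (setIntegral_le_integral hki.norm (ae_of_all _ fun _ => norm_nonneg _))
  have hXs : Function.Surjective X := by
    refine hXc.surjective ?_ ?_
    · refine tendsto_atTop_mono (f := fun s => s - ∫ t, ‖k t‖) (fun s => ?_)
        (tendsto_atTop_add_const_right _ _ tendsto_id)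
      have := (abs_le.1 (hXb s)).1; linarith
    · refine tendsto_atBot_mono (g := X) (f := fun s => s + ∫ t, ‖k t‖) (fun s => ?_)
        (tendsto_atBot_add_const_right _ _ tendsto_id)
      have := (abs_le.1 (hXb s)).2; linarith
  set O := StrictMono.orderIsoOfSurjective X hXm hXs with hO
  have hOX : ∀ s, O.symm (X s) = s := fun s => O.symm_apply_apply s
  have hXO : ∀ s, X (O.symm s) = s := fun s => O.apply_symm_apply s
  have hX0 : X 0 = 0 := by simp [hX]
  refine ⟨X 1, O.symm, ?_, O.symm.continuous, O.symm.strictMono, ?_, hOX 1, ?_⟩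
  · rw [← hX0]; exact hXm zero_lt_one
  · conv_lhs => rw [← hX0]
    exact hOX 0
  · intro x hx
    have hs : O.symm x ∈ Ioo (0 : ℝ) 1 := by
      constructor
      · rw [← hOX 0, hX0]; exact O.symm.strictMono hx.1
      · rw [← hOX 1]; exact O.symm.strictMono hx.2
    set s := O.symm x with hsx
    have hkc : ContinuousOn k (Ioo 0 1) :=
      (hc.sub (continuousOn_const (c := 1))).congr fun t ht => by
        rw [hk, indicator_of_mem ht]; rfl
    have hd : HasDerivAt X (ρ s) s := by
      have := (hasDerivAt_id' s).add (intervalIntegral.integral_hasDerivAt_right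
        (hki.intervalIntegrable (a := 0) (b := s))
        (hkc.stronglyMeasurableAtFilter isOpen_Ioo s hs)
        (hkc.continuousAt (Ioo_mem_nhds hs.1 hs.2)))
      refine this.congr_deriv ?_
      rw [hk, indicator_of_mem hs]; ring
    exact hd.of_local_left_inverse O.symm.continuous.continuousAt (hpos s hs).ne'
      (Eventually.of_forall hXO)

/-- A monotone solution of the fourth order equation on `[0, T]` between two turning points. -/
structure Lap (q : ℝ) (f : ℝ → ℝ) (T : ℝ) (u₀ u₁ u₂ u₃ : ℝ → ℝ) : Prop where
  pos : 0 < T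
  cont₀ : ContinuousOn u₀ (Icc 0 T)
  cont₁ : ContinuousOn u₁ (Icc 0 T)
  cont₂ : ContinuousOn u₂ (Icc 0 T)
  cont₃ : ContinuousOn u₃ (Icc 0 T)
  deriv₀ : ∀ x ∈ Ioo 0 T, HasDerivAt u₀ (u₁ x) x
  deriv₁ : ∀ x ∈ Ioo 0 T, HasDerivAt u₁ (u₂ x) x
  deriv₂ : ∀ x ∈ Ioo 0 T, HasDerivAt u₂ (u₃ x) x
  deriv₃ : ∀ x ∈ Ioo 0 T, HasDerivAt u₃ (-q * u₂ x - f (u₀ x)) x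
  left₁ : u₁ 0 = 0
  right₁ : u₁ T = 0
  pos₁ : ∀ x ∈ Ioo 0 T, 0 < u₁ x

section
variable {F F' : ℝ → ℝ} {q e a h η : ℝ} {g : L2I} {P₂ P₃ : ℝ → ℝ}

/-- The independent variable is x = ∫ h y^{-2/3} ds, whose total T is finite thanks to the barrier.
The values of u''² at the ends are the energy law at u' = 0. -/
lemma LapProfile.exists_lap (hP : LapProfile F F' q e a h (prim g) P₂ P₃)
    (hh : 0 < h) (hη : 0 < η) (hg : Above η g) :
    ∃ T u₀ u₁ u₂ u₃, Lap q F' T u₀ u₁ u₂ u₃ ∧ u₀ 0 = a ∧ u₀ T = a + h ∧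
      u₂ 0 ^ 2 = 2 * (F a + e) ∧ u₂ T ^ 2 = 2 * (F (a + h) + e) ∧ u₃ 0 = P₃ 0 ∧ u₃ T = P₃ 1 := by
  have hρc : ContinuousOn (fun s => h * (prim g s) ^ (-(2 / 3) : ℝ)) (Ioo 0 1) :=
    (((prim_continuousOn g).mono Ioo_subset_Icc_self).rpow_const
      fun s hs => Or.inl (hg.pos hη hs).ne').const_mul h
  have hρp : ∀ s ∈ Ioo (0 : ℝ) 1, 0 < h * (prim g s) ^ (-(2 / 3) : ℝ) := fun s hs => by
    have := hg.pos hη hs; positivity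
  obtain ⟨T, τ, hT, hτc, hτm, hτ0, hτT, hτd⟩ := exists_reparametrization hρc hρp
    (hg.intervalIntegrable hη (k := fun _ => h) continuousOn_const)
  have hmaps : MapsTo τ (Icc 0 T) (Icc 0 1) := fun x hx => by
    rw [← hτ0, ← hτT]; exact ⟨hτm.monotone hx.1, hτm.monotone hx.2⟩
  have hmem : ∀ x ∈ Ioo 0 T, τ x ∈ Ioo (0 : ℝ) 1 := fun x hx => by
    rw [← hτ0, ← hτT]; exact ⟨hτm hx.1, hτm hx.2⟩
  have hcomp : ∀ {p : ℝ → ℝ} {p' : ℝ → ℝ},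
      (∀ s ∈ Ioo (0 : ℝ) 1, HasDerivAt p (h * (prim g s) ^ (-(2 / 3) : ℝ) * p' s) s) →
      ∀ x ∈ Ioo 0 T, HasDerivAt (fun x => p (τ x)) (p' (τ x)) x := by
    intro p p' hp x hx
    refine ((hp _ (hmem x hx)).comp x (hτd x hx)).congr_deriv ?_
    rw [mul_comm, inv_mul_cancel_left₀ (hρp _ (hmem x hx)).ne']
  have hc0 := hP.conservation 0 ⟨le_rfl, zero_le_one⟩
  have hc1 := hP.conservation 1 ⟨zero_le_one, le_rfl⟩
  rw [prim_rpow_zero] at hc0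
  rw [hg.prim_rpow_one] at hc1
  simp only [mul_zero, add_zero, mul_one] at hc0 hc1
  refine ⟨T, fun x => a + h * τ x, fun x => (prim g (τ x)) ^ (2 / 3 : ℝ), fun x => P₂ (τ x),
    fun x => P₃ (τ x), ⟨hT, by fun_prop,
      (prim_rpow_continuousOn g).comp hτc.continuousOn hmaps,
      hP.cont₂.comp hτc.continuousOn hmaps, hP.cont₃.comp hτc.continuousOn hmaps,
      ?_, hcomp hP.deriv₁, hcomp hP.deriv₂, hcomp hP.deriv₃, ?_, ?_, ?_⟩,
    ?_, ?_, ?_, ?_, ?_, ?_⟩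
  · refine hcomp (p := fun s => a + h * s) (p' := fun s => (prim g s) ^ (2 / 3 : ℝ)) fun s hs => ?_
    refine (hasDerivAt_add_mul a h s).congr_deriv ?_
    rw [mul_assoc, ← Real.rpow_add (hg.pos hη hs)]
    norm_num
  · simp only [hτ0]; exact prim_rpow_zero g
  · simp only [hτT]; exact hg.prim_rpow_one
  · intro x hx
    have := hg.pos hη (hmem x hx)
    positivity
  · simp [hτ0]
  · simp [hτT]
  · simp only [hτ0]; linarith
  · simp only [hτT]; linarith
  · simp only [hτ0]
  · simp only [hτT]

end

/-! ### Periodic extension by reflection. -/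

lemma hasDerivAt_of_off_countable {f f' : ℝ → ℝ} {s : Set ℝ} (hs : s.Countable)
    (hf : Continuous f) (hf' : Continuous f') (hd : ∀ x ∉ s, HasDerivAt f (f' x) x) (x : ℝ) :
    HasDerivAt f (f' x) x := by
  have h1 : f = fun y => f 0 + ∫ t in (0 : ℝ)..y, f' t := by
    funext y
    rw [integral_eq_of_hasDerivAt_off_countable f f' hs hf.continuousOn
      (fun z hz => hd z hz.2) (hf'.intervalIntegrable _ _)]
    ring
  rw [h1]
  exact (intervalIntegral.integral_hasDerivAt_right (hf'.intervalIntegrable _ _)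
    hf'.aestronglyMeasurable.stronglyMeasurableAtFilter hf'.continuousAt).const_add _

/-- The `2T`-periodic function agreeing with `φ` on `[-T, T)`. -/
noncomputable def periodize {T : ℝ} (hT : 0 < 2 * T) (φ : ℝ → ℝ) (x : ℝ) : ℝ :=
  φ (toIcoMod hT (-T) x)

lemma periodize_periodic {T : ℝ} (hT : 0 < 2 * T) (φ : ℝ → ℝ) :
    Function.Periodic (periodize hT φ) (2 * T) := fun x => by
  unfold periodize; rw [toIcoMod_periodic hT (-T) x]

lemma continuous_periodize {T : ℝ} (hT : 0 < 2 * T) {φ : ℝ → ℝ}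
    (hc : ContinuousOn φ (Icc (-T) T)) (he : φ (-T) = φ T) : Continuous (periodize hT φ) := by
  have : Fact (0 < 2 * T) := ⟨hT⟩
  have hTT : -T + 2 * T = T := by ring
  have h := AddCircle.liftIco_continuous (p := 2 * T) (a := -T) (f := φ) (by rw [hTT, he])
    (by rw [hTT]; exact hc)
  have e : periodize hT φ = fun x : ℝ => AddCircle.liftIco (2 * T) (-T) φ (x : AddCircle (2 * T)) := by
    funext x
    have h2 : (x : AddCircle (2 * T)) = (toIcoMod hT (-T) x : ℝ) := by
      conv_lhs => rw [← toIcoMod_add_toIcoDiv_zsmul hT (-T) x]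
      rw [AddCircle.coe_add, AddCircle.coe_zsmul, AddCircle.coe_period, smul_zero, add_zero]
    rw [h2, AddCircle.liftIco_coe_apply (toIcoMod_mem_Ico hT (-T) x)]
    rfl
  rw [e]
  exact h.comp (AddCircle.continuous_mk' _)

lemma periodize_eq {T : ℝ} (hT : 0 < 2 * T) (φ : ℝ → ℝ) {x : ℝ} (hx : x ∈ Ico (-T) T) :
    periodize hT φ x = φ x := by
  unfold periodize
  rw [(toIcoMod_eq_self hT).2]
  exact ⟨hx.1, by linarith [hx.2]⟩

/-- The derivative is known off the multiples of T. At these points it is recovered from the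
continuity of both periodic extensions. -/
lemma hasDerivAt_periodize {T : ℝ} (hT : 0 < 2 * T) {φ ψ : ℝ → ℝ}
    (hφ : ContinuousOn φ (Icc (-T) T)) (hφe : φ (-T) = φ T)
    (hψ : ContinuousOn ψ (Icc (-T) T)) (hψe : ψ (-T) = ψ T)
    (hd : ∀ x ∈ Ioo (-T) T, x ≠ 0 → HasDerivAt φ (ψ x) x) (x : ℝ) :
    HasDerivAt (periodize hT φ) (periodize hT ψ x) x := by
  refine hasDerivAt_of_off_countable (s := range fun k : ℤ => k • T) (countable_range _)
    (continuous_periodize hT hφ hφe) (continuous_periodize hT hψ hψe) (fun x hx => ?_) x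
  set r := toIcoMod hT (-T) x with hr
  set k := toIcoDiv hT (-T) x with hk
  have hrx : x = r + k • (2 * T) := (toIcoMod_add_toIcoDiv_zsmul hT (-T) x).symm
  have hrm : r ∈ Ico (-T) (-T + 2 * T) := toIcoMod_mem_Ico hT (-T) x
  have h1 : r ≠ 0 := fun h => hx ⟨2 * k, by
    simp only [hrx, h, zsmul_eq_mul]; push_cast; ring⟩
  have h2 : r ≠ -T := fun h => hx ⟨2 * k - 1, by
    simp only [hrx, h, zsmul_eq_mul]; push_cast; ring⟩
  have hrI : r ∈ Ioo (-T) T := ⟨lt_of_le_of_ne hrm.1 h2.symm, by linarith [hrm.2]⟩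
  have h3 : HasDerivAt (periodize hT φ) (ψ r) r :=
    (hd r hrI h1).congr_of_eventuallyEq (by
      filter_upwards [Ioo_mem_nhds hrI.1 hrI.2] with y hy
      exact periodize_eq hT φ ⟨hy.1.le, hy.2⟩)
  have h4 : HasDerivAt (fun y => periodize hT φ (y - k • (2 * T))) (ψ r) x := by
    have : x - k • (2 * T) = r := by rw [hrx]; ring
    rw [← this] at h3
    exact (h3.comp_sub_const x (k • (2 * T))).congr_deriv (by rw [this])
  refine h4.congr_of_eventuallyEq (Eventually.of_forall fun y => ?_)
  exact ((periodize_periodic hT φ).sub_zsmul_eq k).symm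

/-- The odd extension of a function vanishing at the origin. -/
def oddExt (v : ℝ → ℝ) (x : ℝ) : ℝ := v (max x 0) - v (max (-x) 0)

section
variable {T : ℝ} {v w : ℝ → ℝ}

lemma continuousOn_evenExt (hv : ContinuousOn v (Icc 0 T)) :
    ContinuousOn (fun x => v |x|) (Icc (-T) T) :=
  hv.comp (by fun_prop) fun _ hx => ⟨abs_nonneg _, abs_le.2 hx⟩

lemma continuousOn_oddExt (hv : ContinuousOn v (Icc 0 T)) :
    ContinuousOn (oddExt v) (Icc (-T) T) := by
  refine (hv.comp (by fun_prop) fun x hx => ⟨le_max_right _ _, ?_⟩).sub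
    (hv.comp (by fun_prop) fun x hx => ⟨le_max_right _ _, ?_⟩)
  · exact max_le hx.2 (by linarith [hx.1, hx.2])
  · exact max_le (by linarith [hx.1]) (by linarith [hx.1, hx.2])

lemma oddExt_of_nonneg (h0 : v 0 = 0) {x : ℝ} (hx : 0 ≤ x) : oddExt v x = v x := by
  unfold oddExt
  rw [max_eq_left hx, max_eq_right (by linarith), h0, sub_zero]

lemma oddExt_of_nonpos (h0 : v 0 = 0) {x : ℝ} (hx : x ≤ 0) : oddExt v x = -v (-x) := by
  unfold oddExt
  rw [max_eq_right hx, max_eq_left (by linarith), h0, zero_sub]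

lemma hasDerivAt_evenExt (hd : ∀ x ∈ Ioo 0 T, HasDerivAt v (w x) x) (h0 : w 0 = 0) {x : ℝ}
    (hx : x ∈ Ioo (-T) T) (hx0 : x ≠ 0) : HasDerivAt (fun x => v |x|) (oddExt w x) x := by
  rcases lt_or_gt_of_ne hx0 with h | h
  · rw [oddExt_of_nonpos h0 h.le]
    have h1 : HasDerivAt v (w (-x)) |x| := by
      rw [abs_of_neg h]; exact hd _ ⟨by linarith, by linarith [hx.1]⟩
    exact (h1.comp x (hasDerivAt_abs_neg h)).congr_deriv (by ring)
  · rw [oddExt_of_nonneg h0 h.le]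
    have h1 : HasDerivAt v (w x) |x| := by rw [abs_of_pos h]; exact hd _ ⟨h, hx.2⟩
    exact (h1.comp x (hasDerivAt_abs_pos h)).congr_deriv (by ring)

lemma hasDerivAt_oddExt (hd : ∀ x ∈ Ioo 0 T, HasDerivAt v (w x) x) (h0 : v 0 = 0) {x : ℝ}
    (hx : x ∈ Ioo (-T) T) (hx0 : x ≠ 0) : HasDerivAt (oddExt v) (w |x|) x := by
  rcases lt_or_gt_of_ne hx0 with h | h
  · have h1 : HasDerivAt v (w (-x)) (-x) := hd _ ⟨by linarith, by linarith [hx.1]⟩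
    have h2 : HasDerivAt (fun y => -v (-y)) (w |x|) x :=
      (h1.comp x (hasDerivAt_neg x)).neg.congr_deriv (by rw [abs_of_neg h]; ring)
    refine h2.congr_of_eventuallyEq ?_
    filter_upwards [Iio_mem_nhds h] with y hy using oddExt_of_nonpos h0 (le_of_lt hy)
  · have h1 : HasDerivAt v (w |x|) x := by rw [abs_of_pos h]; exact hd _ ⟨h, hx.2⟩
    refine h1.congr_of_eventuallyEq ?_
    filter_upwards [Ioi_mem_nhds h] with y hy using oddExt_of_nonneg h0 (le_of_lt hy)

end

section
variable {q T : ℝ} {f u₀ u₁ u₂ u₃ : ℝ → ℝ}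

lemma Lap.strictMonoOn (hL : Lap q f T u₀ u₁ u₂ u₃) : StrictMonoOn u₀ (Icc 0 T) := by
  refine strictMonoOn_of_deriv_pos (convex_Icc 0 T) hL.cont₀ fun x hx => ?_
  rw [interior_Icc] at hx
  rw [(hL.deriv₀ x hx).deriv]
  exact hL.pos₁ x hx

/-- A lap whose third derivative vanishes at both turning points is half a period of an even
periodic solution. -/
lemma Lap.exists_periodic {F : ℝ → ℝ} (hL : Lap q (deriv F) T u₀ u₁ u₂ u₃)
    (hf : Continuous (deriv F)) (h0 : u₃ 0 = 0) (hT : u₃ T = 0) :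
    ∃ u, IsSwiftHohenbergSolution F q u ∧ IsNontrivialPeriodic u := by
  have hp := hL.pos
  have hT2 : 0 < 2 * T := by positivity
  have habs : |(-T)| = |T| := abs_neg T
  have hodd : ∀ v : ℝ → ℝ, v 0 = 0 → v T = 0 → oddExt v (-T) = oddExt v T := fun v h0 h1 => by
    rw [oddExt_of_nonneg h0 hp.le, oddExt_of_nonpos h0 (by linarith), neg_neg, h1, neg_zero]
  set u₄ : ℝ → ℝ := fun x => -q * u₂ x - deriv F (u₀ x) with hu₄
  have hc₄ : ContinuousOn u₄ (Icc 0 T) :=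
    (hL.cont₂.const_mul _).sub (hf.comp_continuousOn hL.cont₀)
  -- Parities alternate. The odd extensions of u' and u''' glue continuously at 0 and ±T because
  -- both functions vanish at the turning points.
  set U₀ := periodize hT2 (fun x => u₀ |x|) with hU₀
  set U₁ := periodize hT2 (oddExt u₁) with hU₁
  set U₂ := periodize hT2 (fun x => u₂ |x|) with hU₂
  set U₃ := periodize hT2 (oddExt u₃) with hU₃
  set U₄ := periodize hT2 (fun x => u₄ |x|) with hU₄
  have d0 : ∀ x, HasDerivAt U₀ (U₁ x) x := hasDerivAt_periodize hT2
    (continuousOn_evenExt hL.cont₀) (by simp only [habs]) (continuousOn_oddExt hL.cont₁)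
    (hodd _ hL.left₁ hL.right₁) fun x hx hx0 => hasDerivAt_evenExt hL.deriv₀ hL.left₁ hx hx0
  have d1 : ∀ x, HasDerivAt U₁ (U₂ x) x := hasDerivAt_periodize hT2
    (continuousOn_oddExt hL.cont₁) (hodd _ hL.left₁ hL.right₁)
    (continuousOn_evenExt hL.cont₂) (by simp only [habs])
    fun x hx hx0 => hasDerivAt_oddExt hL.deriv₁ hL.left₁ hx hx0
  have d2 : ∀ x, HasDerivAt U₂ (U₃ x) x := hasDerivAt_periodize hT2
    (continuousOn_evenExt hL.cont₂) (by simp only [habs]) (continuousOn_oddExt hL.cont₃)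
    (hodd _ h0 hT) fun x hx hx0 => hasDerivAt_evenExt hL.deriv₂ h0 hx hx0
  have d3 : ∀ x, HasDerivAt U₃ (U₄ x) x := hasDerivAt_periodize hT2
    (continuousOn_oddExt hL.cont₃) (hodd _ h0 hT)
    (continuousOn_evenExt hc₄) (by simp only [habs])
    fun x hx hx0 => hasDerivAt_oddExt hL.deriv₃ h0 hx hx0
  have hc4 : Continuous U₄ := continuous_periodize hT2 (continuousOn_evenExt hc₄)
    (by simp only [habs])
  have e0 : deriv U₀ = U₁ := funext fun x => (d0 x).deriv
  have e1 : deriv U₁ = U₂ := funext fun x => (d1 x).deriv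
  have e2 : deriv U₂ = U₃ := funext fun x => (d2 x).deriv
  have e3 : deriv U₃ = U₄ := funext fun x => (d3 x).deriv
  refine ⟨U₀, ⟨?_, fun x => ?_⟩, ⟨2 * T, hT2, periodize_periodic hT2 _⟩, ?_⟩
  · have c1 : ContDiff ℝ (0 + 1) U₃ := contDiff_succ_iff_deriv.2
      ⟨fun x => (d3 x).differentiableAt, by simp, by rw [e3]; exact contDiff_zero.2 hc4⟩
    have c2 : ContDiff ℝ (0 + 1 + 1) U₂ := contDiff_succ_iff_deriv.2
      ⟨fun x => (d2 x).differentiableAt, by simp, by rw [e2]; exact c1⟩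
    have c3 : ContDiff ℝ (0 + 1 + 1 + 1) U₁ := contDiff_succ_iff_deriv.2
      ⟨fun x => (d1 x).differentiableAt, fun h => absurd h (by decide), by rw [e1]; exact c2⟩
    have c4 : ContDiff ℝ (0 + 1 + 1 + 1 + 1) U₀ := contDiff_succ_iff_deriv.2
      ⟨fun x => (d0 x).differentiableAt, fun h => absurd h (by decide), by rw [e0]; exact c3⟩
    convert c4 using 1
    norm_num
  · have i2 : iteratedDeriv 2 U₀ = U₂ := by
      rw [iteratedDeriv_succ, iteratedDeriv_one, e0, e1]
    have i4 : iteratedDeriv 4 U₀ = U₄ := by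
      rw [iteratedDeriv_succ, iteratedDeriv_succ, i2, e2, e3]
    rw [i2, i4]
    simp only [hU₄, hU₂, hU₀, periodize, hu₄]
    ring
  · rintro ⟨c, hc⟩
    have h1 : u₀ 0 = c := by
      rw [← hc 0, hU₀, periodize_eq hT2 _ ⟨by linarith, hp⟩, abs_zero]
    have h2 : u₀ (T / 2) = c := by
      rw [← hc (T / 2), hU₀, periodize_eq hT2 _ ⟨by linarith, by linarith⟩,
        abs_of_pos (by linarith)]
    have := hL.strictMonoOn ⟨le_rfl, hp.le⟩ ⟨by linarith, by linarith⟩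
      (show 0 < T / 2 by linarith)
    rw [h1, h2] at this
    exact this.false

/-! ### Laps with an end at the saddle-focus. -/

lemma Lap.reflect (hL : Lap q f T u₀ u₁ u₂ u₃) :
    Lap q (fun x => -f (-x)) T (fun x => -u₀ (T - x)) (fun x => u₁ (T - x))
      (fun x => -u₂ (T - x)) (fun x => u₃ (T - x)) := by
  have hm : MapsTo (fun x => T - x) (Icc 0 T) (Icc 0 T) := fun x hx =>
    ⟨by linarith [hx.2], by linarith [hx.1]⟩
  have hm' : ∀ x ∈ Ioo 0 T, T - x ∈ Ioo 0 T := fun x hx =>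
    ⟨by linarith [hx.2], by linarith [hx.1]⟩
  have hd : ∀ x : ℝ, HasDerivAt (fun x => T - x) (-1) x := fun x => by
    simpa using (hasDerivAt_id' x).const_sub T
  have hc : ContinuousOn (fun x => T - x) (Icc 0 T) := by fun_prop
  refine ⟨hL.pos, (hL.cont₀.comp hc hm).neg, hL.cont₁.comp hc hm, (hL.cont₂.comp hc hm).neg,
    hL.cont₃.comp hc hm, fun x hx => ?_, fun x hx => ?_, fun x hx => ?_, fun x hx => ?_,
    by simpa using hL.right₁, by simpa using hL.left₁, fun x hx => hL.pos₁ _ (hm' x hx)⟩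
  · exact ((hL.deriv₀ _ (hm' x hx)).comp x (hd x)).neg.congr_deriv (by ring)
  · exact ((hL.deriv₁ _ (hm' x hx)).comp x (hd x)).congr_deriv (by ring)
  · exact ((hL.deriv₂ _ (hm' x hx)).comp x (hd x)).neg.congr_deriv (by ring)
  · exact ((hL.deriv₃ _ (hm' x hx)).comp x (hd x)).congr_deriv (by simp only [neg_neg]; ring)

/-- Near a saddle-focus a lap starting at the equilibrium with small second derivative and
nonpositive third derivative turns back before leaving the neighbourhood. -/
lemma Lap.false_of_saddleFocus (hL : Lap q f T u₀ u₁ u₂ u₃) {l m ε δ : ℝ} (hl : 0 < l)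
    (hm : 0 < m) (hq : q = 2 * (m ^ 2 - l ^ 2)) (hδ : 0 < δ)
    (hf : ∀ t ∈ Icc 0 δ, (l ^ 2 + m ^ 2) ^ 2 * t ≤ f t) (h0 : u₀ 0 = 0) (hT : δ ≤ u₀ T)
    (h2 : u₂ 0 ≤ ε) (hε0 : 0 ≤ ε) (h3 : u₃ 0 ≤ 0)
    (hε : ε * Real.sinh (l * (Real.pi / m)) < 2 * l * m * δ) : False := by
  -- Up to a constant, K is the fundamental solution of k'''' + qk'' + N²k = 0, whose exponents are
  -- ±l ± im. Its successive derivatives are NL, NL₁ and NL₂, so it vanishes at 0 with its first two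
  -- derivatives and K'''(0) = 2lmN.
  set K : ℝ → ℝ := fun t => l * (Real.cosh (l * t) * Real.sin (m * t)) -
    m * (Real.sinh (l * t) * Real.cos (m * t)) with hK
  set L : ℝ → ℝ := fun t => Real.sinh (l * t) * Real.sin (m * t) with hLd
  set L₁ : ℝ → ℝ := fun t => l * (Real.cosh (l * t) * Real.sin (m * t)) +
    m * (Real.sinh (l * t) * Real.cos (m * t)) with hL₁
  set L₂ : ℝ → ℝ := fun t => (l ^ 2 - m ^ 2) * L t +
    2 * l * m * (Real.cosh (l * t) * Real.cos (m * t)) with hL₂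
  set N := l ^ 2 + m ^ 2 with hN
  have hNp : 0 < N := by positivity
  have hlin : ∀ c t : ℝ, HasDerivAt (fun t => c * t) c t := fun c t => by
    simpa using (hasDerivAt_id' t).const_mul c
  have hsh : ∀ t, HasDerivAt (fun t => Real.sinh (l * t)) (Real.cosh (l * t) * l) t := fun t =>
    (Real.hasDerivAt_sinh (l * t)).comp t (hlin l t)
  have hch : ∀ t, HasDerivAt (fun t => Real.cosh (l * t)) (Real.sinh (l * t) * l) t := fun t =>
    (Real.hasDerivAt_cosh (l * t)).comp t (hlin l t)
  have hsi : ∀ t, HasDerivAt (fun t => Real.sin (m * t)) (Real.cos (m * t) * m) t := fun t =>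
    (Real.hasDerivAt_sin (m * t)).comp t (hlin m t)
  have hco : ∀ t, HasDerivAt (fun t => Real.cos (m * t)) (-Real.sin (m * t) * m) t := fun t =>
    (Real.hasDerivAt_cos (m * t)).comp t (hlin m t)
  have dK : ∀ t, HasDerivAt K (N * L t) t := fun t =>
    ((((hch t).mul (hsi t)).const_mul l).sub (((hsh t).mul (hco t)).const_mul m)).congr_deriv (by
      simp only [hN, hLd]; ring)
  have dL : ∀ t, HasDerivAt L (L₁ t) t := fun t =>
    ((hsh t).mul (hsi t)).congr_deriv (by simp only [hL₁]; ring)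
  have dL₁ : ∀ t, HasDerivAt L₁ (L₂ t) t := fun t =>
    ((((hch t).mul (hsi t)).const_mul l).add (((hsh t).mul (hco t)).const_mul m)).congr_deriv (by
      simp only [hL₂, hLd]; ring)
  have dL₂ : ∀ t, HasDerivAt L₂ (-q * L₁ t - N * K t) t := fun t =>
    (((dL t).const_mul (l ^ 2 - m ^ 2)).add
      (((hch t).mul (hco t)).const_mul (2 * l * m))).congr_deriv (by
      simp only [hL₁, hK, hN, hq]; ring)
  have hLpos : ∀ t ∈ Icc 0 (Real.pi / m), 0 ≤ L t := fun t ht => by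
    refine mul_nonneg (Real.sinh_nonneg_iff.2 (mul_nonneg hl.le ht.1))
      (Real.sin_nonneg_of_nonneg_of_le_pi (mul_nonneg hm.le ht.1) ?_)
    have := (le_div_iff₀ hm).1 ht.2
    linarith
  have hKpos : ∀ t ∈ Icc 0 (Real.pi / m), 0 ≤ K t := fun t ht => by
    have hmono : MonotoneOn K (Icc 0 (Real.pi / m)) := by
      refine monotoneOn_of_deriv_nonneg (convex_Icc _ _)
        (fun x _ => (dK x).continuousAt.continuousWithinAt)
        (fun x _ => (dK x).differentiableAt.differentiableWithinAt) fun x hx => ?_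
      rw [(dK x).deriv]
      exact mul_nonneg hNp.le (hLpos x (interior_subset hx))
    have := hmono ⟨le_rfl, ht.1.trans ht.2⟩ ht ht.1
    simpa [hK] using this
  have hT0 := hL.pos
  have key : ∀ t ∈ Ioc 0 (min T (Real.pi / m)), u₀ t ≤ δ → 2 * l * m * u₀ t ≤ L t * ε := by
    intro t ht htδ
    have htT : t ≤ T := ht.2.trans (min_le_left _ _)
    have htm : t ≤ Real.pi / m := ht.2.trans (min_le_right _ _)
    -- Variation of constants. The linear part cancels in Θ', leaving −K(t − s)(f(u) − N²u) ≤ 0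
    -- while u stays in [0, δ]. Comparing Θ at t and at 0 bounds u(t) by the linear solution.
    set Θ : ℝ → ℝ := fun s => K (t - s) * u₃ s + N * L (t - s) * u₂ s +
      (N * L₁ (t - s) + q * K (t - s)) * u₁ s + (N * L₂ (t - s) + q * (N * L (t - s))) * u₀ s
      with hΘ
    have hr : ∀ s : ℝ, HasDerivAt (fun s => t - s) (-1) s := fun s => by
      simpa using (hasDerivAt_id' s).const_sub t
    have hsub : Icc 0 t ⊆ Icc 0 T := Icc_subset_Icc_right htT
    have hdΘ : ∀ s ∈ Ioo 0 t,
        HasDerivAt Θ (-(K (t - s) * (f (u₀ s) - N ^ 2 * u₀ s))) s := by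
      intro s hs
      have hsT : s ∈ Ioo 0 T := ⟨hs.1, hs.2.trans_le htT⟩
      have k0 := (dK (t - s)).comp s (hr s)
      have k1 := (dL (t - s)).comp s (hr s)
      have k2 := (dL₁ (t - s)).comp s (hr s)
      have k3 := (dL₂ (t - s)).comp s (hr s)
      refine ((((k0.mul (hL.deriv₃ s hsT)).add ((k1.const_mul N).mul (hL.deriv₂ s hsT))).add
        (((k2.const_mul N).add (k0.const_mul q)).mul (hL.deriv₁ s hsT))).add
        (((k3.const_mul N).add ((k1.const_mul N).const_mul q)).mul
          (hL.deriv₀ s hsT))).congr_deriv ?_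
      simp only [Function.comp, Pi.add_apply]
      ring
    have hΘc : ContinuousOn Θ (Icc 0 t) := by
      have cK : Continuous K := continuous_iff_continuousAt.2 fun x => (dK x).continuousAt
      have cL : Continuous L := continuous_iff_continuousAt.2 fun x => (dL x).continuousAt
      have cL₁ : Continuous L₁ := continuous_iff_continuousAt.2 fun x => (dL₁ x).continuousAt
      have cL₂ : Continuous L₂ := continuous_iff_continuousAt.2 fun x => (dL₂ x).continuousAt
      have c0 := hL.cont₀.mono hsub
      have c1 := hL.cont₁.mono hsub
      have c2 := hL.cont₂.mono hsub
      have c3 := hL.cont₃.mono hsub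
      simp only [hΘ]
      fun_prop
    have hanti : AntitoneOn Θ (Icc 0 t) := by
      refine antitoneOn_of_deriv_nonpos (convex_Icc _ _) hΘc
        (fun s hs => ?_) fun s hs => ?_
      · rw [interior_Icc] at hs
        exact (hdΘ s hs).differentiableAt.differentiableWithinAt
      · rw [interior_Icc] at hs
        rw [(hdΘ s hs).deriv, neg_nonpos]
        have hsT : s ∈ Icc 0 T := ⟨hs.1.le, hs.2.le.trans htT⟩
        have m1 := hL.strictMonoOn.monotoneOn ⟨le_rfl, hT0.le⟩ hsT hs.1.le
        have m2 := hL.strictMonoOn.monotoneOn hsT ⟨ht.1.le, htT⟩ hs.2.le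
        rw [h0] at m1
        have := hf (u₀ s) ⟨m1, m2.trans htδ⟩
        exact mul_nonneg (hKpos _ ⟨by linarith [hs.2], by linarith [hs.1]⟩) (by linarith)
    have := hanti ⟨le_rfl, ht.1.le⟩ ⟨ht.1.le, le_rfl⟩ ht.1.le
    have hΘt : Θ t = N * (2 * l * m * u₀ t) := by
      simp only [hΘ, hK, hLd, hL₁, hL₂, sub_self, mul_zero, Real.sinh_zero, Real.cosh_zero,
        Real.sin_zero, Real.cos_zero]
      ring
    have hΘ0 : Θ 0 = K t * u₃ 0 + N * (L t * u₂ 0) := by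
      simp only [hΘ, sub_zero, h0, hL.left₁]
      ring
    rw [hΘt, hΘ0] at this
    have e1 : K t * u₃ 0 ≤ 0 := mul_nonpos_of_nonneg_of_nonpos (hKpos t ⟨ht.1.le, htm⟩) h3
    have e2 : L t * u₂ 0 ≤ L t * ε := mul_le_mul_of_nonneg_left h2 (hLpos t ⟨ht.1.le, htm⟩)
    have e3 : N * (2 * l * m * u₀ t) ≤ N * (L t * ε) := by
      have := mul_le_mul_of_nonneg_left e2 hNp.le
      linarith
    exact le_of_mul_le_mul_left e3 hNp
  have contra : ∀ t ∈ Ioc 0 (min T (Real.pi / m)), u₀ t = δ → False := by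
    intro t ht htδ
    have h4 := key t ht htδ.le
    rw [htδ] at h4
    have h5 : L t ≤ Real.sinh (l * (Real.pi / m)) := by
      have h6 : Real.sinh (l * t) ≤ Real.sinh (l * (Real.pi / m)) :=
        Real.sinh_le_sinh.2 (mul_le_mul_of_nonneg_left (ht.2.trans (min_le_right _ _)) hl.le)
      have h7 : 0 ≤ Real.sinh (l * t) := Real.sinh_nonneg_iff.2 (mul_nonneg hl.le ht.1.le)
      have := Real.sin_le_one (m * t)
      calc L t ≤ Real.sinh (l * t) * 1 := mul_le_mul_of_nonneg_left this h7
        _ ≤ _ := by rw [mul_one]; exact h6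
    have := mul_le_mul_of_nonneg_right h5 hε0
    linarith
  have hpm : 0 < Real.pi / m := div_pos Real.pi_pos hm
  set t₁ := min T (Real.pi / m) with ht₁
  have ht₁p : 0 < t₁ := lt_min hT0 hpm
  have ht₁T : t₁ ≤ T := min_le_left _ _
  -- Either the height δ is reached by time π/m, where the bound with sinh(lπ/m) forbids it, or time
  -- π/m is attained below δ. There L vanishes and forces u ≤ 0, against monotonicity.
  rcases le_or_gt δ (u₀ t₁) with hcase | hcase
  · obtain ⟨t, ht, hut⟩ := intermediate_value_Icc ht₁p.le (hL.cont₀.mono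
      (Icc_subset_Icc_right ht₁T)) (show δ ∈ Icc (u₀ 0) (u₀ t₁) from ⟨by rw [h0]; exact hδ.le, hcase⟩)
    refine contra t ⟨lt_of_le_of_ne ht.1 ?_, ht.2⟩ hut
    rintro rfl
    rw [h0] at hut
    exact hδ.ne hut
  · have hTm : t₁ = Real.pi / m := by
      rcases min_choice T (Real.pi / m) with h | h
      · rw [ht₁, h] at hcase; linarith
      · exact h
    have h4 := key t₁ ⟨ht₁p, le_rfl⟩ hcase.le
    have h5 : L t₁ = 0 := by
      simp only [hLd]
      rw [hTm, mul_div_cancel₀ _ hm.ne', Real.sin_pi, mul_zero]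
    have h6 := hL.strictMonoOn ⟨le_rfl, hT0.le⟩ ⟨ht₁p.le, ht₁T⟩ ht₁p
    rw [h0] at h6
    rw [h5, zero_mul] at h4
    have : 0 < 2 * l * m * u₀ t₁ := by positivity
    linarith

end

/-! ### Dependence of the least action on the end points. -/

/-- A nonnegative potential with locally Lipschitz derivative `F'`. -/
structure IsPotential (F F' : ℝ → ℝ) : Prop where
  hasDerivAt : ∀ t, HasDerivAt F (F' t) t
  nonneg : ∀ t, 0 ≤ F t
  lipschitz : ∀ R : ℝ, ∃ L, 0 ≤ L ∧ ∀ x ∈ Icc (-R) R, ∀ y ∈ Icc (-R) R,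
    |F' x - F' y| ≤ L * |x - y|
  cont' : Continuous F'

section
variable {F F' : ℝ → ℝ}

lemma IsPotential.cont (hF : IsPotential F F') : Continuous F :=
  continuous_iff_continuousAt.2 fun t => (hF.hasDerivAt t).continuousAt

lemma IsPotential.of_contDiff (hF : ContDiff ℝ 2 F) (h0 : ∀ t, 0 ≤ F t) :
    IsPotential F (deriv F) := by
  have h1 : ContDiff ℝ (1 + 1) F := by convert hF using 1; norm_num
  obtain ⟨hd, -, h2⟩ := contDiff_succ_iff_deriv.1 h1
  obtain ⟨hd2, h3⟩ := contDiff_one_iff_deriv.1 h2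
  refine ⟨fun t => (hd t).hasDerivAt, h0, fun R => ?_, h2.continuous⟩
  obtain ⟨C, hC⟩ := isCompact_Icc.exists_bound_of_continuousOn (s := Icc (-R) R) h3.continuousOn
  refine ⟨max C 0, le_max_right _ _, fun x hx y hy => ?_⟩
  have := (convex_Icc (-R) R).norm_image_sub_le_of_norm_deriv_le
    (fun z _ => hd2 z) (fun z hz => (hC z hz).trans (le_max_left C 0)) hy hx
  simpa [Real.norm_eq_abs] using this

lemma IsPotential.taylor (hF : IsPotential F F') (R : ℝ) :
    ∃ C, 0 ≤ C ∧ (∀ x ∈ Icc (-R) R, |F' x| ≤ C) ∧ (∀ x ∈ Icc (-R) R, |F x| ≤ C) ∧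
      ∀ x ∈ Icc (-R) R, ∀ y ∈ Icc (-R) R, |F y - F x - F' x * (y - x)| ≤ C * (y - x) ^ 2 := by
  obtain ⟨L, hL0, hL⟩ := hF.lipschitz R
  obtain ⟨C₁, hC₁⟩ := isCompact_Icc.exists_bound_of_continuousOn (s := Icc (-R) R)
    hF.cont'.continuousOn
  obtain ⟨C₂, hC₂⟩ := isCompact_Icc.exists_bound_of_continuousOn (s := Icc (-R) R)
    hF.cont.continuousOn
  have hm1 : L ≤ max L (max C₁ C₂) := le_max_left _ _
  refine ⟨max L (max C₁ C₂), hL0.trans hm1, fun x hx => (hC₁ x hx).trans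
    ((le_max_left _ _).trans (le_max_right _ _)), fun x hx => (hC₂ x hx).trans
    ((le_max_right _ _).trans (le_max_right _ _)), fun x hx y hy => ?_⟩
  have hsub : uIcc x y ⊆ Icc (-R) R := ordConnected_Icc.uIcc_subset hx hy
  have := (convex_uIcc x y).norm_image_sub_le_of_norm_hasDerivWithin_le
    (f := fun t => F t - F' x * t) (f' := fun t => F' t - F' x * 1) (C := L * |y - x|)
    (fun z _ => ((hF.hasDerivAt z).sub ((hasDerivAt_id' z).const_mul (F' x))).hasDerivWithinAt)
    (fun z hz => by
      rw [mul_one, Real.norm_eq_abs]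
      refine (hL z (hsub hz) x hx).trans ?_
      exact mul_le_mul_of_nonneg_left (abs_sub_left_of_mem_uIcc hz) hL0)
    left_mem_uIcc right_mem_uIcc
  rw [Real.norm_eq_abs, Real.norm_eq_abs, mul_assoc, ← sq, sq_abs] at this
  calc |F y - F x - F' x * (y - x)| = |F y - F' x * y - (F x - F' x * x)| := by congr 1; ring
    _ ≤ L * (y - x) ^ 2 := this
    _ ≤ _ := by gcongr

lemma mem_Icc_of_box {r a h s : ℝ} (ha : |a| ≤ r) (h0 : 0 ≤ h) (hr : h ≤ r)
    (hs : s ∈ Icc (0 : ℝ) 1) : a + h * s ∈ Icc (-(2 * r)) (2 * r) := by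
  have h1 := abs_le.1 ha
  have h2 : h * s ≤ h * 1 := mul_le_mul_of_nonneg_left hs.2 h0
  have h3 : 0 ≤ h * s := mul_nonneg h0 hs.1
  constructor <;> linarith [h1.1, h1.2]

/-- First order expansion of the action with respect to the end points of the lap. -/
lemma IsPotential.lapEnergy_taylor (hF : IsPotential F F') (q e : ℝ) {r : ℝ} (hr : 0 < r) :
    ∃ C, 0 ≤ C ∧ ∀ a h a' h' : ℝ, |a| ≤ r → r⁻¹ ≤ h → h ≤ r → |a'| ≤ r → r⁻¹ ≤ h' → h' ≤ r →
      ∀ η > 0, ∀ g, Above η g →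
      |lapEnergy F q e a' h' g - lapEnergy F q e a h g - partA F' a h g * (a' - a) -
        partH F F' q e a h g * (h' - h)| ≤ C * (|a' - a| + |h' - h|) ^ 2 *
          (‖g‖ ^ 2 + ∫ s in (0 : ℝ)..1, (prim g s) ^ (-(2 / 3) : ℝ)) := by
  obtain ⟨C, hC0, hC1, -, hC2⟩ := hF.taylor (2 * r)
  refine ⟨2 / 9 * r ^ 3 + (r * C + C), by positivity, ?_⟩
  intro a h a' h' ha hrh hhr ha' hrh' hhr' η hη g hg
  have hri : 0 < r⁻¹ := inv_pos.2 hr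
  have hh : 0 < h := hri.trans_le hrh
  have hh' : 0 < h' := hri.trans_le hrh'
  set d := |a' - a| + |h' - h| with hd
  have hd0 : 0 ≤ d := by positivity
  have hFc := hF.cont
  have hFc' := hF.cont'
  have i1 := hg.intervalIntegrable hη (k := fun s => F (a' + h' * s) + e) (by fun_prop)
  have i2 := hg.intervalIntegrable hη (k := fun s => F (a + h * s) + e) (by fun_prop)
  have i3 := hg.intervalIntegrable hη (k := fun s => F' (a + h * s)) (by fun_prop)
  have i4 := hg.intervalIntegrable hη (k := fun s => F' (a + h * s) * s) (by fun_prop)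
  have i5 : IntervalIntegrable (fun s => (prim g s) ^ (-(2 / 3) : ℝ)) volume 0 1 := by
    simpa using hg.intervalIntegrable hη (k := fun _ => 1) continuousOn_const
  set Rm : ℝ → ℝ := fun s => h' * (F (a' + h' * s) + e) - h * (F (a + h * s) + e) -
    h * F' (a + h * s) * (a' - a) - ((F (a + h * s) + e) + h * (F' (a + h * s) * s)) * (h' - h)
    with hRm
  have e1 : lapEnergy F q e a' h' g - lapEnergy F q e a h g - partA F' a h g * (a' - a) -
        partH F F' q e a h g * (h' - h) = 2 / 9 * (1 / h' - 1 / h + (h' - h) / h ^ 2) * ‖g‖ ^ 2 +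
        ∫ s in (0 : ℝ)..1, Rm s * (prim g s) ^ (-(2 / 3) : ℝ) := by
    have : ∫ s in (0 : ℝ)..1, Rm s * (prim g s) ^ (-(2 / 3) : ℝ) =
        h' * (∫ s in (0 : ℝ)..1, (F (a' + h' * s) + e) * (prim g s) ^ (-(2 / 3) : ℝ)) -
        h * (∫ s in (0 : ℝ)..1, (F (a + h * s) + e) * (prim g s) ^ (-(2 / 3) : ℝ)) -
        (h * (a' - a)) * (∫ s in (0 : ℝ)..1, F' (a + h * s) * (prim g s) ^ (-(2 / 3) : ℝ)) -
        (h' - h) * (∫ s in (0 : ℝ)..1, (F (a + h * s) + e) * (prim g s) ^ (-(2 / 3) : ℝ)) -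
        (h * (h' - h)) * ∫ s in (0 : ℝ)..1,
          (F' (a + h * s) * s) * (prim g s) ^ (-(2 / 3) : ℝ) := by
      rw [← intervalIntegral.integral_const_mul, ← intervalIntegral.integral_const_mul,
        ← intervalIntegral.integral_const_mul, ← intervalIntegral.integral_const_mul,
        ← intervalIntegral.integral_const_mul,
        ← intervalIntegral.integral_sub (i1.const_mul _) (i2.const_mul _),
        ← intervalIntegral.integral_sub ((i1.const_mul _).sub (i2.const_mul _)) (i3.const_mul _),
        ← intervalIntegral.integral_sub (((i1.const_mul _).sub (i2.const_mul _)).sub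
          (i3.const_mul _)) (i2.const_mul _),
        ← intervalIntegral.integral_sub ((((i1.const_mul _).sub (i2.const_mul _)).sub
          (i3.const_mul _)).sub (i2.const_mul _)) (i4.const_mul _)]
      congr 1
      funext s
      simp only [hRm]
      ring
    rw [this, lapEnergy_eq, lapEnergy_eq]
    unfold partA partH
    field_simp
    ring
  have e2 : |1 / h' - 1 / h + (h' - h) / h ^ 2| ≤ r ^ 3 * d ^ 2 := by
    have : 1 / h' - 1 / h + (h' - h) / h ^ 2 = h'⁻¹ * (h⁻¹) ^ 2 * (h' - h) ^ 2 := by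
      field_simp
      ring
    have b1 : h'⁻¹ ≤ r := inv_le_of_inv_le₀ hr hrh'
    have b2 : h⁻¹ ≤ r := inv_le_of_inv_le₀ hr hrh
    have b3 : (h' - h) ^ 2 ≤ d ^ 2 := by
      rw [← sq_abs (h' - h)]
      gcongr
      simp [hd]
    rw [this, abs_of_nonneg (by positivity)]
    calc h'⁻¹ * h⁻¹ ^ 2 * (h' - h) ^ 2 ≤ r * r ^ 2 * d ^ 2 := by gcongr
      _ = _ := by ring
  have e3 : ∀ s ∈ Icc (0 : ℝ) 1, |Rm s| ≤ (r * C + C) * d ^ 2 := by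
    intro s hs
    set u := a + h * s with hu
    set u' := a' + h' * s with hu'
    have hum : u ∈ Icc (-(2 * r)) (2 * r) := mem_Icc_of_box ha hh.le hhr hs
    have hum' : u' ∈ Icc (-(2 * r)) (2 * r) := mem_Icc_of_box ha' hh'.le hhr' hs
    have huu : |u' - u| ≤ d := by
      have : u' - u = (a' - a) + (h' - h) * s := by simp only [hu, hu']; ring
      rw [this]
      refine (abs_add_le _ _).trans ?_
      rw [abs_mul, abs_of_nonneg hs.1, hd]
      have := mul_le_mul_of_nonneg_left hs.2 (abs_nonneg (h' - h))
      linarith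
    have hRe : Rm s = h' * (F u' - F u - F' u * (u' - u)) + (h' - h) * (F' u * (u' - u)) := by
      simp only [hRm, hu, hu']
      ring
    have t1 : |F u' - F u - F' u * (u' - u)| ≤ C * d ^ 2 := by
      refine (hC2 u hum u' hum').trans ?_
      rw [← sq_abs (u' - u)]
      gcongr
    have t2 : |h' - h| ≤ d := by simp [hd]
    rw [hRe]
    refine (abs_add_le _ _).trans ?_
    rw [abs_mul, abs_mul, abs_mul, abs_of_pos hh']
    have t3 := hC1 u hum
    calc h' * |F u' - F u - F' u * (u' - u)| + |h' - h| * (|F' u| * |u' - u|)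
        ≤ r * (C * d ^ 2) + d * (C * d) := by gcongr
      _ = _ := by ring
  have hpow : ∀ s ∈ Icc (0 : ℝ) 1, 0 ≤ (prim g s) ^ (-(2 / 3) : ℝ) := fun s hs =>
    Real.rpow_nonneg (hg.nonneg hη hs) _
  have e4 : |∫ s in (0 : ℝ)..1, Rm s * (prim g s) ^ (-(2 / 3) : ℝ)| ≤
      (r * C + C) * d ^ 2 * ∫ s in (0 : ℝ)..1, (prim g s) ^ (-(2 / 3) : ℝ) := by
    rw [← intervalIntegral.integral_const_mul, ← Real.norm_eq_abs]
    refine intervalIntegral.norm_integral_le_of_norm_le zero_le_one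
      (ae_of_all _ fun s hs => ?_) (i5.const_mul _)
    have hs' := Ioc_subset_Icc_self hs
    rw [Real.norm_eq_abs, abs_mul, abs_of_nonneg (hpow s hs')]
    exact mul_le_mul_of_nonneg_right (e3 s hs') (hpow s hs')
  have hW : 0 ≤ ∫ s in (0 : ℝ)..1, (prim g s) ^ (-(2 / 3) : ℝ) :=
    intervalIntegral.integral_nonneg zero_le_one hpow
  set W := ∫ s in (0 : ℝ)..1, (prim g s) ^ (-(2 / 3) : ℝ)
  rw [e1]
  refine (abs_add_le _ _).trans ?_
  rw [abs_mul, abs_mul, abs_of_nonneg (by norm_num : (0 : ℝ) ≤ 2 / 9), abs_of_nonneg (sq_nonneg ‖g‖)]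
  have p1 : 2 / 9 * |1 / h' - 1 / h + (h' - h) / h ^ 2| * ‖g‖ ^ 2 ≤
      2 / 9 * (r ^ 3 * d ^ 2) * ‖g‖ ^ 2 := by gcongr
  have p2 : 0 ≤ 2 / 9 * (r ^ 3 * d ^ 2) * W := by positivity
  have p3 : 0 ≤ (r * C + C) * d ^ 2 * ‖g‖ ^ 2 := by positivity
  linarith

/-- The minimiser of the action among laps from `a` to `a + h`. -/
noncomputable def lapMin (F : ℝ → ℝ) (q e a h : ℝ) : L2I :=
  Classical.epsilon fun g => Above (min 1 (9 * h ^ 2 * e / 16)) g ∧ IsLapMin F q e a h g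

/-- The least action of laps from `a` to `a + h`. -/
noncomputable def lapAction (F : ℝ → ℝ) (q e a h : ℝ) : ℝ :=
  lapEnergy F q e a h (lapMin F q e a h)

variable {q e a h : ℝ}

lemma IsPotential.lapMin_spec (hF : IsPotential F F') (hq : 0 ≤ q) (he : 0 < e) (hh : 0 < h) :
    Above (min 1 (9 * h ^ 2 * e / 16)) (lapMin F q e a h) ∧
      IsLapMin F q e a h (lapMin F q e a h) :=
  Classical.epsilon_spec (exists_isLapMin hF.cont hF.nonneg hq he hh)

lemma lapBarrier_pos (he : 0 < e) (hh : 0 < h) : 0 < min 1 (9 * h ^ 2 * e / 16) := by positivity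

lemma IsPotential.lapAction_le (hF : IsPotential F F') (hq : 0 ≤ q) (he : 0 < e) (hh : 0 < h)
    {η : ℝ} (hη : 0 < η) {g : L2I} (hg : Above η g) :
    lapAction F q e a h + 1 / (9 * h) * ‖g - lapMin F q e a h‖ ^ 2 ≤ lapEnergy F q e a h g := by
  have := (hF.lapMin_spec (a := a) hq he hh).2 η hη g hg
  unfold lapAction lapEnergy
  convert this using 3
  field_simp

lemma Above.integral_rpow_neg_le {η : ℝ} {g : L2I} (hg : Above η g) (hη : 0 < η) :
    ∫ s in (0 : ℝ)..1, (prim g s) ^ (-(2 / 3) : ℝ) ≤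
      ∫ s in (0 : ℝ)..1, (η * (s * (1 - s))) ^ (-(2 / 3) : ℝ) := by
  have i5 : IntervalIntegrable (fun s => (prim g s) ^ (-(2 / 3) : ℝ)) volume 0 1 := by
    simpa using hg.intervalIntegrable hη (k := fun _ => 1) continuousOn_const
  refine intervalIntegral.integral_mono_on_of_le_Ioo zero_le_one i5 (intervalIntegrable_barrier η hη)
    fun s hs => hg.rpow_neg_le hη ⟨hs.1, hs.2.le⟩

lemma le_of_quadratic_le {x α β γ : ℝ} (hα : 0 < α) (hβ : 0 ≤ β) (hγ : 0 ≤ γ)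
    (h : α * x ^ 2 ≤ β * x + γ) : x ≤ 1 + (β + γ) / α := by
  by_contra! hx
  have h1 : (β + γ) / α * α = β + γ := div_mul_cancel₀ _ hα.ne'
  have h0 : 0 ≤ (β + γ) / α := by positivity
  have h2 : β + γ < α * x := by nlinarith
  have : (β + γ) * x < α * x * x := mul_lt_mul_of_pos_right h2 (by linarith)
  nlinarith

/-- Bounds for minimisers, uniform for end points in a compact set. -/
lemma IsPotential.lapMin_bound (hF : IsPotential F F') (hq : 0 ≤ q) (he : 0 < e) {r : ℝ}
    (hr : 0 < r) : ∃ M, 0 ≤ M ∧ ∀ a h : ℝ, |a| ≤ r → r⁻¹ ≤ h → h ≤ r →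
      ‖lapMin F q e a h‖ ^ 2 + (∫ s in (0 : ℝ)..1, (prim (lapMin F q e a h) s) ^ (-(2 / 3) : ℝ)) ≤ M
      ∧ |partA F' a h (lapMin F q e a h)| ≤ M ∧ |partH F F' q e a h (lapMin F q e a h)| ≤ M := by
  obtain ⟨C, hC0, hC1, hC2, -⟩ := hF.taylor (2 * r)
  obtain ⟨g₀, hg₀⟩ := exists_above
  have hri : 0 < r⁻¹ := inv_pos.2 hr
  -- The barrier belonging to the smallest admissible height r⁻¹ serves for all heights in the box.
  -- A fixed trial profile bounds the action from above by E₀.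
  set η := min 1 (9 * r⁻¹ ^ 2 * e / 16) with hη
  have hη0 : 0 < η := lapBarrier_pos he hri
  set I := ∫ s in (0 : ℝ)..1, (η * (s * (1 - s))) ^ (-(2 / 3) : ℝ) with hI
  have hI0 : 0 ≤ I := intervalIntegral.integral_nonneg zero_le_one fun s hs =>
    Real.rpow_nonneg (mul_nonneg hη0.le (mul_nonneg hs.1 (by linarith [hs.2]))) _
  set W₀ := ∫ s in (0 : ℝ)..1, (prim g₀ s) ^ (-(2 / 3) : ℝ) with hW₀
  have hW₀0 : 0 ≤ W₀ := intervalIntegral.integral_nonneg zero_le_one fun s hs =>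
    Real.rpow_nonneg (hg₀.nonneg one_pos hs) _
  set E₀ := 2 / 9 * r * ‖g₀‖ ^ 2 + r * ((C + e) * W₀) with hE₀
  have hE₀0 : 0 ≤ E₀ := by positivity
  set N := 1 + (q / 2 * r + (q / 2 * r + E₀)) / (2 / (9 * r)) with hN
  have hN0 : 0 ≤ N := by positivity
  set M₁ := N ^ 2 + I with hM₁
  set M₂ := r * (C * I) with hM₂
  set M₃ := 2 / 9 * r ^ 2 * N ^ 2 + q / 2 * (1 + N) + (C + e) * I + r * (C * I) with hM₃
  have hM₁0 : 0 ≤ M₁ := by positivity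
  have hM₂0 : 0 ≤ M₂ := by positivity
  have hM₃0 : 0 ≤ M₃ := by positivity
  refine ⟨M₁ + M₂ + M₃, by positivity, ?_⟩
  intro a h ha hrh hhr
  have hh : 0 < h := hri.trans_le hrh
  obtain ⟨hgA, hgm⟩ := hF.lapMin_spec (a := a) hq he hh
  have hFc := hF.cont
  have hFc' := hF.cont'
  have hint : ∀ (k : ℝ → ℝ) (D : ℝ) (η : ℝ) (g : L2I), 0 < η → Above η g →
      ContinuousOn k (Icc 0 1) → (∀ s ∈ Icc (0 : ℝ) 1, |k s| ≤ D) →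
      |∫ s in (0 : ℝ)..1, k s * (prim g s) ^ (-(2 / 3) : ℝ)| ≤
        D * ∫ s in (0 : ℝ)..1, (prim g s) ^ (-(2 / 3) : ℝ) := by
    intro k D η g hη hg hk hkD
    have i5 : IntervalIntegrable (fun s => (prim g s) ^ (-(2 / 3) : ℝ)) volume 0 1 := by
      simpa using hg.intervalIntegrable hη (k := fun _ => 1) continuousOn_const
    rw [← intervalIntegral.integral_const_mul, ← Real.norm_eq_abs]
    refine intervalIntegral.norm_integral_le_of_norm_le zero_le_one
      (ae_of_all _ fun s hs => ?_) (i5.const_mul _)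
    have hs' := Ioc_subset_Icc_self hs
    have hp : 0 ≤ (prim g s) ^ (-(2 / 3) : ℝ) := Real.rpow_nonneg (hg.nonneg hη hs') _
    rw [Real.norm_eq_abs, abs_mul, abs_of_nonneg hp]
    exact mul_le_mul_of_nonneg_right (hkD s hs') hp
  have hmem : ∀ s ∈ Icc (0 : ℝ) 1, a + h * s ∈ Icc (-(2 * r)) (2 * r) := fun s hs =>
    mem_Icc_of_box ha hh.le hhr hs
  have hGb : ∀ s ∈ Icc (0 : ℝ) 1, |F (a + h * s) + e| ≤ C + e := fun s hs => by
    refine (abs_add_le _ _).trans ?_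
    rw [abs_of_pos he]
    linarith [hC2 _ (hmem s hs)]
  have hAb : ∀ s ∈ Icc (0 : ℝ) 1, |F' (a + h * s)| ≤ C := fun s hs => hC1 _ (hmem s hs)
  have hHb : ∀ s ∈ Icc (0 : ℝ) 1, |F' (a + h * s) * s| ≤ C := fun s hs => by
    rw [abs_mul, abs_of_nonneg hs.1]
    nlinarith [hC1 _ (hmem s hs), hs.1, hs.2, abs_nonneg (F' (a + h * s))]
  have hηle : η ≤ min 1 (9 * h ^ 2 * e / 16) := by
    simp only [hη]
    gcongr
  have hgη := hgA.mono hηle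
  set g := lapMin F q e a h with hg
  have hWI := hgη.integral_rpow_neg_le hη0
  have hW0 : 0 ≤ ∫ s in (0 : ℝ)..1, (prim g s) ^ (-(2 / 3) : ℝ) :=
    intervalIntegral.integral_nonneg zero_le_one fun s hs =>
      Real.rpow_nonneg (hgη.nonneg hη0 hs) _
  have hhi : h⁻¹ ≤ r := inv_le_of_inv_le₀ hr hrh
  have hup : lapEnergy F q e a h g ≤ E₀ := by
    have h1 := hF.lapAction_le (a := a) hq he hh one_pos hg₀
    have h2 : 0 ≤ 1 / (9 * h) * ‖g₀ - lapMin F q e a h‖ ^ 2 := by positivity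
    have h3 : lapEnergy F q e a h g₀ ≤ E₀ := by
      rw [lapEnergy_eq]
      have h4 := (abs_le.1 (hint _ _ 1 g₀ one_pos hg₀
        (by fun_prop : ContinuousOn (fun s => F (a + h * s) + e) (Icc 0 1)) hGb)).2
      have h5 : 0 ≤ ∫ s in (0 : ℝ)..1, (prim g₀ s) ^ (2 / 3 : ℝ) :=
        intervalIntegral.integral_nonneg zero_le_one fun s hs =>
          Real.rpow_nonneg (hg₀.nonneg one_pos hs) _
      have h6 : 2 / (9 * h) * ‖g₀‖ ^ 2 ≤ 2 / 9 * r * ‖g₀‖ ^ 2 := by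
        have : 2 / (9 * h) = 2 / 9 * h⁻¹ := by field_simp
        rw [this]; gcongr
      have h7 : 0 ≤ q / 2 * h * ∫ s in (0 : ℝ)..1, (prim g₀ s) ^ (2 / 3 : ℝ) := by positivity
      have h8 : h * (∫ s in (0 : ℝ)..1, (F (a + h * s) + e) * (prim g₀ s) ^ (-(2 / 3) : ℝ)) ≤
          r * ((C + e) * W₀) :=
        (mul_le_mul_of_nonneg_left h4 hh.le).trans
          (mul_le_mul_of_nonneg_right hhr (by positivity))
      linarith
    unfold lapAction at h1
    linarith
  have hlow := le_energy (α := 2 / (9 * h)) (β := q / 2 * h)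
    (w := fun s => h * (F (a + h * s) + e)) (by positivity)
    (fun s _ => mul_nonneg hh.le (by linarith [hF.nonneg (a + h * s)])) hη0 hgη
  have hnorm : ‖g‖ ≤ N := by
    refine le_of_quadratic_le (by positivity) (by positivity) (by positivity) ?_
    have h1 : 2 / (9 * r) * ‖g‖ ^ 2 ≤ 2 / (9 * h) * ‖g‖ ^ 2 := by gcongr
    have h2 : q / 2 * h * (1 + ‖g‖) ≤ q / 2 * r * (1 + ‖g‖) := by gcongr
    have h3 : energy (2 / (9 * h)) (q / 2 * h) (fun s => h * (F (a + h * s) + e)) g ≤ E₀ := hup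
    linarith
  have hnorm2 : ‖g‖ ^ 2 ≤ N ^ 2 := by gcongr
  refine ⟨by linarith, ?_, ?_⟩
  · have h1 := hint _ _ η g hη0 hgη
      (by fun_prop : ContinuousOn (fun s => F' (a + h * s)) (Icc 0 1)) hAb
    unfold partA
    rw [abs_mul, abs_of_pos hh]
    have : h * |∫ s in (0 : ℝ)..1, F' (a + h * s) * (prim g s) ^ (-(2 / 3) : ℝ)| ≤ M₂ := by
      simp only [hM₂]
      gcongr
      exact h1.trans (by gcongr)
    linarith
  · have h1 := hint _ _ η g hη0 hgη
      (by fun_prop : ContinuousOn (fun s => F' (a + h * s) * s) (Icc 0 1)) hHb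
    have h2 := hint _ _ η g hη0 hgη
      (by fun_prop : ContinuousOn (fun s => F (a + h * s) + e) (Icc 0 1)) hGb
    have hB := integral_prim_rpow_le g hgη hη0
    have hB0 : 0 ≤ ∫ s in (0 : ℝ)..1, (prim g s) ^ (2 / 3 : ℝ) :=
      intervalIntegral.integral_nonneg zero_le_one fun s hs =>
        Real.rpow_nonneg (hgη.nonneg hη0 hs) _
    have b1 : |-(2 / (9 * h ^ 2)) * ‖g‖ ^ 2| ≤ 2 / 9 * r ^ 2 * N ^ 2 := by
      rw [neg_mul, abs_neg, abs_of_nonneg (by positivity)]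
      have : 2 / (9 * h ^ 2) = 2 / 9 * h⁻¹ ^ 2 := by field_simp
      rw [this]
      gcongr
    have b2 : |q / 2 * ∫ s in (0 : ℝ)..1, (prim g s) ^ (2 / 3 : ℝ)| ≤ q / 2 * (1 + N) := by
      rw [abs_of_nonneg (by positivity)]
      gcongr
      linarith
    have b3 : |∫ s in (0 : ℝ)..1, (F (a + h * s) + e) * (prim g s) ^ (-(2 / 3) : ℝ)| ≤
        (C + e) * I := h2.trans (by gcongr)
    have b4 : |h * ∫ s in (0 : ℝ)..1, F' (a + h * s) * s * (prim g s) ^ (-(2 / 3) : ℝ)| ≤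
        r * (C * I) := by
      rw [abs_mul, abs_of_pos hh]
      gcongr
      exact h1.trans (by gcongr)
    have hfin : |partH F F' q e a h g| ≤ M₃ := by
      unfold partH
      simp only [hM₃]
      refine (abs_add_le _ _).trans (add_le_add ?_ b4)
      refine (abs_add_le _ _).trans (add_le_add ?_ b3)
      exact (abs_sub _ _).trans (add_le_add b1 b2)
    linarith

end

section
variable {F F' : ℝ → ℝ} {q e a h : ℝ}

/-- The action is semiconcave, Lipschitz, and its minimisers are Hölder continuous,
uniformly for end points in a compact set. -/
lemma IsPotential.lapAction_estimates (hF : IsPotential F F') (hq : 0 ≤ q) (he : 0 < e) {r : ℝ}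
    (hr : 0 < r) : ∃ C, 0 ≤ C ∧ ∀ a h a' h' : ℝ, |a| ≤ r → r⁻¹ ≤ h → h ≤ r → |a'| ≤ r → r⁻¹ ≤ h' →
      h' ≤ r →
      lapAction F q e a' h' ≤ lapAction F q e a h +
        (partA F' a h (lapMin F q e a h) * (a' - a) +
          partH F F' q e a h (lapMin F q e a h) * (h' - h)) + C * (|a' - a| + |h' - h|) ^ 2 ∧
      |lapAction F q e a' h' - lapAction F q e a h| ≤ C * (|a' - a| + |h' - h|) ∧
      ‖lapMin F q e a h - lapMin F q e a' h'‖ ^ 2 ≤ C * (|a' - a| + |h' - h|) := by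
  obtain ⟨C, hC0, hC⟩ := hF.lapEnergy_taylor q e hr
  obtain ⟨M, hM0, hM⟩ := hF.lapMin_bound hq he hr
  have hri : 0 < r⁻¹ := inv_pos.2 hr
  set L := M + C * (4 * r) * M with hL
  have hL0 : 0 ≤ L := by positivity
  -- The minimiser for one pair of end points is a competitor for the other pair. Exchanging the
  -- roles gives the Lipschitz bound, and strong convexity converts it into a bound on the distance
  -- of the minimisers.
  have key : ∀ a h a' h' : ℝ, |a| ≤ r → r⁻¹ ≤ h → h ≤ r → |a'| ≤ r → r⁻¹ ≤ h' → h' ≤ r →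
      lapEnergy F q e a' h' (lapMin F q e a h) ≤ lapAction F q e a h +
        (partA F' a h (lapMin F q e a h) * (a' - a) +
          partH F F' q e a h (lapMin F q e a h) * (h' - h)) +
            C * M * (|a' - a| + |h' - h|) ^ 2 ∧
      lapEnergy F q e a' h' (lapMin F q e a h) ≤ lapAction F q e a h +
        L * (|a' - a| + |h' - h|) := by
    intro a h a' h' ha hrh hhr ha' hrh' hhr'
    have hh : 0 < h := hri.trans_le hrh
    obtain ⟨hgA, -⟩ := hF.lapMin_spec (a := a) hq he hh
    obtain ⟨m1, m2, m3⟩ := hM a h ha hrh hhr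
    have ht := (abs_le.1 (hC a h a' h' ha hrh hhr ha' hrh' hhr' _ (lapBarrier_pos he hh) _ hgA)).2
    set g := lapMin F q e a h
    set d := |a' - a| + |h' - h| with hd
    have hd0 : 0 ≤ d := by positivity
    have h1 : C * d ^ 2 * (‖g‖ ^ 2 + ∫ s in (0 : ℝ)..1, (prim g s) ^ (-(2 / 3) : ℝ)) ≤
        C * M * d ^ 2 := by
      have := mul_le_mul_of_nonneg_left m1 (show 0 ≤ C * d ^ 2 by positivity)
      linarith
    have h2 : lapAction F q e a h = lapEnergy F q e a h g := rfl
    have h3 : lapEnergy F q e a' h' g ≤ lapAction F q e a h +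
        (partA F' a h g * (a' - a) + partH F F' q e a h g * (h' - h)) + C * M * d ^ 2 := by
      rw [h2]; linarith
    refine ⟨h3, h3.trans ?_⟩
    have hdr : d ≤ 4 * r := by
      have q1 := abs_le.1 ha
      have q2 := abs_le.1 ha'
      have q3 : |a' - a| ≤ 2 * r := abs_le.2 ⟨by linarith, by linarith⟩
      have q4 : |h' - h| ≤ 2 * r := abs_le.2 ⟨by linarith, by linarith⟩
      simp only [hd]; linarith
    have h4 : partA F' a h g * (a' - a) + partH F F' q e a h g * (h' - h) ≤ M * d := by
      have q1 : partA F' a h g * (a' - a) ≤ M * |a' - a| := (le_abs_self _).trans (by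
        rw [abs_mul]; gcongr)
      have q2 : partH F F' q e a h g * (h' - h) ≤ M * |h' - h| := (le_abs_self _).trans (by
        rw [abs_mul]; gcongr)
      simp only [hd]; linarith
    have h5 : C * M * d ^ 2 ≤ C * (4 * r) * M * d := by
      have := mul_le_mul_of_nonneg_left hdr (show 0 ≤ C * M * d by positivity)
      linarith
    simp only [hL]
    linarith
  have hnn : ∀ h (v : L2I), 0 < h → 0 ≤ 1 / (9 * h) * ‖v‖ ^ 2 := fun h v hh => by positivity
  refine ⟨C * M + L + 9 * r * (2 * L), by positivity, ?_⟩
  intro a h a' h' ha hrh hhr ha' hrh' hhr'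
  have hh : 0 < h := hri.trans_le hrh
  have hh' : 0 < h' := hri.trans_le hrh'
  obtain ⟨hgA, -⟩ := hF.lapMin_spec (a := a) hq he hh
  obtain ⟨hgA', -⟩ := hF.lapMin_spec (a := a') hq he hh'
  obtain ⟨k1, k2⟩ := key a h a' h' ha hrh hhr ha' hrh' hhr'
  obtain ⟨-, k3⟩ := key a' h' a h ha' hrh' hhr' ha hrh hhr
  have l1 := hF.lapAction_le (a := a') hq he hh' (lapBarrier_pos he hh) hgA
  have l2 := hF.lapAction_le (a := a) hq he hh (lapBarrier_pos he hh') hgA'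
  have n1 := hnn h' (lapMin F q e a h - lapMin F q e a' h') hh'
  have n2 := hnn h (lapMin F q e a' h' - lapMin F q e a h) hh
  rw [abs_sub_comm a a', abs_sub_comm h h'] at k3
  set d := |a' - a| + |h' - h| with hd
  have hd0 : 0 ≤ d := by positivity
  have w1 : C * M * d ≤ (C * M + L + 9 * r * (2 * L)) * d := by gcongr; linarith [show 0 ≤ 9 * r * (2 * L) by positivity]
  have w2 : L * d ≤ (C * M + L + 9 * r * (2 * L)) * d := by
    gcongr; linarith [show 0 ≤ 9 * r * (2 * L) by positivity, show 0 ≤ C * M by positivity]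
  have w3 : 9 * r * (2 * L) * d ≤ (C * M + L + 9 * r * (2 * L)) * d := by
    gcongr; linarith [show 0 ≤ C * M by positivity]
  have w4 : C * M * d ^ 2 ≤ (C * M + L + 9 * r * (2 * L)) * d ^ 2 := by
    gcongr; linarith [show 0 ≤ 9 * r * (2 * L) by positivity]
  refine ⟨by linarith, abs_le.2 ⟨by linarith, by linarith⟩, le_trans ?_ w3⟩
  have h6 : 1 / (9 * h') * ‖lapMin F q e a h - lapMin F q e a' h'‖ ^ 2 ≤ 2 * L * d := by
    linarith
  calc ‖lapMin F q e a h - lapMin F q e a' h'‖ ^ 2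
      = 9 * h' * (1 / (9 * h') * ‖lapMin F q e a h - lapMin F q e a' h'‖ ^ 2) := by
        field_simp
    _ ≤ 9 * r * (2 * L * d) := by gcongr
    _ = _ := by ring

lemma exists_box (a : ℝ) {h : ℝ} (hh : 0 < h) :
    ∃ r, 0 < r ∧ ∀ᶠ x : ℝ × ℝ in 𝓝 (a, h), |x.1| ≤ r ∧ r⁻¹ ≤ x.2 ∧ x.2 ≤ r := by
  refine ⟨|a| + 2 * h + 2 / h, by positivity, ?_⟩
  have h1 : ∀ᶠ x : ℝ × ℝ in 𝓝 (a, h), |x.1| < |a| + 2 * h + 2 / h :=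
    (continuous_fst.abs.tendsto (a, h)).eventually_lt_const (by
      change |a| < _; have : 0 < 2 * h + 2 / h := by positivity
      linarith)
  have h2 : ∀ᶠ x : ℝ × ℝ in 𝓝 (a, h), (|a| + 2 * h + 2 / h)⁻¹ < x.2 :=
    (continuous_snd.tendsto (a, h)).eventually_const_lt (by
      change _ < h
      refine (inv_lt_comm₀ (by positivity) hh).2 ?_
      have : h⁻¹ < 2 / h := by rw [inv_eq_one_div]; gcongr; norm_num
      have : 0 ≤ |a| := abs_nonneg a
      linarith)
  have h3 : ∀ᶠ x : ℝ × ℝ in 𝓝 (a, h), x.2 < |a| + 2 * h + 2 / h :=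
    (continuous_snd.tendsto (a, h)).eventually_lt_const (by
      change h < _
      have : 0 < 2 / h := by positivity
      have : 0 ≤ |a| := abs_nonneg a
      linarith)
  filter_upwards [h1, h2, h3] with x x1 x2 x3 using ⟨x1.le, x2.le, x3.le⟩

lemma tendsto_dist_sum (a h : ℝ) :
    Tendsto (fun x : ℝ × ℝ => |x.1 - a| + |x.2 - h|) (𝓝 (a, h)) (𝓝 0) := by
  have : Continuous fun x : ℝ × ℝ => |x.1 - a| + |x.2 - h| := by fun_prop
  simpa using this.tendsto (a, h)

lemma IsPotential.continuousAt_lapAction (hF : IsPotential F F') (hq : 0 ≤ q) (he : 0 < e)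
    (hh : 0 < h) : ContinuousAt (fun x : ℝ × ℝ => lapAction F q e x.1 x.2) (a, h) := by
  obtain ⟨r, hr, hev⟩ := exists_box a hh
  obtain ⟨C, hC0, hC⟩ := hF.lapAction_estimates hq he hr
  obtain ⟨b1, b2, b3⟩ := hev.self_of_nhds
  rw [ContinuousAt, tendsto_iff_dist_tendsto_zero]
  have ht := (tendsto_dist_sum a h).const_mul C
  rw [mul_zero] at ht
  refine squeeze_zero' (Eventually.of_forall fun _ => dist_nonneg) ?_ ht
  filter_upwards [hev] with x hx
  exact (hC a h x.1 x.2 b1 b2 b3 hx.1 hx.2.1 hx.2.2).2.1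

lemma IsPotential.continuousAt_lapMin (hF : IsPotential F F') (hq : 0 ≤ q) (he : 0 < e)
    (hh : 0 < h) : ContinuousAt (fun x : ℝ × ℝ => lapMin F q e x.1 x.2) (a, h) := by
  obtain ⟨r, hr, hev⟩ := exists_box a hh
  obtain ⟨C, hC0, hC⟩ := hF.lapAction_estimates hq he hr
  obtain ⟨b1, b2, b3⟩ := hev.self_of_nhds
  rw [ContinuousAt, tendsto_iff_norm_sub_tendsto_zero]
  have ht := ((tendsto_dist_sum a h).const_mul C).sqrt
  rw [mul_zero, Real.sqrt_zero] at ht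
  refine squeeze_zero' (Eventually.of_forall fun _ => norm_nonneg _) ?_ ht
  filter_upwards [hev] with x hx
  rw [norm_sub_rev]
  exact Real.le_sqrt_of_sq_le (hC a h x.1 x.2 b1 b2 b3 hx.1 hx.2.1 hx.2.2).2.2

lemma IsPotential.tendsto_integral (hF : IsPotential F F') (hq : 0 ≤ q) (he : 0 < e)
    (hh : 0 < h) {φ ψ : ℝ → ℝ} (hφ : Continuous φ) (hψ : Continuous ψ) :
    Tendsto (fun x : ℝ × ℝ => ∫ s in (0 : ℝ)..1,
      φ (x.1 + x.2 * s) * ψ s * (prim (lapMin F q e x.1 x.2) s) ^ (-(2 / 3) : ℝ)) (𝓝 (a, h))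
      (𝓝 (∫ s in (0 : ℝ)..1,
        φ (a + h * s) * ψ s * (prim (lapMin F q e a h) s) ^ (-(2 / 3) : ℝ))) := by
  obtain ⟨r, hr, hev⟩ := exists_box a hh
  have hri : 0 < r⁻¹ := inv_pos.2 hr
  obtain ⟨C, hC⟩ := isCompact_Icc.exists_bound_of_continuousOn
    (s := Icc (-(2 * r)) (2 * r)) hφ.continuousOn
  obtain ⟨C', hC'⟩ := isCompact_Icc.exists_bound_of_continuousOn
    (s := Icc (0 : ℝ) 1) hψ.continuousOn
  have hη0 : 0 < min 1 (9 * r⁻¹ ^ 2 * e / 16) := lapBarrier_pos he hri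
  have hab : ∀ᶠ x : ℝ × ℝ in 𝓝 (a, h),
      Above (min 1 (9 * r⁻¹ ^ 2 * e / 16)) (lapMin F q e x.1 x.2) := by
    filter_upwards [hev] with x hx
    refine (hF.lapMin_spec (a := x.1) hq he (hri.trans_le hx.2.1)).1.mono ?_
    have := hx.2.1
    gcongr
  refine tendsto_integral_prim_rpow_neg (k := fun x : ℝ × ℝ => fun s => φ (x.1 + x.2 * s) * ψ s)
    (C := C * C') hη0 (hF.continuousAt_lapMin hq he hh) hab
    hab.self_of_nhds (Eventually.of_forall fun x => by fun_prop) ?_ fun s _ => ?_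
  · filter_upwards [hev] with x hx s hs
    rw [abs_mul]
    have h1 := hC _ (mem_Icc_of_box hx.1 (hri.trans_le hx.2.1).le hx.2.2 hs)
    exact mul_le_mul h1 (hC' s hs) (abs_nonneg _) ((norm_nonneg _).trans h1)
  · have : Continuous fun x : ℝ × ℝ => φ (x.1 + x.2 * s) * ψ s := by fun_prop
    exact this.tendsto (a, h)

lemma IsPotential.continuousAt_partA (hF : IsPotential F F') (hq : 0 ≤ q) (he : 0 < e)
    (hh : 0 < h) :
    ContinuousAt (fun x : ℝ × ℝ => partA F' x.1 x.2 (lapMin F q e x.1 x.2)) (a, h) := by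
  have h1 := hF.tendsto_integral (a := a) hq he hh hF.cont' (continuous_const (y := (1 : ℝ)))
  simp only [mul_one] at h1
  exact continuousAt_snd.mul h1

lemma IsPotential.continuousAt_partH (hF : IsPotential F F') (hq : 0 ≤ q) (he : 0 < e)
    (hh : 0 < h) :
    ContinuousAt (fun x : ℝ × ℝ => partH F F' q e x.1 x.2 (lapMin F q e x.1 x.2)) (a, h) := by
  have h1 := hF.tendsto_integral (a := a) hq he hh (φ := fun t => F t + e)
    (hF.cont.add continuous_const) (continuous_const (y := (1 : ℝ)))
  have h2 := hF.tendsto_integral (a := a) hq he hh hF.cont' continuous_id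
  simp only [mul_one] at h1
  have hm := hF.continuousAt_lapMin (a := a) hq he hh
  have h3 := tendsto_integral_prim_rpow hm (r := 2 / 3) (by norm_num)
  have hs : Tendsto (fun x : ℝ × ℝ => x.2) (𝓝 (a, h)) (𝓝 h) := continuousAt_snd
  unfold partH
  have h4 : Tendsto (fun x : ℝ × ℝ => -(2 / (9 * x.2 ^ 2))) (𝓝 (a, h)) (𝓝 (-(2 / (9 * h ^ 2)))) :=
    (tendsto_const_nhds.div ((hs.pow 2).const_mul 9) (by positivity)).neg
  have h5 : Tendsto (fun x : ℝ × ℝ => ‖lapMin F q e x.1 x.2‖ ^ 2) (𝓝 (a, h))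
    (𝓝 (‖lapMin F q e a h‖ ^ 2)) := (hm.norm).pow 2
  exact (((h4.mul h5).sub (h3.const_mul (q / 2))).add h1).add (hs.mul h2)

end

/-! ### Trial laps of cosine shape. -/

lemma mul_one_sub_pos {s : ℝ} (hs : s ∈ Ioo (0 : ℝ) 1) : 0 < s * (1 - s) :=
  mul_pos hs.1 (by linarith [hs.2])

lemma mul_one_sub_nonneg {s : ℝ} (hs : s ∈ Icc (0 : ℝ) 1) : 0 ≤ s * (1 - s) :=
  mul_nonneg hs.1 (by linarith [hs.2])

lemma hasDerivAt_mul_one_sub (s : ℝ) : HasDerivAt (fun s : ℝ => s * (1 - s)) (1 - 2 * s) s :=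
  ((hasDerivAt_id' s).mul ((hasDerivAt_id' s).const_sub 1)).congr_deriv (by ring)

lemma hasDerivAt_sqrt_parabola {s : ℝ} (hs : s ∈ Ioo (0 : ℝ) 1) :
    HasDerivAt (fun s => √(s * (1 - s))) ((1 - 2 * s) / 2 * (√(s * (1 - s)))⁻¹) s :=
  ((hasDerivAt_mul_one_sub s).sqrt (mul_one_sub_pos hs).ne').congr_deriv (by
    have := (Real.sqrt_pos.2 (mul_one_sub_pos hs)).ne'
    field_simp)

lemma hasDerivAt_arcsin_parabola {s : ℝ} (hs : s ∈ Ioo (0 : ℝ) 1) :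
    HasDerivAt (fun s => Real.arcsin (2 * s - 1)) (√(s * (1 - s)))⁻¹ s := by
  have h1 : HasDerivAt (fun s : ℝ => 2 * s - 1) 2 s := by
    simpa using ((hasDerivAt_id' s).const_mul 2).sub_const 1
  refine ((Real.hasDerivAt_arcsin (x := 2 * s - 1) (by linarith [hs.1])
    (by linarith [hs.2])).comp s h1).congr_deriv ?_
  have h2 : 1 - (2 * s - 1) ^ 2 = 2 ^ 2 * (s * (1 - s)) := by ring
  have h3 := (Real.sqrt_pos.2 (mul_one_sub_pos hs)).ne'
  rw [h2, Real.sqrt_mul (by norm_num), Real.sqrt_sq (by norm_num)]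
  field_simp

lemma rpow_neg_half_eq {x : ℝ} (hx : 0 ≤ x) : x ^ (-(1 / 2) : ℝ) = (√x)⁻¹ := by
  rw [Real.rpow_neg hx, Real.sqrt_eq_rpow]

lemma intervalIntegrable_inv_sqrt_parabola :
    IntervalIntegrable (fun s : ℝ => (√(s * (1 - s)))⁻¹) volume 0 1 := by
  refine (intervalIntegrable_parabola_rpow (r := -(1 / 2)) (by norm_num) (by norm_num)).congr ?_
  intro s hs
  rw [uIoc_of_le zero_le_one] at hs
  exact rpow_neg_half_eq (mul_one_sub_nonneg (Ioc_subset_Icc_self hs))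

lemma continuous_sqrt_parabola : Continuous fun s : ℝ => √(s * (1 - s)) := by fun_prop

lemma integral_inv_sqrt_parabola : ∫ s in (0 : ℝ)..1, (√(s * (1 - s)))⁻¹ = Real.pi := by
  rw [intervalIntegral.integral_eq_sub_of_hasDerivAt_of_le zero_le_one
    (f := fun s => Real.arcsin (2 * s - 1))
    (Real.continuous_arcsin.comp (by fun_prop)).continuousOn
    (fun s hs => hasDerivAt_arcsin_parabola hs) intervalIntegrable_inv_sqrt_parabola]
  norm_num [Real.arcsin_one, Real.arcsin_neg]

lemma integral_sqrt_parabola : ∫ s in (0 : ℝ)..1, √(s * (1 - s)) = Real.pi / 8 := by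
  rw [intervalIntegral.integral_eq_sub_of_hasDerivAt_of_le zero_le_one
    (f := fun s => (2 * s - 1) / 4 * √(s * (1 - s)) + Real.arcsin (2 * s - 1) / 8)
    (((by fun_prop : Continuous fun s : ℝ => (2 * s - 1) / 4).mul continuous_sqrt_parabola).add
      ((Real.continuous_arcsin.comp (by fun_prop)).div_const 8)).continuousOn
    (fun s hs => ?_) (continuous_sqrt_parabola.intervalIntegrable _ _)]
  · norm_num [Real.arcsin_one, Real.arcsin_neg]
    ring
  · have h1 : HasDerivAt (fun s : ℝ => (2 * s - 1) / 4) (2 / 4) s := by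
      simpa using (((hasDerivAt_id' s).const_mul 2).sub_const 1).div_const 4
    refine ((h1.mul (hasDerivAt_sqrt_parabola hs)).add
      ((hasDerivAt_arcsin_parabola hs).div_const 8)).congr_deriv ?_
    have h3 := (Real.sqrt_pos.2 (mul_one_sub_pos hs)).ne'
    have h4 := Real.sq_sqrt (mul_one_sub_pos hs).le
    field_simp
    linear_combination (-32 : ℝ) * h4

lemma integral_sq_mul_inv_sqrt_parabola :
    ∫ s in (0 : ℝ)..1, (1 - s) ^ 2 * (√(s * (1 - s)))⁻¹ = 3 * Real.pi / 8 := by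
  have hi : IntervalIntegrable (fun s : ℝ => (1 - 2 * s) / 2 * (√(s * (1 - s)))⁻¹) volume 0 1 :=
    intervalIntegrable_inv_sqrt_parabola.continuousOn_mul (by fun_prop)
  have h1 : ∫ s in (0 : ℝ)..1, (1 - 2 * s) / 2 * (√(s * (1 - s)))⁻¹ = 0 := by
    rw [intervalIntegral.integral_eq_sub_of_hasDerivAt_of_le zero_le_one
      continuous_sqrt_parabola.continuousOn (fun s hs => hasDerivAt_sqrt_parabola hs) hi]
    norm_num
  have h2 : ∫ s in (0 : ℝ)..1, (1 - s) ^ 2 * (√(s * (1 - s)))⁻¹ =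
      ∫ s in (0 : ℝ)..1, (1 / 2 * (√(s * (1 - s)))⁻¹ + (1 - 2 * s) / 2 * (√(s * (1 - s)))⁻¹ -
        √(s * (1 - s))) := by
    refine intervalIntegral.integral_congr fun s hs => ?_
    rw [uIcc_of_le zero_le_one] at hs
    rcases eq_or_ne (√(s * (1 - s))) 0 with h0 | h0
    · rw [h0]; simp
    · have h4 := Real.sq_sqrt (mul_one_sub_nonneg hs)
      field_simp
      linear_combination 2 * h4
  rw [h2, intervalIntegral.integral_sub ((intervalIntegrable_inv_sqrt_parabola.const_mul _).add hi)
    (continuous_sqrt_parabola.intervalIntegrable _ _),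
    intervalIntegral.integral_add (intervalIntegrable_inv_sqrt_parabola.const_mul _) hi,
    intervalIntegral.integral_const_mul, h1, integral_inv_sqrt_parabola, integral_sqrt_parabola]
  ring

/-- The element of `L2I` corresponding to a half period of a cosine of frequency `ω`
and height `h`. -/
lemma exists_cosine_lap {c : ℝ} (hc : 0 < c) :
    ∃ g : L2I, (∃ η > 0, Above η g) ∧ ‖g‖ ^ 2 = 9 * Real.pi / 32 * c ^ 3 ∧
      ∀ s ∈ Icc (0 : ℝ) 1, (prim g s) ^ (2 / 3 : ℝ) = c * √(s * (1 - s)) := by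
  -- For u = a + h(1 − cos ωx)/2 one has u' = ωh√(s(1 − s)). Here c stands for ωh, and the profile
  -- is the power 3/2 of this velocity.
  set K := c ^ (3 / 2 : ℝ) with hK
  have hK0 : 0 < K := by positivity
  have hK2 : K ^ 2 = c ^ 3 := by
    rw [hK, ← Real.rpow_natCast, ← Real.rpow_mul hc.le, ← Real.rpow_natCast]; norm_num
  have hK3 : K ^ (2 / 3 : ℝ) = c := by
    rw [hK, ← Real.rpow_mul hc.le]; norm_num
  set f' : ℝ → ℝ := fun s => K * ((1 - 2 * s) * (3 / 4) * (s * (1 - s)) ^ (-(1 / 4) : ℝ)) with hf'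
  have hd : ∀ s ∈ Ioo (0 : ℝ) 1, HasDerivAt (fun s : ℝ => K * (s * (1 - s)) ^ (3 / 4 : ℝ))
      (f' s) s := fun s hs => by
    refine (((hasDerivAt_mul_one_sub s).rpow_const (p := 3 / 4)
      (Or.inl (mul_one_sub_pos hs).ne')).const_mul K).congr_deriv ?_
    have : (3 / 4 - 1 : ℝ) = -(1 / 4) := by norm_num
    simp only [hf', this]
  have hsq : ∀ s ∈ Icc (0 : ℝ) 1, f' s ^ 2 =
      9 / 16 * c ^ 3 * ((√(s * (1 - s)))⁻¹ - 4 * √(s * (1 - s))) := fun s hs => by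
    have hx := mul_one_sub_nonneg hs
    have h1 : ((s * (1 - s)) ^ (-(1 / 4) : ℝ)) ^ 2 = (√(s * (1 - s)))⁻¹ := by
      rw [← rpow_neg_half_eq hx, ← Real.rpow_natCast, ← Real.rpow_mul hx]; norm_num
    have h2 : f' s ^ 2 = K ^ 2 * (9 / 16) * (1 - 2 * s) ^ 2 *
        ((s * (1 - s)) ^ (-(1 / 4) : ℝ)) ^ 2 := by simp only [hf']; ring
    rw [h2, h1, hK2]
    rcases eq_or_ne (√(s * (1 - s))) 0 with h0 | h0
    · rw [h0]; simp
    · have h4 := Real.sq_sqrt hx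
      field_simp
      linear_combination 4 * h4
  have hi : IntervalIntegrable (fun s : ℝ => (√(s * (1 - s)))⁻¹ - 4 * √(s * (1 - s))) volume 0 1 :=
    intervalIntegrable_inv_sqrt_parabola.sub
      ((continuous_sqrt_parabola.intervalIntegrable _ _).const_mul 4)
  have hmeas : Measurable f' := by fun_prop
  have hm : MemLp f' 2 (volume.restrict (Ioc 0 1)) := by
    rw [memLp_two_iff_integrable_sq hmeas.aestronglyMeasurable]
    have := (intervalIntegrable_iff_integrableOn_Ioc_of_le zero_le_one).1
      (hi.const_mul (9 / 16 * c ^ 3))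
    refine IntegrableOn.congr_fun this (fun s hs => (hsq s (Ioc_subset_Icc_self hs)).symm)
      measurableSet_Ioc
  have hcont : Continuous fun s : ℝ => K * (s * (1 - s)) ^ (3 / 4 : ℝ) :=
    continuous_const.mul ((by fun_prop : Continuous fun s : ℝ => s * (1 - s)).rpow_const
      fun _ => Or.inr (by norm_num))
  obtain ⟨g, hg, hgn⟩ := exists_prim_eq hcont.continuousOn hd
    (by simp) hm
  refine ⟨g, ⟨K, hK0, ?_, fun s hs => ?_⟩, ?_, fun s hs => ?_⟩
  · rw [hg 1 ⟨zero_le_one, le_rfl⟩]; simp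
  · rw [hg s hs]
    gcongr
    have h0 := mul_one_sub_nonneg hs
    have h1 : s * (1 - s) ≤ 1 := by nlinarith [hs.1, hs.2]
    calc s * (1 - s) = (s * (1 - s)) ^ (1 : ℝ) := (Real.rpow_one _).symm
      _ ≤ _ := by
        rcases h0.eq_or_lt with h | h
        · rw [← h, Real.zero_rpow (by norm_num), Real.zero_rpow (by norm_num)]
        · exact Real.rpow_le_rpow_of_exponent_ge h h1 (by norm_num)
  · rw [hgn, intervalIntegral.integral_congr (g := fun s =>
      9 / 16 * c ^ 3 * ((√(s * (1 - s)))⁻¹ - 4 * √(s * (1 - s))))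
      (fun s hs => hsq s (by rwa [uIcc_of_le zero_le_one] at hs)),
      intervalIntegral.integral_const_mul,
      intervalIntegral.integral_sub intervalIntegrable_inv_sqrt_parabola
      ((continuous_sqrt_parabola.intervalIntegrable _ _).const_mul 4),
      intervalIntegral.integral_const_mul, integral_inv_sqrt_parabola, integral_sqrt_parabola]
    ring
  · have hx := mul_one_sub_nonneg hs
    rw [hg s hs, Real.mul_rpow hK0.le (by positivity), hK3, ← Real.rpow_mul hx,
      Real.sqrt_eq_rpow]
    norm_num

section
variable {F F' : ℝ → ℝ} {q e a h : ℝ}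

/-- The least action is tested with half a period of a cosine of frequency ω, whose kinetic
integrals are explicit. -/
lemma IsPotential.lapAction_le_cosine (hF : IsPotential F F') (hq : 0 ≤ q) (he : 0 < e)
    (hh : 0 < h) {ω : ℝ} (hω : 0 < ω) {k : ℝ → ℝ} (hk : Continuous k)
    (hFk : ∀ s ∈ Icc (0 : ℝ) 1, F (a + h * s) ≤ k s) :
    lapAction F q e a h ≤ Real.pi * h ^ 2 / 16 * (ω ^ 3 - q * ω) +
      1 / ω * ∫ s in (0 : ℝ)..1, (k s + e) * (√(s * (1 - s)))⁻¹ := by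
  have hc : 0 < ω * h := by positivity
  obtain ⟨g, ⟨η, hη, hg⟩, hgn, hgp⟩ := exists_cosine_lap hc
  have h1 := hF.lapAction_le (a := a) hq he hh hη hg
  have h2 : 0 ≤ 1 / (9 * h) * ‖g - lapMin F q e a h‖ ^ 2 := by positivity
  have hFc := hF.cont
  have hneg : ∀ s ∈ Icc (0 : ℝ) 1, (prim g s) ^ (-(2 / 3) : ℝ) =
      (ω * h)⁻¹ * (√(s * (1 - s)))⁻¹ := fun s hs => by
    rw [Real.rpow_neg (hg.nonneg hη hs), hgp s hs, mul_inv]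
  have h3 : ∫ s in (0 : ℝ)..1, (prim g s) ^ (2 / 3 : ℝ) = ω * h * (Real.pi / 8) := by
    rw [intervalIntegral.integral_congr (g := fun s => ω * h * √(s * (1 - s)))
      (fun s hs => hgp s (by rwa [uIcc_of_le zero_le_one] at hs)),
      intervalIntegral.integral_const_mul, integral_sqrt_parabola]
  have h4 : ∫ s in (0 : ℝ)..1, (F (a + h * s) + e) * (prim g s) ^ (-(2 / 3) : ℝ) ≤
      (ω * h)⁻¹ * ∫ s in (0 : ℝ)..1, (k s + e) * (√(s * (1 - s)))⁻¹ := by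
    rw [← intervalIntegral.integral_const_mul]
    refine intervalIntegral.integral_mono_on zero_le_one
      (hg.intervalIntegrable hη (by fun_prop))
      ((intervalIntegrable_inv_sqrt_parabola.continuousOn_mul (by fun_prop)).const_mul _)
      fun s hs => ?_
    rw [hneg s hs]
    have := hFk s hs
    have h5 : 0 ≤ (ω * h)⁻¹ * (√(s * (1 - s)))⁻¹ := by positivity
    calc (F (a + h * s) + e) * ((ω * h)⁻¹ * (√(s * (1 - s)))⁻¹)
        ≤ (k s + e) * ((ω * h)⁻¹ * (√(s * (1 - s)))⁻¹) := by gcongr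
      _ = _ := by ring
  have h5 := mul_le_mul_of_nonneg_left h4 hh.le
  rw [lapEnergy_eq, hgn, h3] at h1
  set I := ∫ s in (0 : ℝ)..1, (k s + e) * (√(s * (1 - s)))⁻¹
  have e1 : h * ((ω * h)⁻¹ * I) = 1 / ω * I := by field_simp
  have e2 : 2 / (9 * h) * (9 * Real.pi / 32 * (ω * h) ^ 3) -
      q / 2 * h * (ω * h * (Real.pi / 8)) = Real.pi * h ^ 2 / 16 * (ω ^ 3 - q * ω) := by
    field_simp
    ring
  rw [e1] at h5
  linarith

/-- Laps of small height have small action. -/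
lemma IsPotential.lapAction_le_of_le (hF : IsPotential F F') (hq : 0 ≤ q) (he : 0 < e)
    (hh : 0 < h) {m : ℝ} (hm : ∀ s ∈ Icc (0 : ℝ) 1, F (a + h * s) ≤ m) :
    lapAction F q e a h ≤ Real.pi * h ^ 2 / 16 + Real.pi * (m + e) := by
  have h1 := hF.lapAction_le_cosine (a := a) hq he hh one_pos (continuous_const (y := m)) hm
  rw [intervalIntegral.integral_const_mul, integral_inv_sqrt_parabola] at h1
  have : 0 ≤ Real.pi * h ^ 2 / 16 * q := by have := Real.pi_pos; positivity
  linarith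

/-- Long laps descending into a region where the potential grows slowly have negative action. -/
lemma IsPotential.exists_lapAction_neg (hF : IsPotential F F') (hq : 0 < q) (he : 0 < e) {l C : ℝ}
    (hl : 24 * l < q ^ 2) (hFl : ∀ t ≤ 0, F t ≤ l * t ^ 2 + C) (m : ℝ) :
    ∃ h > 0, m ≤ h ∧ lapAction F q e (-h) h < 0 := by
  -- The choice ω² = q/2 minimises ω⁴ − qω². The coefficient of h² becomes π(24l − q²)/(64ω), which
  -- is the source of the constant 24.
  have hω : 0 < √(q / 2) := Real.sqrt_pos.2 (by positivity)
  have hω2 : √(q / 2) ^ 2 = q / 2 := Real.sq_sqrt (by positivity)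
  set ω := √(q / 2)
  have hd : 0 < (q ^ 2 - 24 * l) / 64 := by linarith
  obtain ⟨h, hh⟩ : ∃ h : ℝ, 1 ≤ h ∧ m ≤ h ∧ |C + e| < (q ^ 2 - 24 * l) / 64 * h := by
    refine ⟨max 1 (max m (|C + e| / ((q ^ 2 - 24 * l) / 64) + 1)), le_max_left _ _,
      (le_max_left _ _).trans (le_max_right _ _), ?_⟩
    calc |C + e| = (q ^ 2 - 24 * l) / 64 * (|C + e| / ((q ^ 2 - 24 * l) / 64)) :=
          (mul_div_cancel₀ _ hd.ne').symm
      _ < _ := by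
        gcongr
        exact (lt_add_one _).trans_le ((le_max_right _ _).trans (le_max_right _ _))
  have hh0 : 0 < h := by linarith
  refine ⟨h, hh0, hh.2.1, ?_⟩
  have h1 := hF.lapAction_le_cosine (a := -h) (h := h) hq.le he hh0 hω
    (k := fun s => l * h ^ 2 * (1 - s) ^ 2 + C) (by fun_prop) (fun s hs => by
      refine (hFl _ ?_).trans (le_of_eq (by ring))
      nlinarith [hs.1, hs.2])
  have hi : IntervalIntegrable (fun s : ℝ => (1 - s) ^ 2 * (√(s * (1 - s)))⁻¹) volume 0 1 :=
    intervalIntegrable_inv_sqrt_parabola.continuousOn_mul (by fun_prop)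
  have h2 : ∫ s in (0 : ℝ)..1, (l * h ^ 2 * (1 - s) ^ 2 + C + e) * (√(s * (1 - s)))⁻¹ =
      l * h ^ 2 * (3 * Real.pi / 8) + (C + e) * Real.pi := by
    rw [← integral_sq_mul_inv_sqrt_parabola, ← integral_inv_sqrt_parabola,
      ← intervalIntegral.integral_const_mul, ← intervalIntegral.integral_const_mul,
      ← intervalIntegral.integral_add (hi.const_mul _)
        (intervalIntegrable_inv_sqrt_parabola.const_mul _)]
    congr 1
    funext s
    ring
  rw [h2] at h1
  refine h1.trans_lt ?_
  have e1 : Real.pi * h ^ 2 / 16 * (ω ^ 3 - q * ω) +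
      1 / ω * (l * h ^ 2 * (3 * Real.pi / 8) + (C + e) * Real.pi) =
      Real.pi / ω * ((C + e) - (q ^ 2 - 24 * l) / 64 * h ^ 2) := by
    field_simp
    linear_combination 512 * h ^ 2 * (ω ^ 2 - q / 2) * hω2
  rw [e1]
  refine mul_neg_of_pos_of_neg (div_pos Real.pi_pos hω) ?_
  have h3 : (q ^ 2 - 24 * l) / 64 * h ≤ (q ^ 2 - 24 * l) / 64 * h ^ 2 := by
    gcongr; nlinarith [hh.1]
  linarith [le_abs_self (C + e), hh.2.2]

end

/-! ### Deformation of the quadrant by projected gradient steps. -/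

/-- End points of nondegenerate laps crossing the equilibrium. -/
def crossing : Set (ℝ × ℝ) := {x | x.1 ≤ 0 ∧ 0 ≤ x.2 ∧ x.1 < x.2}

/-- First order necessary conditions for a minimum on the quadrant `x.1 ≤ 0 ≤ x.2`. -/
def IsKKT (A B : ℝ × ℝ → ℝ) (x : ℝ × ℝ) : Prop :=
  (x.1 < 0 → A x = 0) ∧ (x.1 = 0 → A x ≤ 0) ∧ (0 < x.2 → B x = 0) ∧ (x.2 = 0 → 0 ≤ B x)

lemma abs_min_sub_le {a s : ℝ} (ha : a ≤ 0) : |min (a - s) 0 - a| ≤ |s| := by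
  have := abs_min_sub_min_le_max (a - s) 0 a 0
  rw [min_eq_left ha] at this
  simpa using this

/-- The obtuse angle property of the projection onto a half-line: the first order gain of a
projected step is at least quadratic in its length. -/
lemma mul_min_sub_le {a s : ℝ} (ha : a ≤ 0) :
    s * (min (a - s) 0 - a) ≤ -(min (a - s) 0 - a) ^ 2 := by
  rcases le_total (a - s) 0 with h | h
  · rw [min_eq_left h]; nlinarith
  · rw [min_eq_right h]; nlinarith

lemma abs_max_sub_le {b s : ℝ} (hb : 0 ≤ b) : |max (b - s) 0 - b| ≤ |s| := by
  have := abs_max_sub_max_le_max (b - s) 0 b 0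
  rw [max_eq_left hb] at this
  simpa using this

lemma mul_max_sub_le {b s : ℝ} (hb : 0 ≤ b) :
    s * (max (b - s) 0 - b) ≤ -(max (b - s) 0 - b) ^ 2 := by
  rcases le_total 0 (b - s) with h | h
  · rw [max_eq_left h]; nlinarith
  · rw [max_eq_right h]; nlinarith

lemma crossing_norm {x : ℝ × ℝ} (hx : x ∈ crossing) :
    ‖x‖ ≤ x.2 - x.1 ∧ x.2 - x.1 ≤ 2 * ‖x‖ ∧ |x.1| ≤ ‖x‖ ∧ |x.2| ≤ ‖x‖ := by
  have h1 : |x.1| ≤ ‖x‖ := by rw [Prod.norm_def]; exact le_max_left _ _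
  have h2 : |x.2| ≤ ‖x‖ := by rw [Prod.norm_def]; exact le_max_right _ _
  obtain ⟨ha, hb, -⟩ := hx
  have h3 := abs_of_nonpos ha
  have h4 := abs_of_nonneg hb
  refine ⟨?_, by linarith, h1, h2⟩
  rw [Prod.norm_def, Real.norm_eq_abs, Real.norm_eq_abs]
  exact max_le (by linarith) (by linarith)

lemma mem_crossing_of_norm {x : ℝ × ℝ} (h1 : x.1 ≤ 0) (h2 : 0 ≤ x.2) (h : 0 < ‖x‖) :
    x ∈ crossing := by
  refine ⟨h1, h2, lt_of_le_of_ne (h1.trans h2) fun he => ?_⟩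
  have e1 : x.1 = 0 := by linarith
  have e2 : x.2 = 0 := by linarith
  have : x = 0 := Prod.ext e1 e2
  rw [this, norm_zero] at h
  exact h.false

lemma isCompact_annulus {r R : ℝ} : IsCompact {x : ℝ × ℝ | x.1 ≤ 0 ∧ 0 ≤ x.2 ∧ r ≤ ‖x‖ ∧ ‖x‖ ≤ R} := by
  refine Metric.isCompact_of_isClosed_isBounded ?_ ?_
  · exact (isClosed_le continuous_fst continuous_const).inter
      ((isClosed_le continuous_const continuous_snd).inter
      ((isClosed_le continuous_const continuous_norm).inter
      (isClosed_le continuous_norm continuous_const)))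
  · exact (Metric.isBounded_closedBall (x := (0 : ℝ × ℝ)) (r := R)).subset fun x hx => by
      simpa using hx.2.2.2

lemma isKKT_of_fixed {A B : ℝ × ℝ → ℝ} {x : ℝ × ℝ} {τ : ℝ} (hτ : 0 < τ)
    (h1 : min (x.1 - τ * A x) 0 = x.1) (h2 : max (x.2 - τ * B x) 0 = x.2) : IsKKT A B x := by
  have e1 := min_le_left (x.1 - τ * A x) 0
  have e2 := le_max_left (x.2 - τ * B x) 0
  refine ⟨fun h => ?_, fun h => ?_, fun h => ?_, fun h => ?_⟩
  · rcases min_choice (x.1 - τ * A x) 0 with h6 | h6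
    · have : τ * A x = 0 := by linarith
      exact (mul_eq_zero.1 this).resolve_left hτ.ne'
    · linarith
  · exact nonpos_of_mul_nonpos_right (by linarith : τ * A x ≤ 0) hτ
  · rcases max_choice (x.2 - τ * B x) 0 with h6 | h6
    · have : τ * B x = 0 := by linarith
      exact (mul_eq_zero.1 this).resolve_left hτ.ne'
    · linarith
  · exact nonneg_of_mul_nonneg_right (by linarith : 0 ≤ τ * B x) hτ

/-- A deformation of the quadrant decreasing a semiconcave function away from critical points:
one step of the projected gradient method, cut off near the origin and near infinity. -/
lemma exists_deformation {S A B : ℝ × ℝ → ℝ} (hS : ContinuousOn S crossing)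
    (hA : ContinuousOn A crossing) (hB : ContinuousOn B crossing)
    (hest : ∀ r > 0, ∃ C, 0 ≤ C ∧ ∀ x y : ℝ × ℝ, |x.1| ≤ r → r⁻¹ ≤ x.2 - x.1 → x.2 - x.1 ≤ r →
      |y.1| ≤ r → r⁻¹ ≤ y.2 - y.1 → y.2 - y.1 ≤ r →
      S y ≤ S x + (A x * (y.1 - x.1) + B x * (y.2 - x.2)) +
        C * (|y.1 - x.1| + |y.2 - x.2|) ^ 2)
    {ρ R c : ℝ} (hρ : 0 < ρ)
    (hcrit : ∀ x ∈ crossing, 2 * ρ ≤ ‖x‖ → ‖x‖ ≤ R → c ≤ S x → ¬ IsKKT A B x) :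
    ∃ (φ : ℝ × ℝ → ℝ × ℝ) (m : ℝ), 0 < m ∧ ContinuousOn φ crossing ∧
      MapsTo φ crossing crossing ∧ (∀ x ∈ crossing, S (φ x) ≤ S x) ∧
      (∀ x ∈ crossing, ‖x‖ ≤ ρ → φ x = x) ∧
      ∀ x ∈ crossing, 2 * ρ ≤ ‖x‖ → ‖x‖ ≤ R → c ≤ S x → S (φ x) ≤ S x - m := by
  have hann : ∀ r R, 0 < r → {x : ℝ × ℝ | x.1 ≤ 0 ∧ 0 ≤ x.2 ∧ r ≤ ‖x‖ ∧ ‖x‖ ≤ R} ⊆ crossing :=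
    fun r R hr x hx => mem_crossing_of_norm hx.1 hx.2.1 (hr.trans_le hx.2.2.1)
  obtain ⟨NA, hNA⟩ := (isCompact_annulus (r := ρ) (R := R + 1)).exists_bound_of_continuousOn
    (hA.mono (hann _ _ hρ))
  obtain ⟨NB, hNB⟩ := (isCompact_annulus (r := ρ) (R := R + 1)).exists_bound_of_continuousOn
    (hB.mono (hann _ _ hρ))
  set N := max 0 (max NA NB) with hN
  have hN0 : 0 ≤ N := le_max_left _ _
  have hNA' : NA ≤ N := (le_max_left _ _).trans (le_max_right _ _)
  have hNB' : NB ≤ N := (le_max_right _ _).trans (le_max_right _ _)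
  -- A box containing the annulus and its image: a step moves each end point by at most ρ/4, so
  -- heights remain at least ρ/2 ≥ r⁻¹.
  set r := 2 * (|R| + 1) + ρ + 2 / ρ with hr
  have hr0 : 0 < r := by positivity
  have hrρ : r⁻¹ ≤ ρ / 2 := by
    have : 2 / ρ ≤ r := by simp only [hr]; have : 0 ≤ |R| := abs_nonneg R; linarith
    calc r⁻¹ ≤ (2 / ρ)⁻¹ := by gcongr
      _ = ρ / 2 := by rw [inv_div]
  obtain ⟨C, hC0, hC⟩ := hest r hr0
  -- The part 4C lets the quadratic error consume at most half of the descent; the part 4N/ρ keeps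
  -- steps shorter than ρ/4.
  set τ := (4 * C + 1 + 4 * N / ρ)⁻¹ with hτ
  have hτ0 : 0 < τ := by positivity
  have hτC : 4 * C ≤ τ⁻¹ := by
    rw [hτ, inv_inv]; have : 0 ≤ 4 * N / ρ := by positivity
    linarith
  have hτN : τ * N ≤ ρ / 4 := by
    have h1 : 4 * N / ρ ≤ τ⁻¹ := by rw [hτ, inv_inv]; linarith
    have h2 : τ * (4 * N / ρ) ≤ 1 := by
      calc τ * (4 * N / ρ) ≤ τ * τ⁻¹ := by gcongr
        _ = 1 := mul_inv_cancel₀ hτ0.ne'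
    have h3 : τ * (4 * N / ρ) = τ * N * 4 / ρ := by ring
    rw [h3, div_le_one hρ] at h2
    linarith
  clear_value τ N r
  set θ : ℝ × ℝ → ℝ := fun x => min 1 (max 0 ((‖x‖ - ρ) / ρ)) * min 1 (max 0 (R + 1 - ‖x‖))
    with hθ
  have hθc : Continuous θ := by simp only [hθ]; fun_prop
  have hθ0 : ∀ x, 0 ≤ θ x := fun x => by simp only [hθ]; positivity
  have hθ1 : ∀ x, θ x ≤ 1 := fun x =>
    mul_le_one₀ (min_le_left _ _) (by positivity) (min_le_left _ _)
  have hθin : ∀ x, ‖x‖ ≤ ρ → θ x = 0 := fun x hx => by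
    have : (‖x‖ - ρ) / ρ ≤ 0 := div_nonpos_of_nonpos_of_nonneg (by linarith) hρ.le
    simp only [hθ]
    rw [max_eq_left this]; simp
  have hθout : ∀ x, R + 1 ≤ ‖x‖ → θ x = 0 := fun x hx => by
    have : R + 1 - ‖x‖ ≤ 0 := by linarith
    simp only [hθ]
    rw [max_eq_left this]; simp
  have hθone : ∀ x, 2 * ρ ≤ ‖x‖ → ‖x‖ ≤ R → θ x = 1 := fun x h1 h2 => by
    have e1 : 1 ≤ (‖x‖ - ρ) / ρ := by rw [le_div_iff₀ hρ]; linarith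
    have e2 : 1 ≤ R + 1 - ‖x‖ := by linarith
    simp only [hθ]
    rw [min_eq_left (e1.trans (le_max_right _ _)), min_eq_left (e2.trans (le_max_right _ _)),
      one_mul]
  clear_value θ
  set φ : ℝ × ℝ → ℝ × ℝ := fun x =>
    (min (x.1 - τ * θ x * A x) 0, max (x.2 - τ * θ x * B x) 0) with hφ
  have hφc : ContinuousOn φ crossing := by
    have h1 : ContinuousOn (fun x : ℝ × ℝ => τ * θ x) crossing := (hθc.const_mul τ).continuousOn
    exact ((continuousOn_fst.sub (h1.mul hA)).inf continuousOn_const).prodMk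
      ((continuousOn_snd.sub (h1.mul hB)).sup continuousOn_const)
  have hφid : ∀ x ∈ crossing, θ x = 0 → φ x = x := fun x hx h0 => by
    simp only [hφ, h0, mul_zero, zero_mul, sub_zero]
    rw [min_eq_left hx.1, max_eq_left hx.2.1]
  have main : ∀ x ∈ crossing, φ x ∈ crossing ∧
      S (φ x) ≤ S x - (2 * τ)⁻¹ * (((φ x).1 - x.1) ^ 2 + ((φ x).2 - x.2) ^ 2) := by
    intro x hx
    rcases (hθ0 x).eq_or_lt with h0 | hpos
    · rw [hφid x hx h0.symm]
      exact ⟨hx, by simp⟩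
    have hxρ : ρ < ‖x‖ := by
      by_contra! h; rw [hθin x h] at hpos; exact hpos.false
    have hxR : ‖x‖ < R + 1 := by
      by_contra! h; rw [hθout x h] at hpos; exact hpos.false
    obtain ⟨n1, n2, n3, n4⟩ := crossing_norm hx
    have hxm : x ∈ {x : ℝ × ℝ | x.1 ≤ 0 ∧ 0 ≤ x.2 ∧ ρ ≤ ‖x‖ ∧ ‖x‖ ≤ R + 1} :=
      ⟨hx.1, hx.2.1, hxρ.le, hxR.le⟩
    have bA : |A x| ≤ N := (hNA x hxm).trans hNA'
    have bB : |B x| ≤ N := (hNB x hxm).trans hNB'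
    have hstep : ∀ D, |D| ≤ N → |τ * θ x * D| ≤ ρ / 4 := fun D hD => by
      rw [abs_mul, abs_of_nonneg (by positivity)]
      calc τ * θ x * |D| ≤ τ * 1 * N := by gcongr; exact hθ1 x
        _ ≤ ρ / 4 := by rw [mul_one]; exact hτN
    have d1 : |(φ x).1 - x.1| ≤ ρ / 4 := (abs_min_sub_le hx.1).trans (hstep _ bA)
    have d2 : |(φ x).2 - x.2| ≤ ρ / 4 := (abs_max_sub_le hx.2.1).trans (hstep _ bB)
    -- The product DΔ is nonpositive, so dropping the cutoff factor θ ≤ 1 only strengthens the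
    -- descent.
    have hdesc : ∀ D Δ : ℝ, τ * θ x * D * Δ ≤ -Δ ^ 2 → D * Δ ≤ -(τ⁻¹ * Δ ^ 2) := by
      intro D Δ h
      have h1 : θ x * (D * Δ) ≤ -(τ⁻¹ * Δ ^ 2) := by
        have := mul_le_mul_of_nonneg_left h (inv_pos.2 hτ0).le
        calc θ x * (D * Δ) = τ⁻¹ * (τ * θ x * D * Δ) := by field_simp
          _ ≤ _ := by linarith
      have h2 : 0 ≤ τ⁻¹ * Δ ^ 2 := by positivity
      have h3 : D * Δ ≤ 0 := by
        by_contra! h4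
        have := mul_pos hpos h4
        linarith
      nlinarith [hθ1 x]
    have p1 := hdesc _ _ (mul_min_sub_le (s := τ * θ x * A x) hx.1)
    have p2 := hdesc _ _ (mul_max_sub_le (s := τ * θ x * B x) hx.2.1)
    change A x * ((φ x).1 - x.1) ≤ -(τ⁻¹ * ((φ x).1 - x.1) ^ 2) at p1
    change B x * ((φ x).2 - x.2) ≤ -(τ⁻¹ * ((φ x).2 - x.2) ^ 2) at p2
    have q1 := abs_le.1 d1
    have q2 := abs_le.1 d2
    have hRabs := le_abs_self R
    have h2ρ : 0 < 2 / ρ := by positivity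
    have hle : (φ x).1 ≤ 0 := min_le_right _ _
    have hge : 0 ≤ (φ x).2 := le_max_right _ _
    have hest' := hC x (φ x) (by linarith) (by linarith) (by linarith)
      (by rw [abs_of_nonpos hle]; have := abs_of_nonpos hx.1; linarith) (by linarith) (by linarith)
    refine ⟨⟨hle, hge, by linarith⟩, hest'.trans ?_⟩
    set u := (φ x).1 - x.1
    set v := (φ x).2 - x.2
    have e1 : (|u| + |v|) ^ 2 ≤ 2 * (u ^ 2 + v ^ 2) := by
      rw [← sq_abs u, ← sq_abs v]; nlinarith [sq_nonneg (|u| - |v|)]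
    have e2 : C * (|u| + |v|) ^ 2 ≤ C * (2 * (u ^ 2 + v ^ 2)) := by gcongr
    have e3 : 4 * C * (u ^ 2 + v ^ 2) ≤ τ⁻¹ * (u ^ 2 + v ^ 2) := by gcongr
    have e4 : (2 * τ)⁻¹ = τ⁻¹ / 2 := by rw [mul_inv]; ring
    rw [e4]
    linarith
  have hdec : ∀ x ∈ crossing, S (φ x) ≤ S x := fun x hx => by
    have := (main x hx).2
    have h1 : 0 ≤ (2 * τ)⁻¹ * (((φ x).1 - x.1) ^ 2 + ((φ x).2 - x.2) ^ 2) := by positivity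
    linarith
  have hmaps : MapsTo φ crossing crossing := fun x hx => (main x hx).1
  have h2ρ : 0 < 2 * ρ := by positivity
  set K := {x : ℝ × ℝ | x.1 ≤ 0 ∧ 0 ≤ x.2 ∧ 2 * ρ ≤ ‖x‖ ∧ ‖x‖ ≤ R} ∩ S ⁻¹' Ici c with hK
  have hKsub : K ⊆ crossing := inter_subset_left.trans (hann _ _ h2ρ)
  have hKc : IsCompact K := isCompact_annulus.of_isClosed_subset
    ((hS.mono (hann _ _ h2ρ)).preimage_isClosed_of_isClosed isCompact_annulus.isClosed isClosed_Ici)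
    inter_subset_left
  -- The decrease is uniform by compactness. Without decrease the point would be fixed by the full
  -- step, since θ = 1 there, hence a constrained critical point.
  obtain ⟨m, hm0, hm⟩ := hKc.exists_forall_le' (f := fun x => S x - S (φ x)) (a := 0)
    ((hS.mono hKsub).sub (hS.comp (hφc.mono hKsub) fun x hx => hmaps (hKsub hx))) (by
      intro x hx
      have hxc := hKsub hx
      have hx1 := hx.1
      have hθx := hθone x hx1.2.2.1 hx1.2.2.2
      by_contra! hle
      have h1 := (main x hxc).2
      have h2 : (2 * τ)⁻¹ * (((φ x).1 - x.1) ^ 2 + ((φ x).2 - x.2) ^ 2) ≤ 0 := by linarith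
      have h3 : ((φ x).1 - x.1) ^ 2 + ((φ x).2 - x.2) ^ 2 ≤ 0 :=
        nonpos_of_mul_nonpos_right h2 (by positivity)
      have h4 : (φ x).1 = x.1 := sub_eq_zero.1 ((pow_eq_zero_iff two_ne_zero).1
        (le_antisymm (by linarith [sq_nonneg ((φ x).2 - x.2)]) (sq_nonneg _)))
      have h5 : (φ x).2 = x.2 := sub_eq_zero.1 ((pow_eq_zero_iff two_ne_zero).1
        (le_antisymm (by linarith [sq_nonneg ((φ x).1 - x.1)]) (sq_nonneg _)))
      simp only [hφ, hθx, mul_one] at h4 h5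
      exact hcrit x hxc hx1.2.2.1 hx1.2.2.2 hx.2 (isKKT_of_fixed hτ0 h4 h5))
  refine ⟨φ, m, hm0, hφc, hmaps, hdec, fun x hx hxρ => hφid x hx (hθin x hxρ), ?_⟩
  intro x hx h1 h2 h3
  have := hm x ⟨⟨hx.1, hx.2.1, h1, h2⟩, h3⟩
  linarith

/-! ### The reduced action as a function of the two turning values. -/

/-- The least action of laps between two given heights. -/
noncomputable def endAction (F : ℝ → ℝ) (q e : ℝ) (x : ℝ × ℝ) : ℝ :=
  lapAction F q e x.1 (x.2 - x.1)

/-- The derivative of `endAction` with respect to the upper end point. -/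
noncomputable def endUpper (F F' : ℝ → ℝ) (q e : ℝ) (x : ℝ × ℝ) : ℝ :=
  partH F F' q e x.1 (x.2 - x.1) (lapMin F q e x.1 (x.2 - x.1))

/-- The derivative of `endAction` with respect to the lower end point. -/
noncomputable def endLower (F F' : ℝ → ℝ) (q e : ℝ) (x : ℝ × ℝ) : ℝ :=
  partA F' x.1 (x.2 - x.1) (lapMin F q e x.1 (x.2 - x.1)) - endUpper F F' q e x

section
variable {F F' : ℝ → ℝ} {q e : ℝ}

lemma continuousAt_ends {f : ℝ × ℝ → ℝ} (hf : ∀ a h : ℝ, 0 < h → ContinuousAt f (a, h)) :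
    ContinuousOn (fun x : ℝ × ℝ => f (x.1, x.2 - x.1)) crossing := fun x hx => by
  have h1 : Continuous fun x : ℝ × ℝ => (x.1, x.2 - x.1) := by fun_prop
  exact (ContinuousAt.comp (f := fun x : ℝ × ℝ => (x.1, x.2 - x.1)) (x := x)
    (hf x.1 (x.2 - x.1) (by linarith [hx.2.2])) h1.continuousAt).continuousWithinAt

lemma IsPotential.continuousOn_endAction (hF : IsPotential F F') (hq : 0 ≤ q) (he : 0 < e) :
    ContinuousOn (endAction F q e) crossing :=
  continuousAt_ends fun _ _ hh => hF.continuousAt_lapAction hq he hh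

lemma IsPotential.continuousOn_endUpper (hF : IsPotential F F') (hq : 0 ≤ q) (he : 0 < e) :
    ContinuousOn (endUpper F F' q e) crossing :=
  continuousAt_ends fun _ _ hh => hF.continuousAt_partH hq he hh

lemma IsPotential.continuousOn_endLower (hF : IsPotential F F') (hq : 0 ≤ q) (he : 0 < e) :
    ContinuousOn (endLower F F' q e) crossing :=
  (continuousAt_ends fun _ _ hh => hF.continuousAt_partA hq he hh).sub
    (hF.continuousOn_endUpper hq he)

lemma IsPotential.endAction_semiconcave (hF : IsPotential F F') (hq : 0 ≤ q) (he : 0 < e) (r : ℝ)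
    (hr : 0 < r) : ∃ C, 0 ≤ C ∧ ∀ x y : ℝ × ℝ, |x.1| ≤ r → r⁻¹ ≤ x.2 - x.1 → x.2 - x.1 ≤ r →
      |y.1| ≤ r → r⁻¹ ≤ y.2 - y.1 → y.2 - y.1 ≤ r →
      endAction F q e y ≤ endAction F q e x + (endLower F F' q e x * (y.1 - x.1) +
        endUpper F F' q e x * (y.2 - x.2)) + C * (|y.1 - x.1| + |y.2 - x.2|) ^ 2 := by
  obtain ⟨C, hC0, hC⟩ := hF.lapAction_estimates hq he hr
  refine ⟨4 * C, by positivity, fun x y h1 h2 h3 h4 h5 h6 => ?_⟩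
  refine (hC _ _ _ _ h1 h2 h3 h4 h5 h6).1.trans ?_
  have h7 : |y.2 - y.1 - (x.2 - x.1)| ≤ |y.1 - x.1| + |y.2 - x.2| := by
    have : y.2 - y.1 - (x.2 - x.1) = (y.2 - x.2) - (y.1 - x.1) := by ring
    rw [this, add_comm]
    exact abs_sub _ _
  have h8 : C * (|y.1 - x.1| + |y.2 - y.1 - (x.2 - x.1)|) ^ 2 ≤
      C * (2 * (|y.1 - x.1| + |y.2 - x.2|)) ^ 2 := by
    gcongr
    have := abs_nonneg (y.2 - x.2)
    linarith
  have h9 : partA F' x.1 (x.2 - x.1) (lapMin F q e x.1 (x.2 - x.1)) * (y.1 - x.1) +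
      partH F F' q e x.1 (x.2 - x.1) (lapMin F q e x.1 (x.2 - x.1)) * (y.2 - y.1 - (x.2 - x.1)) =
      endLower F F' q e x * (y.1 - x.1) + endUpper F F' q e x * (y.2 - x.2) := by
    unfold endLower endUpper; ring
  rw [h9]
  unfold endAction
  linarith

/-- Differentiating the action with the minimising profile held fixed leaves only third derivatives
at the turning points. This ties critical points of the reduced action to laps that can be
reflected. -/
lemma IsPotential.exists_profile (hF : IsPotential F F') (hq : 0 ≤ q) (he : 0 < e) {x : ℝ × ℝ}
    (hx : x ∈ crossing) : ∃ P₂ P₃, LapProfile F F' q e x.1 (x.2 - x.1)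
      (prim (lapMin F q e x.1 (x.2 - x.1))) P₂ P₃ ∧
      endUpper F F' q e x = -P₃ 1 ∧ endLower F F' q e x = P₃ 0 := by
  have hh : 0 < x.2 - x.1 := by linarith [hx.2.2]
  obtain ⟨hg, hm⟩ := hF.lapMin_spec (a := x.1) hq he hh
  have hη := lapBarrier_pos he hh
  obtain ⟨P₂, P₃, hP⟩ := exists_lapProfile hF.hasDerivAt hF.cont' hh hη hg hm
  have h1 : endUpper F F' q e x = -P₃ 1 := hP.partH_eq hF.cont hF.cont' hh hη hg hm
  refine ⟨P₂, P₃, hP, h1, ?_⟩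
  unfold endLower
  rw [h1, hP.partA_eq hF.cont' hη hg]
  ring

/-- A constrained critical point of the action away from the origin is a genuine critical point,
hence yields a periodic solution. -/
lemma IsPotential.exists_periodic_of_isKKT (hF : IsPotential F (deriv F)) (hF0 : F 0 = 0)
    (hq : 0 ≤ q) (he : 0 < e) {l m δ : ℝ} (hl : 0 < l) (hm : 0 < m)
    (hqlm : q = 2 * (m ^ 2 - l ^ 2)) (hδ : 0 < δ)
    (hpos : ∀ t ∈ Icc 0 δ, (l ^ 2 + m ^ 2) ^ 2 * t ≤ deriv F t)
    (hneg : ∀ t ∈ Icc 0 δ, (l ^ 2 + m ^ 2) ^ 2 * t ≤ -deriv F (-t))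
    (hε : √(2 * e) * Real.sinh (l * (Real.pi / m)) < 2 * l * m * δ) {x : ℝ × ℝ}
    (hx : x ∈ crossing) (hxδ : δ ≤ ‖x‖)
    (hK : IsKKT (endLower F (deriv F) q e) (endUpper F (deriv F) q e) x) :
    ∃ u, IsSwiftHohenbergSolution F q u ∧ IsNontrivialPeriodic u := by
  have hh : 0 < x.2 - x.1 := by linarith [hx.2.2]
  obtain ⟨hg, hmin⟩ := hF.lapMin_spec (a := x.1) hq he hh
  obtain ⟨P₂, P₃, hP, hU, hL⟩ := hF.exists_profile hq he hx
  obtain ⟨T, u₀, u₁, u₂, u₃, hlap, h0, hT, h20, h2T, h30, h3T⟩ :=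
    hP.exists_lap hh (lapBarrier_pos he hh) hg
  rw [add_sub_cancel] at hT h2T
  rw [← h3T] at hU
  rw [← h30] at hL
  have hend : ∀ v : ℝ, v ^ 2 = 2 * (F 0 + e) → |v| ≤ √(2 * e) := fun v hv => by
    rw [hF0, zero_add] at hv
    rw [← hv, Real.sqrt_sq_eq_abs]
  -- If a = 0, the constraint yields u''' ≤ 0 at a lap leaving the equilibrium with u''² = 2e, which
  -- the saddle-focus forbids. The case b = 0 is the same for −u(T − x).
  have hA : endLower F (deriv F) q e x = 0 := by
    rcases hx.1.lt_or_eq with h | h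
    · exact hK.1 h
    · exfalso
      have hle := hK.2.1 h
      rw [hL] at hle
      rw [h] at h0 h20
      refine hlap.false_of_saddleFocus hl hm hqlm hδ hpos h0 ?_
        ((le_abs_self _).trans (hend _ h20)) (Real.sqrt_nonneg _) hle hε
      rw [hT]
      rw [Prod.norm_def, h, norm_zero, max_eq_right (norm_nonneg _), Real.norm_eq_abs,
        abs_of_nonneg hx.2.1] at hxδ
      exact hxδ
  have hB : endUpper F (deriv F) q e x = 0 := by
    rcases hx.2.1.lt_or_eq with h | h
    · exact hK.2.2.1 h
    · exfalso
      have hle := hK.2.2.2 h.symm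
      rw [hU] at hle
      rw [← h] at hT h2T
      refine hlap.reflect.false_of_saddleFocus hl hm hqlm hδ hneg (by simp [hT]) ?_
        (ε := √(2 * e)) ?_ (Real.sqrt_nonneg _) ?_ hε
      · rw [sub_self, h0]
        rw [Prod.norm_def, ← h, norm_zero, max_eq_left (norm_nonneg _), Real.norm_eq_abs,
          abs_of_nonpos hx.1] at hxδ
        exact hxδ
      · rw [sub_zero]
        exact (neg_le_abs _).trans (hend _ h2T)
      · rw [sub_zero]; linarith
  rw [hA] at hL
  rw [hB] at hU
  exact hlap.exists_periodic hF.cont' hL.symm (by linarith)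

lemma IsPotential.le_endAction (hF : IsPotential F F') (hq : 0 ≤ q) (he : 0 < e)
    {σ κ δ : ℝ} (hκ0 : 0 ≤ κ) (hκ : κ < 1 / 2) (hκσ : q ^ 2 / 16 ≤ (1 / 2 - κ) * (σ / 2 - κ))
    (hσ : ∀ t, |t| ≤ δ → σ / 2 * t ^ 2 ≤ F t) {x : ℝ × ℝ} (hx : x ∈ crossing) (hxδ : ‖x‖ ≤ δ) :
    2 * κ / 3 * ‖x‖ ^ 2 ≤ endAction F q e x := by
  have hh : 0 < x.2 - x.1 := by linarith [hx.2.2]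
  obtain ⟨hg, hmin⟩ := hF.lapMin_spec (a := x.1) hq he hh
  obtain ⟨P₂, P₃, hP, -, -⟩ := hF.exists_profile hq he hx
  obtain ⟨-, -, n1, n2⟩ := crossing_norm hx
  have h1 := (abs_le.1 (n1.trans hxδ)).1
  have h2 := (abs_le.1 (n2.trans hxδ)).2
  have := hP.barrier hF.cont he.le hh (lapBarrier_pos he hh) hg hmin hκ0 hκ hκσ hσ hx.1
    (by rw [add_sub_cancel]; exact hx.2.1) h1 (by rw [add_sub_cancel]; exact h2)
  rw [add_sub_cancel] at this
  refine le_trans ?_ this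
  gcongr
  rcases max_choice ‖x.1‖ ‖x.2‖ with h | h
  · rw [Prod.norm_def, h, Real.norm_eq_abs, sq_abs]; nlinarith [sq_nonneg x.2]
  · rw [Prod.norm_def, h, Real.norm_eq_abs, sq_abs]; nlinarith [sq_nonneg x.1]

lemma IsPotential.endAction_le (hF : IsPotential F F') (hq : 0 ≤ q) (he : 0 < e) {δ M : ℝ}
    (hM : ∀ t, |t| ≤ δ → F t ≤ M) {x : ℝ × ℝ} (hx : x ∈ crossing) (hxδ : ‖x‖ ≤ δ) :
    endAction F q e x ≤ Real.pi * δ ^ 2 / 4 + Real.pi * (M + e) := by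
  have hh : 0 < x.2 - x.1 := by linarith [hx.2.2]
  obtain ⟨-, n0, n1, n2⟩ := crossing_norm hx
  refine (hF.lapAction_le_of_le hq he hh (m := M) fun s hs => hM _ (abs_le.2 ⟨?_, ?_⟩)).trans ?_
  · have := mul_nonneg hh.le hs.1
    linarith [(abs_le.1 (n1.trans hxδ)).1]
  · have := mul_le_mul_of_nonneg_left hs.2 hh.le
    linarith [(abs_le.1 (n2.trans hxδ)).2]
  · have h3 : (x.2 - x.1) ^ 2 ≤ (2 * δ) ^ 2 := by gcongr; linarith
    have := mul_le_mul_of_nonneg_left h3 Real.pi_pos.le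
    linarith

/-! ### Monotonicity in the parameter and bounds on the height. -/

lemma lapEnergy_sub (F : ℝ → ℝ) (q q' e a h : ℝ) (g : L2I) :
    lapEnergy F q' e a h g - lapEnergy F q e a h g =
      (q - q') / 2 * (h * ∫ s in (0 : ℝ)..1, (prim g s) ^ (2 / 3 : ℝ)) := by
  rw [lapEnergy_eq, lapEnergy_eq]; ring

lemma Above.integral_nonneg {η : ℝ} {g : L2I} (hg : Above η g) (hη : 0 < η) (r : ℝ) :
    0 ≤ ∫ s in (0 : ℝ)..1, (prim g s) ^ r :=
  intervalIntegral.integral_nonneg zero_le_one fun _ hs => Real.rpow_nonneg (hg.nonneg hη hs) _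

/-- The minimiser for q' is a competitor for q, and only the term −(q/2) ∫ u'² depends on the
parameter. -/
lemma IsPotential.endAction_sub_le (hF : IsPotential F F') {q' : ℝ} (hq' : 0 ≤ q') (hq : 0 ≤ q)
    (he : 0 < e) {x : ℝ × ℝ} (hx : x ∈ crossing) :
    (q - q') / 2 * ((x.2 - x.1) *
      ∫ s in (0 : ℝ)..1, (prim (lapMin F q' e x.1 (x.2 - x.1)) s) ^ (2 / 3 : ℝ)) ≤
    endAction F q' e x - endAction F q e x := by
  have hh : 0 < x.2 - x.1 := by linarith [hx.2.2]
  obtain ⟨hg, -⟩ := hF.lapMin_spec (a := x.1) hq' he hh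
  have h1 := hF.lapAction_le (a := x.1) hq he hh (lapBarrier_pos he hh) hg
  have h2 := lapEnergy_sub F q q' e x.1 (x.2 - x.1) (lapMin F q' e x.1 (x.2 - x.1))
  have h3 : 0 ≤ 1 / (9 * (x.2 - x.1)) *
      ‖lapMin F q' e x.1 (x.2 - x.1) - lapMin F q e x.1 (x.2 - x.1)‖ ^ 2 := by positivity
  unfold endAction
  have h4 : lapAction F q' e x.1 (x.2 - x.1) =
    lapEnergy F q' e x.1 (x.2 - x.1) (lapMin F q' e x.1 (x.2 - x.1)) := rfl
  linarith

lemma IsPotential.endAction_antitone (hF : IsPotential F F') {q' : ℝ} (hq' : 0 ≤ q') (hqq : q' ≤ q)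
    (he : 0 < e) {x : ℝ × ℝ} (hx : x ∈ crossing) : endAction F q e x ≤ endAction F q' e x := by
  have hh : 0 < x.2 - x.1 := by linarith [hx.2.2]
  have h1 := hF.endAction_sub_le hq' (hq'.trans hqq) he hx
  have h2 := (hF.lapMin_spec (a := x.1) hq' he hh).1.integral_nonneg (lapBarrier_pos he hh) (2 / 3)
  have h3 : 0 ≤ (q - q') / 2 * ((x.2 - x.1) *
      ∫ s in (0 : ℝ)..1, (prim (lapMin F q' e x.1 (x.2 - x.1)) s) ^ (2 / 3 : ℝ)) :=
    mul_nonneg (by linarith) (mul_nonneg hh.le h2)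
  linarith

lemma two_le_rpow_add {x : ℝ} (hx : 0 < x) : 2 ≤ x ^ (2 / 3 : ℝ) + x ^ (-(2 / 3) : ℝ) := by
  have h : 0 < x ^ (2 / 3 : ℝ) := by positivity
  rw [Real.rpow_neg hx.le]
  have h2 : x ^ (2 / 3 : ℝ) + (x ^ (2 / 3 : ℝ))⁻¹ - 2 =
      (x ^ (2 / 3 : ℝ))⁻¹ * (x ^ (2 / 3 : ℝ) - 1) ^ 2 := by
    field_simp
    ring
  have h3 : 0 ≤ (x ^ (2 / 3 : ℝ))⁻¹ * (x ^ (2 / 3 : ℝ) - 1) ^ 2 := by positivity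
  linarith

/-- If the action does not vary too fast with the parameter `q`, the lap cannot be too high. -/
lemma IsPotential.height_le (hF : IsPotential F F') {q' K K' : ℝ} (hq' : 0 ≤ q') (hqq : q' < q)
    (he : 0 < e) {x : ℝ × ℝ} (hx : x ∈ crossing) (h1 : endAction F q' e x ≤ K)
    (h2 : endAction F q' e x - endAction F q e x ≤ K' * (q - q')) :
    x.2 - x.1 ≤ K' + (K + q * K') / (2 * e) := by
  have hh : 0 < x.2 - x.1 := by linarith [hx.2.2]
  have hη := lapBarrier_pos he hh
  obtain ⟨hg, -⟩ := hF.lapMin_spec (a := x.1) hq' he hh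
  have h3 := hF.endAction_sub_le hq' (hq'.trans hqq.le) he hx
  have h4 : endAction F q' e x =
    lapEnergy F q' e x.1 (x.2 - x.1) (lapMin F q' e x.1 (x.2 - x.1)) := rfl
  rw [lapEnergy_eq] at h4
  set g := lapMin F q' e x.1 (x.2 - x.1)
  set h := x.2 - x.1
  have hFc := hF.cont
  have i1 := intervalIntegrable_prim_rpow g (r := 2 / 3) (by norm_num)
  have i2 : IntervalIntegrable (fun s => (prim g s) ^ (-(2 / 3) : ℝ)) volume 0 1 := by
    simpa using hg.intervalIntegrable hη (k := fun _ => 1) continuousOn_const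
  have i3 := hg.intervalIntegrable hη (k := fun s => F (x.1 + h * s) + e) (by fun_prop)
  have h5 : 2 ≤ (∫ s in (0 : ℝ)..1, (prim g s) ^ (2 / 3 : ℝ)) +
      ∫ s in (0 : ℝ)..1, (prim g s) ^ (-(2 / 3) : ℝ) := by
    rw [← intervalIntegral.integral_add i1 i2]
    have := intervalIntegral.integral_mono_on_of_le_Ioo zero_le_one
      (intervalIntegrable_const (c := (2 : ℝ))) (i1.add i2) fun s hs =>
        two_le_rpow_add (hg.pos hη hs)
    simpa using this
  have h6 : e * (∫ s in (0 : ℝ)..1, (prim g s) ^ (-(2 / 3) : ℝ)) ≤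
      ∫ s in (0 : ℝ)..1, (F (x.1 + h * s) + e) * (prim g s) ^ (-(2 / 3) : ℝ) := by
    rw [← intervalIntegral.integral_const_mul]
    refine intervalIntegral.integral_mono_on zero_le_one (i2.const_mul e) i3 fun s hs => ?_
    have := hF.nonneg (x.1 + h * s)
    exact mul_le_mul_of_nonneg_right (by linarith) (Real.rpow_nonneg (hg.nonneg hη hs) _)
  have hB0 := hg.integral_nonneg hη (2 / 3)
  set B := ∫ s in (0 : ℝ)..1, (prim g s) ^ (2 / 3 : ℝ)
  set V := ∫ s in (0 : ℝ)..1, (prim g s) ^ (-(2 / 3) : ℝ)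
  set W := ∫ s in (0 : ℝ)..1, (F (x.1 + h * s) + e) * (prim g s) ^ (-(2 / 3) : ℝ)
  -- Here hB is ∫ u'² and hV is the duration of the lap. The first is controlled by the variation in
  -- q, the second by the action since F + e ≥ e, and y^{2/3} + y^{-2/3} ≥ 2 turns both into a bound
  -- for h.
  have h7 : h * B ≤ 2 * K' := by
    have : (q - q') * (h * B) ≤ (q - q') * (2 * K') := by linarith
    exact le_of_mul_le_mul_left this (by linarith)
  have h8 : 0 ≤ 2 / (9 * h) * ‖g‖ ^ 2 := by positivity
  have h9 : q' * (h * B) ≤ q * (2 * K') :=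
    mul_le_mul hqq.le h7 (by positivity) (by linarith)
  have h10 : h * V * e ≤ K + q * K' := by
    have := mul_le_mul_of_nonneg_left h6 hh.le
    linarith
  have h11 : h * V ≤ (K + q * K') / e := by rwa [le_div_iff₀ he]
  have h12 := mul_le_mul_of_nonneg_left h5 hh.le
  have h13 : (K + q * K') / (2 * e) = (K + q * K') / e / 2 := by field_simp
  rw [h13]
  linarith

end

/-! ### The mountain pass and the monotonicity trick. -/

/-- A path of laps from `x₀` to a lap of negative action. -/
structure IsPass (F : ℝ → ℝ) (q e : ℝ) (x₀ : ℝ × ℝ) (γ : ℝ → ℝ × ℝ) : Prop where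
  cont : ContinuousOn γ (Icc 0 1)
  mapsTo : MapsTo γ (Icc 0 1) crossing
  left : γ 0 = x₀
  right : endAction F q e (γ 1) < 0

/-- Upper bounds of the action along admissible paths. -/
def passBounds (F : ℝ → ℝ) (e : ℝ) (x₀ : ℝ × ℝ) (q : ℝ) : Set ℝ :=
  {m | ∃ γ, IsPass F q e x₀ γ ∧ ∀ t ∈ Icc (0 : ℝ) 1, endAction F q e (γ t) ≤ m}

/-- The mountain pass level. -/
noncomputable def passLevel (F : ℝ → ℝ) (e : ℝ) (x₀ : ℝ × ℝ) (q : ℝ) : ℝ :=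
  sInf (passBounds F e x₀ q)

section
variable {F F' : ℝ → ℝ} {q e : ℝ} {x₀ : ℝ × ℝ}

lemma passBounds_bddBelow : BddBelow (passBounds F e x₀ q) :=
  ⟨endAction F q e x₀, fun _ ⟨_, hγ, hm⟩ => by
    rw [← hγ.left]; exact hm 0 ⟨le_rfl, zero_le_one⟩⟩

lemma IsPotential.passBounds_subset (hF : IsPotential F F') (he : 0 < e) {q' : ℝ} (hq' : 0 ≤ q')
    (hqq : q' ≤ q) : passBounds F e x₀ q' ⊆ passBounds F e x₀ q := fun _ ⟨γ, hγ, hm⟩ =>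
  ⟨γ, ⟨hγ.cont, hγ.mapsTo, hγ.left, (hF.endAction_antitone hq' hqq he
    (hγ.mapsTo ⟨zero_le_one, le_rfl⟩)).trans_lt hγ.right⟩, fun t ht =>
    (hF.endAction_antitone hq' hqq he (hγ.mapsTo ht)).trans (hm t ht)⟩

lemma IsPotential.antitoneOn_passLevel (hF : IsPotential F F') (he : 0 < e) {J : Set ℝ}
    (hJ : ∀ q ∈ J, 0 ≤ q ∧ (passBounds F e x₀ q).Nonempty) :
    AntitoneOn (passLevel F e x₀) J := fun q' hq' _ _ hqq =>
  csInf_le_csInf passBounds_bddBelow (hJ q' hq').2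
    (hF.passBounds_subset he (hJ q' hq').1 hqq)

/-- A segment along the side b = 0 reaches a lap (−H, 0) of negative action. -/
lemma IsPotential.passBounds_nonempty (hF : IsPotential F F') (hq : 0 < q) (he : 0 < e) {l C : ℝ}
    (hl : 24 * l < q ^ 2) (hFl : ∀ t ≤ 0, F t ≤ l * t ^ 2 + C) {ρ : ℝ} (hρ : 0 < ρ) :
    (passBounds F e (-ρ, 0) q).Nonempty := by
  obtain ⟨H, hH0, hHρ, hH⟩ := hF.exists_lapAction_neg hq he hl hFl ρ
  set γ : ℝ → ℝ × ℝ := fun t => (-(ρ + t * (H - ρ)), 0) with hγ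
  have hc : Continuous γ := by simp only [hγ]; fun_prop
  have hm : MapsTo γ (Icc 0 1) crossing := fun t ht => by
    have : 0 ≤ t * (H - ρ) := mul_nonneg ht.1 (by linarith)
    exact ⟨by simp only [hγ]; linarith, le_rfl, by simp only [hγ]; linarith⟩
  obtain ⟨m, hm'⟩ := isCompact_Icc.exists_bound_of_continuousOn
    ((hF.continuousOn_endAction hq.le he).comp hc.continuousOn hm)
  refine ⟨m, γ, ⟨hc.continuousOn, hm, by simp [hγ], ?_⟩, fun t ht =>
    (le_abs_self _).trans (hm' t ht)⟩
  have h1 : γ 1 = (-H, 0) := Prod.ext (by simp only [hγ]; ring) rfl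
  rw [h1]
  simpa [endAction] using hH

lemma IsPass.exists_norm_eq {γ : ℝ → ℝ × ℝ} (hγ : IsPass F q e x₀ γ) {δ : ℝ} (h0 : ‖x₀‖ ≤ δ)
    (hpos : ∀ x ∈ crossing, ‖x‖ ≤ δ → 0 ≤ endAction F q e x) :
    ∃ t ∈ Icc (0 : ℝ) 1, ‖γ t‖ = δ := by
  have h1 : δ ≤ ‖γ 1‖ := by
    by_contra! h
    exact absurd hγ.right (not_lt.2 (hpos _ (hγ.mapsTo ⟨zero_le_one, le_rfl⟩) h.le))
  exact intermediate_value_Icc zero_le_one hγ.cont.norm ⟨by rw [hγ.left]; exact h0, h1⟩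

/-- If the mountain pass level depends on `q` in a Lipschitz manner from the left, then there is
a critical point of the action. -/
lemma IsPotential.exists_isKKT (hF : IsPotential F F') (hq : 0 < q) (he : 0 < e) {c₀ ρ δ M : ℝ}
    (hρ : 0 < ρ) (hρδ : ρ ≤ δ) (hx₀ : ‖x₀‖ ≤ ρ) (hc₀ : 0 < c₀) (hM : 0 ≤ M)
    (hpos : ∀ x ∈ crossing, ‖x‖ ≤ δ → 0 ≤ endAction F q e x)
    (hmount : ∀ x ∈ crossing, ‖x‖ = δ → c₀ ≤ endAction F q e x)
    (hsmall : ∀ x ∈ crossing, ‖x‖ ≤ 2 * ρ → endAction F q e x < c₀ / 2)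
    (hne : ∀ᶠ q' in 𝓝[<] q, (passBounds F e x₀ q').Nonempty)
    (hlip : ∀ᶠ q' in 𝓝[<] q, passLevel F e x₀ q' ≤ passLevel F e x₀ q + M * (q - q')) :
    ∃ x ∈ crossing, 2 * ρ ≤ ‖x‖ ∧ IsKKT (endLower F F' q e) (endUpper F F' q e) x := by
  by_contra! hcon
  have hev : ∀ r > q - q, ∀ᶠ q' in 𝓝[<] q, q - q' < r := fun r hr =>
    (((continuous_const (y := q)).sub continuous_id).tendsto q).mono_left
      nhdsWithin_le_nhds |>.eventually_lt_const hr
  rw [sub_self] at hev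
  have hqpos : ∀ᶠ q' in 𝓝[<] q, 0 < q' :=
    (lt_mem_nhds hq).filter_mono nhdsWithin_le_nhds
  have hself : ∀ᶠ q' in 𝓝[<] q, q' < q := self_mem_nhdsWithin
  set c := passLevel F e x₀ q with hc
  have hneq : (passBounds F e x₀ q).Nonempty := by
    obtain ⟨q', h1, h2, h3⟩ := (hne.and (hqpos.and hself)).exists
    exact h1.mono (hF.passBounds_subset he h2.le (le_of_lt h3))
  have hcc₀ : c₀ ≤ c := le_csInf hneq fun m ⟨γ, hγ, hm⟩ => by
    obtain ⟨t, ht, htδ⟩ := hγ.exists_norm_eq (hx₀.trans hρδ) hpos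
    exact (hmount _ (hγ.mapsTo ht) htδ).trans (hm t ht)
  -- The radius R is the height bound of `IsPotential.height_le` for K = c + M + 1 and K' = M + 2.
  -- It does not depend on q', so the gain m is fixed before q' is chosen.
  obtain ⟨φ, m, hm0, hφc, hφm, hφS, hφid, hφdec⟩ := exists_deformation
    (hF.continuousOn_endAction hq.le he) (hF.continuousOn_endLower hq.le he)
    (hF.continuousOn_endUpper hq.le he) (hF.endAction_semiconcave hq.le he)
    (R := (M + 2) + ((c + M + 1) + q * (M + 2)) / (2 * e)) (c := c₀ / 2) hρ
    fun x hx h1 _ _ => hcon x hx h1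
  obtain ⟨q', hn', hl', hpos', hlt', ht1, ht2, ht3⟩ := (hne.and (hlip.and (hqpos.and
    (hself.and ((hev 1 one_pos).and
    ((hev (c₀ / 2) (by positivity)).and (hev (m / (M + 1)) (by positivity)))))))).exists
  set t := q - q' with ht
  have ht0 : 0 < t := by simp only [ht]; linarith
  rw [lt_div_iff₀ (by linarith)] at ht3
  -- The path is nearly optimal for q' < q. By monotonicity it is also admissible for q, with action
  -- at most c + (M + 1)t for both parameters.
  obtain ⟨m', ⟨γ, hγ, hγm⟩, hm'⟩ := exists_lt_of_csInf_lt hn'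
    (show sInf (passBounds F e x₀ q') < passLevel F e x₀ q' + t from lt_add_of_pos_right _ ht0)
  have hγbd : ∀ s ∈ Icc (0 : ℝ) 1, endAction F q' e (γ s) ≤ c + (M + 1) * t := fun s hs => by
    have := hγm s hs
    linarith
  have hanti : ∀ s ∈ Icc (0 : ℝ) 1, endAction F q e (γ s) ≤ endAction F q' e (γ s) := fun s hs =>
    hF.endAction_antitone hpos'.le hlt'.le he (hγ.mapsTo hs)
  -- At points of the path with action at least c − t for q, the two actions differ by at most (M +
  -- 2)t, so the height is bounded and the deformation gains m > (M + 1)t. Both entries of the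
  -- maximum lie below c, which contradicts the definition of the level.
  have hbound : max (c - t) (c + (M + 1) * t - m) ∈ passBounds F e x₀ q := by
    refine ⟨φ ∘ γ, ⟨hφc.comp hγ.cont hγ.mapsTo, hφm.comp hγ.mapsTo, ?_, ?_⟩, fun s hs => ?_⟩
    · have h0 := hγ.mapsTo (show (0 : ℝ) ∈ Icc (0 : ℝ) 1 from ⟨le_rfl, zero_le_one⟩)
      rw [Function.comp_apply, hφid _ h0 (by rw [hγ.left]; exact hx₀), hγ.left]
    · have h1 : (1 : ℝ) ∈ Icc (0 : ℝ) 1 := ⟨zero_le_one, le_rfl⟩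
      exact ((hφS _ (hγ.mapsTo h1)).trans (hanti 1 h1)).trans_lt hγ.right
    · have hx := hγ.mapsTo hs
      rcases lt_or_ge (endAction F q e (γ s)) (c - t) with h | h
      · exact ((hφS _ hx).trans h.le).trans (le_max_left _ _)
      · refine le_trans ?_ (le_max_right _ _)
        have b1 := hγbd s hs
        have b2 : (M + 1) * t ≤ M + 1 := by
          have := mul_le_mul_of_nonneg_left ht1.le (show 0 ≤ M + 1 by linarith)
          linarith
        have hR := hF.height_le (K := c + M + 1) (K' := M + 2) hpos'.le hlt' he hx (by linarith)
          (by rw [← ht]; linarith)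
        have hc2 : c₀ / 2 ≤ endAction F q e (γ s) := by linarith
        have hdec := hφdec _ hx (by
          by_contra! hn
          exact absurd (hsmall _ hx hn.le) (not_lt.2 hc2))
          ((crossing_norm hx).1.trans hR) hc2
        have := hanti s hs
        simp only [Function.comp_apply]
        linarith
  have hfin := csInf_le passBounds_bddBelow hbound
  change c ≤ _ at hfin
  rcases le_max_iff.1 hfin with h | h <;> linarith

end

/-! ### Quadratic bounds for the potential and choice of parameters. -/

lemma exists_quadratic_bound {F : ℝ → ℝ} (hF : Continuous F) {p : ℝ}
    (h : 24 * limsupQuotAtBot F < ((p : ℝ) : EReal)) :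
    ∃ l C : ℝ, 24 * l < p ∧ ∀ t ≤ 0, F t ≤ l * t ^ 2 + C := by
  obtain ⟨l, hl, hlim⟩ : ∃ l : ℝ, 24 * l < p ∧ limsupQuotAtBot F < (l : EReal) := by
    induction hv : limsupQuotAtBot F using EReal.rec with
    | bot => exact ⟨(p - 1) / 24, by linarith, EReal.bot_lt_coe _⟩
    | coe r =>
      rw [hv] at h
      have h' : 24 * r < p := by
        rw [← EReal.coe_lt_coe_iff, EReal.coe_mul]
        exact h
      exact ⟨(r + p / 24) / 2, by linarith, by rw [EReal.coe_lt_coe_iff]; linarith⟩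
    | top =>
      rw [hv, EReal.mul_top_of_pos (by norm_num)] at h
      exact absurd h not_top_lt
  have hev : ∀ᶠ t : ℝ in atBot, F t / t ^ 2 < l := by
    filter_upwards [eventually_lt_of_limsup_lt hlim] with t ht
    exact_mod_cast ht
  obtain ⟨N, hN⟩ := eventually_atBot.1 (hev.and (eventually_lt_atBot (0 : ℝ)))
  obtain ⟨C, hC⟩ := isCompact_Icc.exists_bound_of_continuousOn (s := Icc N 0)
    (f := fun t => F t - l * t ^ 2) (by fun_prop)
  refine ⟨l, max C 0, hl, fun t ht => ?_⟩
  rcases le_total t N with h1 | h1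
  · obtain ⟨h2, h3⟩ := hN t h1
    rw [div_lt_iff₀ (by nlinarith)] at h2
    linarith [le_max_right C 0]
  · have := (le_abs_self _).trans (hC t ⟨h1, ht⟩)
    linarith [le_max_left C 0]

/-- Near a nondegenerate minimum the potential dominates a quadratic one. -/
lemma exists_quadratic_minorant {F : ℝ → ℝ} (hF : ContDiff ℝ 2 F) (hF0 : F 0 = 0)
    (hFmin : ∀ t, 0 ≤ F t) {σ : ℝ} (hσ : σ < iteratedDeriv 2 F 0) :
    ∃ δ > 0, (∀ t ∈ Icc 0 δ, σ * t ≤ deriv F t) ∧ (∀ t ∈ Icc 0 δ, σ * t ≤ -deriv F (-t)) ∧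
      ∀ t, |t| ≤ δ → σ / 2 * t ^ 2 ≤ F t := by
  have h1 : ContDiff ℝ (1 + 1) F := by convert hF using 1; norm_num
  obtain ⟨hd, -, h2⟩ := contDiff_succ_iff_deriv.1 h1
  have hd2 := (h2.differentiable (by norm_num) 0).hasDerivAt
  rw [iteratedDeriv_succ, iteratedDeriv_one] at hσ
  have h00 : deriv F 0 = 0 := IsLocalMin.deriv_eq_zero
    (Eventually.of_forall fun t => by rw [hF0]; exact hFmin t)
  have hsl := (hasDerivAt_iff_tendsto_slope_zero.1 hd2).eventually_const_lt hσ
  rw [eventually_nhdsWithin_iff] at hsl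
  obtain ⟨ε, hε, hball⟩ := Metric.eventually_nhds_iff.1 hsl
  have key : ∀ t, |t| ≤ ε / 2 → t ≠ 0 → σ < t⁻¹ * deriv F t := fun t ht h0 => by
    have := hball (y := t) (by rw [Real.dist_eq, sub_zero]; linarith) h0
    simpa [h00] using this
  have kpos : ∀ t ∈ Icc 0 (ε / 2), σ * t ≤ deriv F t := fun t ht => by
    rcases ht.1.eq_or_lt with h | h
    · rw [← h, h00, mul_zero]
    · have := key t (by rw [abs_of_pos h]; exact ht.2) h.ne'
      rw [inv_mul_eq_div, lt_div_iff₀ h] at this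
      exact this.le
  have kneg : ∀ t ∈ Icc 0 (ε / 2), σ * t ≤ -deriv F (-t) := fun t ht => by
    rcases ht.1.eq_or_lt with h | h
    · rw [← h, neg_zero, h00, mul_zero, neg_zero]
    · have := key (-t) (by rw [abs_neg, abs_of_pos h]; exact ht.2) (by linarith)
      have h3 : (-t)⁻¹ * deriv F (-t) = -deriv F (-t) / t := by
        rw [inv_neg]; ring
      rw [h3, lt_div_iff₀ h] at this
      exact this.le
  have quad : ∀ G : ℝ → ℝ, G 0 = 0 → Differentiable ℝ G →
      (∀ t ∈ Icc 0 (ε / 2), σ * t ≤ deriv G t) → ∀ t ∈ Icc 0 (ε / 2), σ / 2 * t ^ 2 ≤ G t := by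
    intro G hG0 hG hG' t ht
    have hda : ∀ x, HasDerivAt (fun t => G t - σ / 2 * t ^ 2) (deriv G x - σ * x) x := fun x =>
      ((hG x).hasDerivAt.sub (((hasDerivAt_id' x).pow 2).const_mul (σ / 2))).congr_deriv (by
        norm_num; ring)
    have hmono : MonotoneOn (fun t => G t - σ / 2 * t ^ 2) (Icc 0 (ε / 2)) := by
      refine monotoneOn_of_deriv_nonneg (convex_Icc _ _)
        (fun x _ => (hda x).continuousAt.continuousWithinAt)
        (fun x _ => (hda x).differentiableAt.differentiableWithinAt) fun x hx => ?_
      rw [(hda x).deriv]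
      linarith [hG' x (interior_subset hx)]
    have := hmono ⟨le_rfl, ht.1.trans ht.2⟩ ht ht.1
    simp only [hG0] at this
    linarith
  refine ⟨ε / 2, by positivity, kpos, kneg, fun t ht => ?_⟩
  rcases le_total 0 t with h | h
  · exact quad F hF0 hd kpos t ⟨h, by rwa [abs_of_nonneg h] at ht⟩
  · have := quad (fun s => F (-s)) (by simpa using hF0) (hd.comp differentiable_neg)
      (fun s hs => by rw [deriv_comp_neg]; exact kneg s hs) (-t)
      ⟨by linarith, by rwa [abs_of_nonpos h] at ht⟩
    simpa using this

lemma isOpen_superquadratic (L : EReal) : IsOpen {q : ℝ | 0 < q ∧ L < ((q ^ 2 : ℝ) : EReal)} :=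
  (isOpen_lt continuous_const continuous_id).inter
    (isOpen_lt continuous_const (continuous_coe_real_ereal.comp (continuous_id.pow 2)))

/-- The roots of λ⁴ + qλ² + σ are ±l ± im, with nonzero real parts because q² < 4σ. -/
lemma exists_saddleFocus_exponents {q σ : ℝ} (hq : 0 < q) (hσ : q ^ 2 < 4 * σ) :
    ∃ l m : ℝ, 0 < l ∧ 0 < m ∧ q = 2 * (m ^ 2 - l ^ 2) ∧ (l ^ 2 + m ^ 2) ^ 2 = σ := by
  have hσ0 : 0 ≤ σ := by nlinarith [sq_nonneg q]
  have hs : q / 2 < √σ := Real.lt_sqrt_of_sq_lt (by linarith)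
  have h1 : 0 < (√σ - q / 2) / 2 := by linarith
  have h2 : 0 < (√σ + q / 2) / 2 := by linarith
  refine ⟨√((√σ - q / 2) / 2), √((√σ + q / 2) / 2), Real.sqrt_pos.2 h1, Real.sqrt_pos.2 h2, ?_, ?_⟩
  · rw [Real.sq_sqrt h1.le, Real.sq_sqrt h2.le]; ring
  · rw [Real.sq_sqrt h1.le, Real.sq_sqrt h2.le]
    ring_nf
    exact Real.sq_sqrt hσ0

lemma exists_coercivity {q σ : ℝ} (hσ : q ^ 2 < 4 * σ) :
    ∃ κ : ℝ, 0 < κ ∧ κ < 1 / 2 ∧ q ^ 2 / 16 ≤ (1 / 2 - κ) * (σ / 2 - κ) := by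
  have hσ0 : 0 < σ := by nlinarith [sq_nonneg q]
  -- This κ makes the part of the inequality linear in κ an equality; κ² is the surplus.
  set κ := (4 * σ - q ^ 2) / (8 * (1 + σ)) with hκ
  have hκ0 : 0 < κ := div_pos (by linarith) (by linarith)
  have e1 : κ * (8 * (1 + σ)) = 4 * σ - q ^ 2 := div_mul_cancel₀ _ (by positivity)
  refine ⟨κ, hκ0, ?_, by nlinarith [sq_nonneg κ]⟩
  rw [hκ, div_lt_div_iff₀ (by linarith) two_pos]
  nlinarith [sq_nonneg q]

lemma eventually_passLevel_le {c : ℝ → ℝ} {q : ℝ} (hc : DifferentiableAt ℝ c q) :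
    ∃ M, 0 ≤ M ∧ ∀ᶠ q' in 𝓝[<] q, c q' ≤ c q + M * (q - q') := by
  obtain ⟨M, hM0, hM⟩ := hc.isBigO_sub.exists_nonneg
  refine ⟨M, hM0, ?_⟩
  filter_upwards [hM.bound.filter_mono nhdsWithin_le_nhds, self_mem_nhdsWithin] with q' h1 h2
  have h3 : q' < q := h2
  rw [Real.norm_eq_abs, Real.norm_eq_abs, abs_of_neg (by linarith : q' - q < 0)] at h1
  have := (le_abs_self _).trans h1
  linarith

/-- Periodic solutions exist for parameters at which the mountain pass levels are
differentiable. -/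
lemma exists_periodic_of_differentiableAt {F : ℝ → ℝ} (hF : ContDiff ℝ 2 F) (hF0 : F 0 = 0)
    (hFmin : ∀ t, 0 ≤ F t) {q : ℝ} (hq : 0 < q)
    (hl : 24 * limsupQuotAtBot F < ((q ^ 2 : ℝ) : EReal)) (hq4 : q ^ 2 < 4 * iteratedDeriv 2 F 0)
    (hdiff : ∀ m n : ℕ, DifferentiableAt ℝ
      (passLevel F (1 / ((n : ℝ) + 1)) (-(1 / ((m : ℝ) + 1)), 0)) q) :
    ∃ u : ℝ → ℝ, IsSwiftHohenbergSolution F q u ∧ IsNontrivialPeriodic u := by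
  have hP := IsPotential.of_contDiff hF hFmin
  obtain ⟨σ, hσ1, hσ2⟩ := exists_between (show q ^ 2 / 4 < iteratedDeriv 2 F 0 by linarith)
  have hσq : q ^ 2 < 4 * σ := by linarith
  obtain ⟨δ, hδ, hpos, hneg, hquad⟩ := exists_quadratic_minorant hF hF0 hFmin hσ2
  obtain ⟨l, m, hl0, hm0, hqlm, hlm⟩ := exists_saddleFocus_exponents hq hσq
  obtain ⟨κ, hκ0, hκ2, hκσ⟩ := exists_coercivity hσq
  set c₀ := 2 * κ / 3 * δ ^ 2 with hc₀
  have hc₀p : 0 < c₀ := by positivity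
  have hpi := Real.pi_pos
  have hlimit : Tendsto (fun k : ℕ => 1 / ((k : ℝ) + 1)) atTop (𝓝 0) :=
    tendsto_one_div_add_atTop_nhds_zero_nat
  have hFsmall : ∀ᶠ t in 𝓝 (0 : ℝ), F t < c₀ / (8 * Real.pi) :=
    (hP.cont.tendsto 0).eventually_lt_const (by rw [hF0]; positivity)
  obtain ⟨ε, hε, hball⟩ := Metric.eventually_nhds_iff.1 hFsmall
  -- The choices are ordered: δ fixes the barrier c₀, then ρ makes laps within radius 2ρ cheap
  -- compared with c₀, and finally e is small enough for the saddle-focus argument at distance 2ρ.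
  obtain ⟨k, hk1, hk2, hk3⟩ : ∃ k : ℕ, 2 * (1 / ((k : ℝ) + 1)) < δ ∧ 2 * (1 / ((k : ℝ) + 1)) < ε ∧
      Real.pi * (2 * (1 / ((k : ℝ) + 1))) ^ 2 / 4 < c₀ / 8 := by
    have t1 := hlimit.const_mul 2
    have t2 := ((t1.pow 2).const_mul Real.pi).div_const 4
    simp only [mul_zero, ne_eq, OfNat.ofNat_ne_zero, not_false_eq_true, zero_pow, zero_div] at t1 t2
    exact ((t1.eventually_lt_const hδ).and ((t1.eventually_lt_const hε).and
      (t2.eventually_lt_const (by positivity)))).exists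
  set ρ := 1 / ((k : ℝ) + 1) with hρ
  have hρ0 : 0 < ρ := by positivity
  obtain ⟨n, hn1, hn2⟩ : ∃ n : ℕ, Real.pi * (1 / ((n : ℝ) + 1)) < c₀ / 8 ∧
      √(2 * (1 / ((n : ℝ) + 1))) * Real.sinh (l * (Real.pi / m)) < 2 * l * m * (2 * ρ) := by
    have t1 := hlimit.const_mul Real.pi
    have t2 := ((hlimit.const_mul 2).sqrt).mul_const (Real.sinh (l * (Real.pi / m)))
    simp only [mul_zero, Real.sqrt_zero, zero_mul] at t1 t2
    exact ((t1.eventually_lt_const (by positivity)).and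
      (t2.eventually_lt_const (by positivity))).exists
  set e := 1 / ((n : ℝ) + 1) with he
  have he0 : 0 < e := by positivity
  obtain ⟨M, hM0, hM⟩ := eventually_passLevel_le (hdiff k n)
  have hne : ∀ᶠ q' in 𝓝[<] q, (passBounds F e (-ρ, 0) q').Nonempty := by
    have := (isOpen_superquadratic (24 * limsupQuotAtBot F)).mem_nhds
      (show q ∈ {q : ℝ | 0 < q ∧ 24 * limsupQuotAtBot F < ((q ^ 2 : ℝ) : EReal)} from ⟨hq, hl⟩)
    filter_upwards [nhdsWithin_le_nhds this] with q' hq'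
    obtain ⟨b, C, hb, hC⟩ := exists_quadratic_bound hP.cont hq'.2
    exact hP.passBounds_nonempty hq'.1 he0 hb hC hρ0
  have hbar : ∀ x ∈ crossing, ‖x‖ ≤ δ → 2 * κ / 3 * ‖x‖ ^ 2 ≤ endAction F q e x := fun x hx hxδ =>
    hP.le_endAction hq.le he0 hκ0.le hκ2 hκσ hquad hx hxδ
  obtain ⟨x, hx, hxρ, hxK⟩ := hP.exists_isKKT (x₀ := (-ρ, 0)) (δ := δ) hq he0 hρ0 (by linarith)
    (by rw [Prod.norm_def, norm_zero, norm_neg, Real.norm_of_nonneg hρ0.le, max_eq_left hρ0.le])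
    hc₀p hM0
    (fun x hx hxδ => le_trans (by positivity) (hbar x hx hxδ))
    (fun x hx hxδ => by rw [hc₀, ← hxδ]; exact hbar x hx hxδ.le)
    (fun x hx hxρ => by
      have h1 := hP.endAction_le hq.le he0 (M := c₀ / (8 * Real.pi)) (δ := 2 * ρ)
        (fun t ht => (hball (by rw [Real.dist_eq, sub_zero]; linarith)).le) hx hxρ
      have h2 : Real.pi * (c₀ / (8 * Real.pi) + e) = c₀ / 8 + Real.pi * e := by field_simp
      rw [h2] at h1
      linarith)
    hne hM
  have hsub : Icc 0 (2 * ρ) ⊆ Icc 0 δ := Icc_subset_Icc_right hk1.le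
  exact hP.exists_periodic_of_isKKT hF0 hq.le he0 hl0 hm0 hqlm (by positivity)
    (fun t ht => by rw [hlm]; exact hpos t (hsub ht))
    (fun t ht => by rw [hlm]; exact hneg t (hsub ht)) hn2 hx hxρ hxK

/-- Lebesgue's theorem for the level, which is monotone on the open set of parameters admitting
paths. -/
lemma ae_differentiableAt_passLevel {F : ℝ → ℝ} (hP : IsPotential F (deriv F)) {e ρ : ℝ}
    (he : 0 < e) (hρ : 0 < ρ) : ∀ᵐ q : ℝ ∂volume, 0 < q →
      24 * limsupQuotAtBot F < ((q ^ 2 : ℝ) : EReal) →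
      DifferentiableAt ℝ (passLevel F e (-ρ, 0)) q := by
  set J := {q : ℝ | 0 < q ∧ 24 * limsupQuotAtBot F < ((q ^ 2 : ℝ) : EReal)} with hJ
  have hJo : IsOpen J := isOpen_superquadratic _
  have hanti : AntitoneOn (passLevel F e (-ρ, 0)) J := hP.antitoneOn_passLevel he fun q hq => by
    obtain ⟨l, C, hl, hC⟩ := exists_quadratic_bound hP.cont hq.2
    exact ⟨hq.1.le, hP.passBounds_nonempty hq.1 he hl hC hρ⟩
  have := (ae_restrict_iff' hJo.measurableSet).1
    (hanti.neg.ae_differentiableWithinAt hJo.measurableSet)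
  filter_upwards [this] with q hq h1 h2
  have hmem : q ∈ J := ⟨h1, h2⟩
  simpa using ((hq hmem).differentiableAt (hJo.mem_nhds hmem)).neg

end

theorem theorem1p2 (F : ℝ → ℝ) (hF : ContDiff ℝ 2 F)
    (hF0 : F 0 = 0) (hFmin : ∀ t : ℝ, 0 ≤ F t)
    (hlim : 6 * limsupQuotAtBot F < ((iteratedDeriv 2 F 0 : ℝ) : EReal)) :
    ∀ᵐ q : ℝ ∂volume,
      0 < q →
      24 * limsupQuotAtBot F < ((q ^ 2 : ℝ) : EReal) →
      q ^ 2 < 4 * iteratedDeriv 2 F 0 →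
      ∃ u : ℝ → ℝ, IsSwiftHohenbergSolution F q u ∧ IsNontrivialPeriodic u := by
  -- The values of ρ and e depend on q, so differentiability is required for all reciprocals of
  -- positive integers at once; countability keeps the exceptional set null.
  have hdiff : ∀ᵐ q : ℝ ∂volume, ∀ m n : ℕ, 0 < q →
      24 * limsupQuotAtBot F < ((q ^ 2 : ℝ) : EReal) →
      DifferentiableAt ℝ (passLevel F (1 / ((n : ℝ) + 1)) (-(1 / ((m : ℝ) + 1)), 0)) q :=
    ae_all_iff.2 fun m => ae_all_iff.2 fun n =>
      ae_differentiableAt_passLevel (IsPotential.of_contDiff hF hFmin) (by positivity)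
        (by positivity)
  filter_upwards [hdiff] with q hq h0 h24 h4
  exact exists_periodic_of_differentiableAt hF hF0 hFmin h0 h24 h4 fun m n => hq m n h0 h24
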